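/- Let $\tau\in\mathbb{C}$ be such that $\tau^2$ is a primitive $\ell$-th root of unity, where $\ell$ is odd and $\ell\ge 3$, and put $d=\tau+\tau^{-1}$. The even Temperley–Lieb category $\mathrm{TL}^{ev}(\tau)$ has as objects the even numbers $0,2,4,\dots$. For even $m,n$, $\mathrm{Hom}(m,n)$ is the complex vector space whose basis is the set of $(m,n)$-diagrams, i.e. the perfect matchings of $m$ marked points on the top edge and $n$ marked points on the bottom edge of a rectangle that can be realized by pairwise disjoint curves in the rectangle. The composition $ba$ of an $(m,n)$-diagram $b$ with an $(\ell',m)$-diagram $a$ is $d^{\,r}c$, where $a$ is put on top of $b$, $r$ is the number of closed loops that arise, and $c$ is the diagram left after these loops are removed; the tensor product $m\otimes m'=m+m'$ is given on diagrams by horizontal juxtaposition; both are extended bilinearly. An ideal of $\mathrm{TL}^{ev}(\tau)$ is a family of linear subspaces $J(m,n)\subseteq\mathrm{Hom}(m,n)$, for all even $m,n$, that is closed under composition on either side, and under tensor product on either side, with arbitrary morphisms of $\mathrm{TL}^{ev}(\tau)$; it is non-zero if some $J(m,n)\neq 0$, and proper if some $J(m,n)\ne\mathrm{Hom}(m,n)$.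 The Markov trace $\mathrm{Tr}:\mathrm{Hom}(n,n)\to\mathbb{C}$ is the linear map that sends a diagram $a$ to $d^{c(a)}$, where $c(a)$ is the number of closed loops obtained by joining, for each $i$, the $i$-th top point of $a$ to its $i$-th bottom point outside the rectangle. A morphism $a\in\mathrm{Hom}(n,m)$ is negligible if $\mathrm{Tr}(ab)=0$ for all $b\in\mathrm{Hom}(m,n)$. Then the negligible morphisms form a non-zero proper ideal of $\mathrm{TL}^{ev}(\tau)$, and this is the only non-zero proper ideal of $\mathrm{TL}^{ev}(\tau)$. -/

import Mathlib

namespace TemperleyLieb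

/-- Position of a marked point of a rectangle with `m` points on the top edge (`inl`) and `n` points
on the bottom edge (`inr`), both numbered from left to right, when the boundary of the rectangle is
traversed clockwise from the top left corner. -/
def pos {m n : ℕ} : Fin m ⊕ Fin n → ℕ
  | .inl i => i
  | .inr j => m + j.rev

/-- An equivalence class of `(m, n)`-diagrams, i.e. the pairing of the `m + n` marked points that is
induced by pairwise disjoint curves in the rectangle: a perfect matching (an involution without
fixed points) in which no two pairs separate each other on the boundary. -/
@[ext]
structure Diagram (m n : ℕ) where
  partner : Fin m ⊕ Fin n → Fin m ⊕ Fin n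
  partner_partner : ∀ x, partner (partner x) = x
  partner_ne : ∀ x, partner x ≠ x
  noncrossing : ∀ x y, ¬ (pos x < pos y ∧ pos y < pos (partner x) ∧
    pos (partner x) < pos (partner y))

section Juxtaposition

variable {l m n : ℕ}

/-- Vertical juxtaposition of `a` (above) and `b` (below). The marked points are the top points of
`a`, the bottom points of `a` identified with the top points of `b`, and the bottom points of `b`;
two points are related when they are the ends of one strand of `a` or of `b`. -/
inductive Glue (a : Diagram l m) (b : Diagram m n) :
    Fin l ⊕ Fin m ⊕ Fin n → Fin l ⊕ Fin m ⊕ Fin n → Prop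
  | upper (x : Fin l ⊕ Fin m) : Glue a b (Sum.map id Sum.inl x) (Sum.map id Sum.inl (a.partner x))
  | lower (y : Fin m ⊕ Fin n) : Glue a b (Sum.inr y) (Sum.inr (b.partner y))

/-- The connected components of the juxtaposition. -/
abbrev Component (a : Diagram l m) (b : Diagram m n) : Type := Quot (Glue a b)

/-- The component through a point on the outer boundary (top of `a` or bottom of `b`). -/
def outer (a : Diagram l m) (b : Diagram m n) (x : Fin l ⊕ Fin n) : Component a b :=
  Quot.mk _ (Sum.map id Sum.inr x)

/-- The number of closed loops in the interior of the juxtaposition. -/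
noncomputable def loops (a : Diagram l m) (b : Diagram m n) : ℕ :=
  Nat.card {q : Component a b // ∀ x, outer a b x ≠ q}

/-! Well-definedness of the composite diagram: the caps between the two copies of the middle points
are contracted one after the other, starting with the leftmost one. -/

/-- One contraction: if the points at the positions `P < Q` are adjacent, joining them leaves a
noncrossing matching. -/
theorem contract_noncrossing {V : Type*} (w : V → ℕ) (f : V → V) (S : Set V) (p q : V)
    (hp : p ∈ S) (hq : q ∈ S) (hpq : w p < w q)
    (hadj : ∀ x ∈ S, x ≠ p → x ≠ q → w x < w p ∨ w q < w x)
    (hS : ∀ x ∈ S, f x ∈ S) (hf : ∀ x ∈ S, f (f x) = x)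
    (hn : ∀ x ∈ S, ∀ y ∈ S, ¬ (w x < w y ∧ w y < w (f x) ∧ w (f x) < w (f y)))
    (g : V → V)
    (hgp : ∀ x, f x = p → g x = f q) (hgq : ∀ x, f x = q → g x = f p)
    (hgo : ∀ x, f x ≠ p → f x ≠ q → g x = f x) :
    ∀ x ∈ S, x ≠ p → x ≠ q → ∀ y ∈ S, y ≠ p → y ≠ q →
      ¬ (w x < w y ∧ w y < w (g x) ∧ w (g x) < w (g y)) := by
  intro x hx hxp hxq y hy hyp hyq
  have ax := hadj x hx hxp hxq
  have ay := hadj y hy hyp hyq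
  have fp := hf p hp
  have fq := hf q hq
  have fx := hf x hx
  have fy := hf y hy
  have sp := hS p hp
  have sq := hS q hq
  have sx := hS x hx
  have sy := hS y hy
  have key : ∀ u ∈ S, ∀ v ∈ S,
      ¬ (w u < w v ∧ w v < w (f u) ∧ w (f u) < w (f v)) := hn
  by_cases h1 : f x = p
  · rw [hgp x h1]
    have e1 : f p = x := by rw [← h1, fx]
    by_cases h2 : f y = p
    · rw [hgp y h2]; omega
    · by_cases h3 : f y = q
      · have : f q = y := by rw [← h3, fy]
        rw [this]; omega
      · rw [hgo y h2 h3]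
        have k1 := key x hx y hy
        have k2 := key y hy (f q) sq
        have k3 := key q hq y hy
        have k4 := key y hy q hq
        have by' := hadj (f y) sy h2 h3
        rw [fq] at k2
        rw [h1] at k1
        omega
  · by_cases h1' : f x = q
    · rw [hgq x h1']
      have e1 : f q = x := by rw [← h1', fx]
      by_cases h2 : f y = p
      · have : f p = y := by rw [← h2, fy]
        rw [this]; omega
      · by_cases h3 : f y = q
        · rw [hgq y h3]; omega
        · rw [hgo y h2 h3]
          have k1 := key x hx y hy
          have k2 := key y hy (f p) sp
          have k3 := key p hp y hy
          have k4 := key y hy p hp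
          have by' := hadj (f y) sy h2 h3
          rw [fp] at k2
          rw [h1'] at k1
          omega
    · rw [hgo x h1 h1']
      by_cases h2 : f y = p
      · have e : f p = y := by rw [← h2, fy]
        rw [hgp y h2]
        have k0 := key p hp x hx
        rw [e] at k0
        have k1 := key x hx y hy
        have k2 := key x hx q hq
        have k3 := key (f x) sx (f q) sq
        have k4 := key (f q) sq x hx
        have bx' := hadj (f x) sx h1 h1'
        rw [h2] at k1
        rw [fq, fx] at k3
        rw [fq] at k4
        omega
      · by_cases h3 : f y = q
        · have e : f q = y := by rw [← h3, fy]
          rw [hgq y h3]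
          have k0 := key q hq x hx
          rw [e] at k0
          have k1 := key x hx y hy
          have k2 := key x hx p hp
          have k3 := key (f x) sx (f p) sp
          have k4 := key (f p) sp x hx
          have bx' := hadj (f x) sx h1 h1'
          rw [h3] at k1
          rw [fp, fx] at k3
          rw [fp] at k4
          omega
        · rw [hgo y h2 h3]
          exact key x hx y hy

/-- `k` successive contractions. The relation `E` records connectedness. -/
theorem exists_contraction {V : Type*} (w : V → ℕ) (f₀ : V → V) (m : ℕ) (p q : Fin m → V)
    (hw : Function.Injective w) (c : ℕ)
    (hp : ∀ j : Fin m, w (p j) + j + 1 = c) (hq : ∀ j : Fin m, w (q j) = c + j)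
    (hf : ∀ x, f₀ (f₀ x) = x) (hne : ∀ x, f₀ x ≠ x)
    (hn : ∀ x y, ¬ (w x < w y ∧ w y < w (f₀ x) ∧ w (f₀ x) < w (f₀ y))) :
    ∀ k ≤ m, ∃ (f : V → V) (E : V → V → Prop), Equivalence E ∧ (∀ x, E x (f₀ x)) ∧
      (∀ j : Fin m, j.1 < k → E (p j) (q j)) ∧
      (∀ E' : V → V → Prop, Equivalence E' → (∀ x, E' x (f₀ x)) → (∀ j, E' (p j) (q j)) →
        ∀ x y, E x y → E' x y) ∧
      ∀ S : Set V, S = {x | w x + k < c ∨ c + k ≤ w x} →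
        (∀ x ∈ S, f x ∈ S) ∧ (∀ x ∈ S, f (f x) = x) ∧ (∀ x ∈ S, f x ≠ x) ∧
        (∀ x ∈ S, ∀ y ∈ S, ¬ (w x < w y ∧ w y < w (f x) ∧ w (f x) < w (f y))) ∧
        (∀ x ∈ S, E x (f x)) ∧ (∀ x ∈ S, ∀ y ∈ S, E x y → y = x ∨ y = f x) := by
  intro k
  induction k with
  | zero =>
    intro _
    refine ⟨f₀, fun x y => y = x ∨ y = f₀ x, ⟨fun _ => .inl rfl, ?_, ?_⟩, fun _ => .inr rfl,
      fun _ h => by omega, ?_, ?_⟩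
    · rintro x y (rfl | rfl)
      · exact .inl rfl
      · exact .inr (hf x).symm
    · rintro x y z (rfl | rfl) (rfl | rfl)
      · exact .inl rfl
      · exact .inr rfl
      · exact .inr rfl
      · exact .inl (hf x)
    · rintro E' hE h1 _ x y (rfl | rfl)
      · exact hE.refl _
      · exact h1 x
    · rintro S rfl
      refine ⟨fun x _ => ?_, fun x _ => hf x, fun x _ => hne x, fun x _ y _ => hn x y,
        fun _ _ => .inr rfl, fun _ _ _ _ h => h⟩
      simp only [Set.mem_ofPred_eq]
      omega
  | succ k ih =>
    intro hk
    classical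
    obtain ⟨f, E, hE, hE0, hEj, hEmin, hS⟩ := ih (by omega)
    obtain ⟨hmap, hinv, hfne, hnc, hEf, hfE⟩ := hS _ rfl
    set S : Set V := {x | w x + k < c ∨ c + k ≤ w x} with hSdef
    set P := p ⟨k, hk⟩ with hP
    set Q := q ⟨k, hk⟩ with hQ
    have wP : w P + k + 1 = c := hp ⟨k, hk⟩
    have wQ : w Q = c + k := hq ⟨k, hk⟩
    have hPS : P ∈ S := by simp only [hSdef, Set.mem_ofPred_eq]; omega
    have hQS : Q ∈ S := by simp only [hSdef, Set.mem_ofPred_eq]; omega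
    have hadj : ∀ x ∈ S, x ≠ P → x ≠ Q → w x < w P ∨ w Q < w x := by
      intro x hx h1 h2
      have h1' : w x ≠ w P := fun h => h1 (hw h)
      have h2' : w x ≠ w Q := fun h => h2 (hw h)
      simp only [hSdef, Set.mem_ofPred_eq] at hx
      omega
    have hS' : ∀ x, (x ∈ {x | w x + (k + 1) < c ∨ c + (k + 1) ≤ w x}) ↔
        x ∈ S ∧ x ≠ P ∧ x ≠ Q := by
      intro x
      constructor
      · intro hx
        simp only [Set.mem_ofPred_eq] at hx
        refine ⟨by simp only [hSdef, Set.mem_ofPred_eq]; omega, ?_, ?_⟩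
        · rintro rfl; omega
        · rintro rfl; omega
      · rintro ⟨h1, h2, h3⟩
        have := hadj x h1 h2 h3
        simp only [Set.mem_ofPred_eq]
        omega
    let g : V → V := fun x => if f x = P then f Q else if f x = Q then f P else f x
    have hPQ : P ≠ Q := by
      intro h
      rw [h] at wP
      omega
    have hgp : ∀ x, f x = P → g x = f Q := fun x h => by simp [g, h]
    have hgq : ∀ x, f x = Q → g x = f P := fun x h => by simp [g, h, hPQ.symm]
    have hgo : ∀ x, f x ≠ P → f x ≠ Q → g x = f x := fun x h h' => by simp [g, h, h']
    have inj : ∀ x ∈ S, ∀ y ∈ S, f x = f y → x = y := by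
      intro x hx y hy h
      rw [← hinv x hx, h, hinv y hy]
    have cases : ∀ x ∈ S, x ≠ P → x ≠ Q →
        (f x = P ∧ x = f P ∧ g x = f Q ∧ f Q ≠ P ∧ f Q ≠ Q) ∨
        (f x = Q ∧ x = f Q ∧ g x = f P ∧ f P ≠ P ∧ f P ≠ Q) ∨
        (f x ≠ P ∧ f x ≠ Q ∧ g x = f x) := by
      intro x hx h1 h2
      by_cases h3 : f x = P
      · left
        have e : x = f P := by rw [← h3, hinv x hx]
        refine ⟨h3, e, hgp x h3, ?_, hfne Q hQS⟩
        intro h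
        apply h2
        rw [e, ← h, hinv Q hQS]
      · by_cases h4 : f x = Q
        · right; left
          have e : x = f Q := by rw [← h4, hinv x hx]
          refine ⟨h4, e, hgq x h4, hfne P hPS, ?_⟩
          intro h
          apply h1
          rw [e, ← h, hinv P hPS]
        · exact .inr (.inr ⟨h3, h4, hgo x h3 h4⟩)
    refine ⟨g, fun x y => E x y ∨ (E x P ∧ E Q y) ∨ (E x Q ∧ E P y), ⟨fun x => .inl (hE.refl x),
      ?_, ?_⟩, fun x => .inl (hE0 x), ?_, ?_, ?_⟩
    · rintro x y (h | ⟨h, h'⟩ | ⟨h, h'⟩)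
      · exact .inl (hE.symm h)
      · exact .inr (.inr ⟨hE.symm h', hE.symm h⟩)
      · exact .inr (.inl ⟨hE.symm h', hE.symm h⟩)
    · have tr := @hE.trans
      have sy := @hE.symm
      rintro x y z (h | ⟨h, h'⟩ | ⟨h, h'⟩) (i | ⟨i, i'⟩ | ⟨i, i'⟩)
      · exact .inl (tr h i)
      · exact .inr (.inl ⟨tr h i, i'⟩)
      · exact .inr (.inr ⟨tr h i, i'⟩)
      · exact .inr (.inl ⟨h, tr h' i⟩)
      · exact .inl (tr h (tr (sy (tr h' i)) i'))
      · exact .inl (tr h i')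
      · exact .inr (.inr ⟨h, tr h' i⟩)
      · exact .inl (tr h i')
      · exact .inl (tr h (tr (sy (tr h' i)) i'))
    · intro j hj
      by_cases h : j.1 = k
      · have : j = ⟨k, hk⟩ := Fin.ext h
        subst this
        exact .inr (.inl ⟨hE.refl _, hE.refl _⟩)
      · exact .inl (hEj j (by omega))
    · rintro E' hE' h1 h2 x y (h | ⟨h, h'⟩ | ⟨h, h'⟩)
      · exact hEmin E' hE' h1 h2 _ _ h
      · exact hE'.trans (hEmin E' hE' h1 h2 _ _ h)
          (hE'.trans (h2 ⟨k, hk⟩) (hEmin E' hE' h1 h2 _ _ h'))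
      · exact hE'.trans (hEmin E' hE' h1 h2 _ _ h)
          (hE'.trans (hE'.symm (h2 ⟨k, hk⟩)) (hEmin E' hE' h1 h2 _ _ h'))
    · rintro T hT
      have hTS : ∀ x, x ∈ T ↔ x ∈ S ∧ x ≠ P ∧ x ≠ Q := by
        intro x; rw [hT]; exact hS' x
      have fP := hmap P hPS
      have fQ := hmap Q hQS
      refine ⟨?_, ?_, ?_, ?_, ?_, ?_⟩
      · intro x hx
        obtain ⟨h1, h2, h3⟩ := (hTS x).1 hx
        rw [hTS]
        obtain ⟨a1, a2, a3, a4, a5⟩ | ⟨a1, a2, a3, a4, a5⟩ | ⟨a1, a2, a3⟩ := cases x h1 h2 h3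
        · rw [a3]; exact ⟨fQ, a4, a5⟩
        · rw [a3]; exact ⟨fP, a4, a5⟩
        · rw [a3]; exact ⟨hmap x h1, a1, a2⟩
      · intro x hx
        obtain ⟨h1, h2, h3⟩ := (hTS x).1 hx
        obtain ⟨a1, a2, a3, a4, a5⟩ | ⟨a1, a2, a3, a4, a5⟩ | ⟨a1, a2, a3⟩ := cases x h1 h2 h3
        · rw [a3, hgq _ (hinv Q hQS), a2]
        · rw [a3, hgp _ (hinv P hPS), a2]
        · rw [a3, hgo _ (by rwa [hinv x h1]) (by rwa [hinv x h1]), hinv x h1]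
      · intro x hx
        obtain ⟨h1, h2, h3⟩ := (hTS x).1 hx
        obtain ⟨a1, a2, a3, a4, a5⟩ | ⟨a1, a2, a3, a4, a5⟩ | ⟨a1, a2, a3⟩ := cases x h1 h2 h3
        · rw [a3]
          intro h
          exact hPQ (inj P hPS Q hQS (by rw [h, a2]))
        · rw [a3]
          intro h
          exact hPQ (inj P hPS Q hQS (by rw [h, a2]))
        · rw [a3]; exact hfne x h1
      · intro x hx y hy
        obtain ⟨h1, h2, h3⟩ := (hTS x).1 hx
        obtain ⟨h4, h5, h6⟩ := (hTS y).1 hy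
        exact contract_noncrossing w f S P Q hPS hQS (by omega) hadj hmap hinv hnc g hgp hgq hgo
          x h1 h2 h3 y h4 h5 h6
      · intro x hx
        obtain ⟨h1, h2, h3⟩ := (hTS x).1 hx
        obtain ⟨a1, a2, a3, a4, a5⟩ | ⟨a1, a2, a3, a4, a5⟩ | ⟨a1, a2, a3⟩ := cases x h1 h2 h3
        · rw [a3]
          refine .inr (.inl ⟨?_, hEf Q hQS⟩)
          rw [← a1]; exact hEf x h1
        · rw [a3]
          refine .inr (.inr ⟨?_, hEf P hPS⟩)
          rw [← a1]; exact hEf x h1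
        · rw [a3]; exact .inl (hEf x h1)
      · intro x hx y hy
        obtain ⟨h1, h2, h3⟩ := (hTS x).1 hx
        obtain ⟨h4, h5, h6⟩ := (hTS y).1 hy
        rintro (h | ⟨h, h'⟩ | ⟨h, h'⟩)
        · obtain h | h := hfE x h1 y h4 h
          · exact .inl h
          · exact .inr (by rw [hgo x (by rwa [← h]) (by rwa [← h]), h])
        · have e1 : P = f x := (hfE x h1 P hPS h).resolve_left (Ne.symm h2)
          have e2 : y = f Q := (hfE Q hQS y h4 h').resolve_left h6
          exact .inr (by rw [hgp x e1.symm, e2])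
        · have e1 : Q = f x := (hfE x h1 Q hQS h).resolve_left (Ne.symm h3)
          have e2 : y = f P := (hfE P hPS y h4 h').resolve_left h5
          exact .inr (by rw [hgq x e1.symm, e2])

theorem pos_injective {m n : ℕ} : Function.Injective (pos : Fin m ⊕ Fin n → ℕ) := by
  rintro (i | i) (j | j) h
  · simp only [pos] at h; rw [Fin.ext h]
  · simp only [pos] at h; omega
  · simp only [pos] at h; omega
  · simp only [pos, Fin.val_rev] at h
    have : i = j := Fin.ext (by omega)
    rw [this]

/-- The outer points of the juxtaposition are the ends of pairwise disjoint curves; so they are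
paired by a unique diagram. -/
theorem existsUnique_composite (a : Diagram l m) (b : Diagram m n) :
    ∃! c : Diagram l n, ∀ x y, x ≠ y → (c.partner x = y ↔ outer a b x = outer a b y) := by
  let w : (Fin l ⊕ Fin m) ⊕ (Fin m ⊕ Fin n) → ℕ := Sum.elim pos (fun y => l + m + pos y)
  let f₀ : (Fin l ⊕ Fin m) ⊕ (Fin m ⊕ Fin n) → (Fin l ⊕ Fin m) ⊕ (Fin m ⊕ Fin n) :=
    Sum.map a.partner b.partner
  have posa : ∀ x : Fin l ⊕ Fin m, pos x < l + m := by
    rintro (x | x) <;> simp only [pos] <;> omega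
  have hw : Function.Injective w := by
    rintro (x | x) (y | y) h
    · simp only [w, Sum.elim_inl] at h; rw [pos_injective h]
    · simp only [w, Sum.elim_inl, Sum.elim_inr] at h; have := posa x; omega
    · simp only [w, Sum.elim_inl, Sum.elim_inr] at h; have := posa y; omega
    · simp only [w, Sum.elim_inr, Nat.add_left_cancel_iff] at h; rw [pos_injective h]
  obtain ⟨f, E, hE, hE0, hEj, hEmin, hS⟩ := exists_contraction w f₀ m
    (fun j => .inl (.inr j)) (fun j => .inr (.inl j)) hw (l + m)
    (by intro j; simp only [w, Sum.elim_inl, pos, Fin.val_rev]; omega)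
    (by intro j; simp only [w, Sum.elim_inr, pos])
    (by rintro (x | x) <;> simp [f₀, a.partner_partner, b.partner_partner])
    (by rintro (x | x) <;> simp [f₀, a.partner_ne, b.partner_ne])
    (by
      rintro (x | x) (y | y)
      · exact a.noncrossing x y
      · simp only [w, f₀, Sum.elim_inl, Sum.elim_inr, Sum.map_inl, Sum.map_inr]
        have := posa (a.partner x); omega
      · simp only [w, f₀, Sum.elim_inl, Sum.elim_inr, Sum.map_inl, Sum.map_inr]
        have := posa y; omega
      · simp only [w, f₀, Sum.elim_inr, Sum.map_inr]
        have := b.noncrossing x y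
        omega) m le_rfl
  obtain ⟨hmap, hinv, hfne, hnc, hEf, hfE⟩ := hS _ rfl
  set S : Set ((Fin l ⊕ Fin m) ⊕ (Fin m ⊕ Fin n)) :=
    {x | w x + m < l + m ∨ l + m + m ≤ w x} with hSdef
  let ι : Fin l ⊕ Fin n → (Fin l ⊕ Fin m) ⊕ (Fin m ⊕ Fin n) := Sum.map Sum.inl Sum.inr
  have hι : ∀ x, ι x ∈ S := by
    rintro (x | x) <;> simp only [hSdef, ι, w, Set.mem_ofPred_eq, Sum.map_inl, Sum.map_inr,
      Sum.elim_inl, Sum.elim_inr, pos] <;> omega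
  have hιinj : Function.Injective ι := Sum.map_injective.2 ⟨Sum.inl_injective, Sum.inr_injective⟩
  have hιsurj : ∀ x ∈ S, ∃ y, ι y = x := by
    rintro ((x | x) | (x | x)) hx
    · exact ⟨.inl x, rfl⟩
    · simp only [hSdef, w, Set.mem_ofPred_eq, Sum.elim_inl, pos, Fin.val_rev] at hx; omega
    · simp only [hSdef, w, Set.mem_ofPred_eq, Sum.elim_inr, pos] at hx; omega
    · exact ⟨.inr x, rfl⟩
  have hιpos : ∀ x y, w (ι x) < w (ι y) ↔ pos x < pos y := by
    rintro (x | x) (y | y) <;> simp only [ι, w, Sum.map_inl, Sum.map_inr,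
      Sum.elim_inl, Sum.elim_inr, pos] <;> omega
  -- connectedness in the glued picture
  have hconn : ∀ x y, E (ι x) (ι y) ↔ outer a b x = outer a b y := by
    let π : (Fin l ⊕ Fin m) ⊕ (Fin m ⊕ Fin n) → Fin l ⊕ Fin m ⊕ Fin n :=
      Sum.elim (Sum.map id Sum.inl) Sum.inr
    have hπ : ∀ x, outer a b x = Quot.mk (Glue a b) (π (ι x)) := by
      rintro (x | x) <;> rfl
    intro x y
    rw [hπ, hπ]
    constructor
    · intro h
      refine hEmin (fun u v => Quot.mk (Glue a b) (π u) = Quot.mk (Glue a b) (π v))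
        ⟨fun _ => rfl, fun h => h.symm, fun h h' => h.trans h'⟩ ?_ ?_ _ _ h
      · rintro (u | u)
        · exact Quot.sound (Glue.upper u)
        · exact Quot.sound (Glue.lower u)
      · intro j; rfl
    · intro h
      let s : Fin l ⊕ Fin m ⊕ Fin n → (Fin l ⊕ Fin m) ⊕ (Fin m ⊕ Fin n) :=
        Sum.elim (fun i => .inl (.inl i)) (Sum.elim (fun j => .inl (.inr j)) (fun k => .inr (.inr k)))
      let st : Setoid ((Fin l ⊕ Fin m) ⊕ (Fin m ⊕ Fin n)) := ⟨E, hE⟩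
      have hs1 : ∀ u, s (Sum.map id Sum.inl u) = .inl u := by rintro (u | u) <;> rfl
      have hs2 : ∀ u, E (s (Sum.inr u)) (.inr u) := by
        rintro (u | u)
        · exact hEj u u.2
        · exact hE.refl _
      have hlift : ∀ u v, Glue a b u v → Quotient.mk st (s u) = Quotient.mk st (s v) := by
        rintro _ _ (u | u)
        · apply Quotient.sound
          rw [hs1, hs1]
          exact hE0 (.inl u)
        · apply Quotient.sound
          exact hE.trans (hs2 u) (hE.trans (hE0 (.inr u)) (hE.symm (hs2 _)))
      have := congrArg (Quot.lift (fun u => Quotient.mk st (s u)) hlift) h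
      have hsι : ∀ x, s (π (ι x)) = ι x := by rintro (x | x) <;> rfl
      have h2 : Quotient.mk st (s (π (ι x))) = Quotient.mk st (s (π (ι y))) := this
      rw [hsι, hsι] at h2
      exact Quotient.exact h2
  choose g hg using fun x => hιsurj (f (ι x)) (hmap _ (hι x))
  have hgg : ∀ x, ι (g (g x)) = ι x := fun x => by rw [hg, hg, hinv _ (hι x)]
  refine ⟨⟨g, fun x => hιinj (hgg x), fun x h => hfne _ (hι x) (by rw [← hg, h]), ?_⟩, ?_, ?_⟩
  · intro x y
    rw [← hιpos, ← hιpos, ← hιpos, hg, hg]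
    exact hnc _ (hι x) _ (hι y)
  · intro x y hxy
    rw [← hconn]
    constructor
    · rintro rfl
      rw [hg]; exact hEf _ (hι x)
    · intro h
      have := (hfE _ (hι x) _ (hι y) h).resolve_left (fun h => hxy (hιinj h).symm)
      exact hιinj (by rw [hg, this])
  · intro c hc
    have hgx : ∀ x, x ≠ g x := fun x h => hfne _ (hι x) (by rw [← hg, ← h])
    ext1
    funext x
    rw [hc x (g x) (hgx x), ← hconn, hg]
    exact hEf _ (hι x)

/-- The composite diagram, i.e. the juxtaposition without its closed loops: two distinct points are
paired when they are the ends of one curve. -/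
noncomputable def Diagram.comp (b : Diagram m n) (a : Diagram l m) : Diagram l n :=
  (existsUnique_composite a b).choose

theorem Diagram.comp_spec (b : Diagram m n) (a : Diagram l m) (x y : Fin l ⊕ Fin n) (hxy : x ≠ y) :
    (b.comp a).partner x = y ↔ outer a b x = outer a b y :=
  (existsUnique_composite a b).choose_spec.1 x y hxy

end Juxtaposition

section Tensor

variable {m m' n n' : ℕ}

/-- The marked points of a horizontal juxtaposition: those of the left and those of the right
rectangle. -/
def splitPoints (m m' n n' : ℕ) :
    Fin (m + m') ⊕ Fin (n + n') ≃ (Fin m ⊕ Fin n) ⊕ (Fin m' ⊕ Fin n') :=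
  (Equiv.sumCongr finSumFinEquiv.symm finSumFinEquiv.symm).trans
    (Equiv.sumSumSumComm (Fin m) (Fin m') (Fin n) (Fin n'))

theorem pos_split_left (u : Fin m ⊕ Fin n) :
    (pos u < m ∧ pos ((splitPoints m m' n n').symm (.inl u)) = pos u) ∨
    (m ≤ pos u ∧ pos ((splitPoints m m' n n').symm (.inl u)) = pos u + m' + n') := by
  rcases u with i | j
  · left
    have e : (splitPoints m m' n n').symm (.inl (.inl i)) = .inl (Fin.castAdd m' i) := rfl
    simp [e, pos]
  · right
    have e : (splitPoints m m' n n').symm (.inl (.inr j)) = .inr (Fin.castAdd n' j) := rfl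
    simp only [e, pos, Fin.val_rev, Fin.val_castAdd]
    omega

theorem pos_split_right (u : Fin m' ⊕ Fin n') :
    pos u < m' + n' ∧ pos ((splitPoints m m' n n').symm (.inr u)) = pos u + m := by
  rcases u with i | j
  · have e : (splitPoints m m' n n').symm (.inr (.inl i)) = .inl (Fin.natAdd m i) := rfl
    simp only [e, pos, Fin.val_natAdd]
    omega
  · have e : (splitPoints m m' n n').symm (.inr (.inr j)) = .inr (Fin.natAdd n j) := rfl
    simp only [e, pos, Fin.val_rev, Fin.val_natAdd]
    omega

/-- Horizontal juxtaposition of `a` (left) and `b` (right). -/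
def Diagram.tensor (a : Diagram m n) (b : Diagram m' n') : Diagram (m + m') (n + n') where
  partner x := (splitPoints m m' n n').symm
    (Sum.map a.partner b.partner (splitPoints m m' n n' x))
  partner_partner x := by
    rw [Equiv.symm_apply_eq, Equiv.apply_symm_apply]
    generalize splitPoints m m' n n' x = u
    rcases u with u | u <;> simp [a.partner_partner, b.partner_partner]
  partner_ne x := by
    rw [Ne, Equiv.symm_apply_eq]
    generalize splitPoints m m' n n' x = u
    rcases u with u | u <;> simp [a.partner_ne, b.partner_ne]
  noncrossing x y := by
    obtain ⟨u, rfl⟩ := (splitPoints m m' n n').symm.surjective x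
    obtain ⟨v, rfl⟩ := (splitPoints m m' n n').symm.surjective y
    simp only [Equiv.apply_symm_apply]
    rcases u with u | u <;> rcases v with v | v <;> simp only [Sum.map_inl, Sum.map_inr]
    · have := a.noncrossing u v
      have h1 := pos_split_left (m' := m') (n' := n') u
      have h2 := pos_split_left (m' := m') (n' := n') v
      have h3 := pos_split_left (m' := m') (n' := n') (a.partner u)
      have h4 := pos_split_left (m' := m') (n' := n') (a.partner v)
      omega
    · have h1 := pos_split_left (m' := m') (n' := n') u
      have h2 := pos_split_right (m := m) (n := n) v
      have h3 := pos_split_left (m' := m') (n' := n') (a.partner u)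
      have h4 := pos_split_right (m := m) (n := n) (b.partner v)
      omega
    · have h1 := pos_split_right (m := m) (n := n) u
      have h2 := pos_split_left (m' := m') (n' := n') v
      have h3 := pos_split_right (m := m) (n := n) (b.partner u)
      have h4 := pos_split_left (m' := m') (n' := n') (a.partner v)
      omega
    · have := b.noncrossing u v
      have h1 := pos_split_right (m := m) (n := n) u
      have h2 := pos_split_right (m := m) (n := n) v
      have h3 := pos_split_right (m := m) (n := n) (b.partner u)
      have h4 := pos_split_right (m := m) (n := n) (b.partner v)
      omega

end Tensor

/-- The closure of an `(n, n)`-diagram: in addition to its strands, the `i`-th top point is joined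
to the `i`-th bottom point. -/
inductive Closure {n : ℕ} (a : Diagram n n) : Fin n ⊕ Fin n → Fin n ⊕ Fin n → Prop
  | strand (x : Fin n ⊕ Fin n) : Closure a x (a.partner x)
  | arc (i : Fin n) : Closure a (.inl i) (.inr i)

/-- The number of closed loops of the closure. -/
noncomputable def closureLoops {n : ℕ} (a : Diagram n n) : ℕ := Nat.card (Quot (Closure a))

/-- The value of a closed loop. -/
noncomputable def loopValue (τ : ℂ) : ℂ := τ + τ⁻¹

/-- `Hom(m, n)` in the Temperley–Lieb category at `τ`. -/
abbrev Hom (m n : ℕ) : Type := Diagram m n →₀ ℂ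

/-- Composition `(g, f) ↦ g f`, the bilinear extension of `(b, a) ↦ d ^ r • b a`, where `r` is the
number of loops removed. -/
noncomputable def comp (τ : ℂ) {l m n : ℕ} : Hom m n →ₗ[ℂ] Hom l m →ₗ[ℂ] Hom l n :=
  Finsupp.linearCombination ℂ fun b : Diagram m n =>
    Finsupp.linearCombination ℂ fun a : Diagram l m =>
      Finsupp.single (b.comp a) (loopValue τ ^ loops a b)

/-- The tensor product of morphisms, the bilinear extension of horizontal juxtaposition. -/
noncomputable def tensor {m n m' n' : ℕ} :
    Hom m n →ₗ[ℂ] Hom m' n' →ₗ[ℂ] Hom (m + m') (n + n') :=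
  Finsupp.linearCombination ℂ fun a : Diagram m n =>
    Finsupp.linearCombination ℂ fun b : Diagram m' n' => Finsupp.single (a.tensor b) (1 : ℂ)

/-- The Markov trace. -/
noncomputable def trace (τ : ℂ) {n : ℕ} : Hom n n →ₗ[ℂ] ℂ :=
  Finsupp.linearCombination ℂ fun a : Diagram n n => loopValue τ ^ closureLoops a

/-! The even Temperley–Lieb category at `τ`: the full subcategory on the even numbers. -/

/-- Objects of the even Temperley–Lieb category. -/
abbrev EvenObj : Type := {n : ℕ // Even n}

/-- The tensor product of objects. -/
def EvenObj.tensor (m n : EvenObj) : EvenObj := ⟨m.1 + n.1, m.2.add n.2⟩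

/-- Morphisms of the even Temperley–Lieb category. -/
abbrev EvenHom (m n : EvenObj) : Type := Hom m.1 n.1

/-- A choice of a subspace of every morphism space, i.e. a homogeneous subspace of the direct sum of
all the morphism spaces. -/
abbrev EvenSubspace : Type := ∀ m n : EvenObj, Submodule ℂ (EvenHom m n)

/-- Closedness under composition and tensor product with arbitrary morphisms. -/
structure IsIdeal (τ : ℂ) (J : EvenSubspace) : Prop where
  comp_left : ∀ {l m n : EvenObj} (g : EvenHom m n) (f : EvenHom l m),
    f ∈ J l m → comp τ g f ∈ J l n
  comp_right : ∀ {l m n : EvenObj} (g : EvenHom m n) (f : EvenHom l m),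
    g ∈ J m n → comp τ g f ∈ J l n
  tensor_left : ∀ {m n m' n' : EvenObj} (f : EvenHom m n) (g : EvenHom m' n'),
    g ∈ J m' n' → tensor f g ∈ J (m.tensor m') (n.tensor n')
  tensor_right : ∀ {m n m' n' : EvenObj} (f : EvenHom m n) (g : EvenHom m' n'),
    f ∈ J m n → tensor f g ∈ J (m.tensor m') (n.tensor n')

/-- The negligible morphisms: all `a` with `Tr (a b) = 0` for every `b` in the opposite direction. -/
noncomputable def negligible (τ : ℂ) : EvenSubspace := fun n m =>
  { carrier := {a | ∀ b : EvenHom m n, trace τ (comp τ a b) = 0}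
    zero_mem' := fun b => by simp
    add_mem' := fun {a a'} h h' b => by simp [h b, h' b]
    smul_mem' := fun c a h b => by simp [h b] }

end TemperleyLieb

namespace TemperleyLieb

/-! ### Two-colourings

The colourings of the marked points that are constant on the strands turn diagrams into matrices of
natural numbers. This is faithful, and a closed loop has the value `2`. -/

/-! Write [k] for the quantum integers, which vanish exactly when ℓ divides k, and m = ℓ - 1, which
is even. Tensoring any morphism with the identity of 0 returns that morphism, so a proper ideal
contains no non-zero multiple of this identity. Closing `a b` with nested cups and caps yields
Tr(ab) times it; hence every proper ideal is negligible (`IsIdeal.le_negligible`). The Jones–Wenzl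
projection on k < ℓ strands has trace [k+1]. On m strands the trace is 0, which makes that
projection a non-zero negligible morphism.

The projection on m strands generates all negligible morphisms (`IsIdeal.negligible_le`). Every
identity morphism is a sum of morphisms through a projection on k < m strands or through the
projection on m strands tensored with an identity (`idh_mem_jwSpan`). Insert such sums on both sides
of a negligible `a`. The second kind of term lies in the ideal. The remaining terms vanish: between
different numbers of strands the projections kill every diagram, and between equal numbers the
result is a scalar times a projection of non-zero trace [k+1].

It remains to find that projection in a given non-zero proper ideal. Bend morphisms into Hom(0, 2k)
and take k minimal with a non-zero element f. A Temperley–Lieb generator factors through an object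
with two points less, so all generators kill f. The decisive step is that this forces k = m
(`eq_zero_of_gen_comp_eq_zero`). Bending f back gives a non-zero endomorphism of k = m that is
killed by the generators, and this is a multiple of the projection.

For the decisive step, Hom(0, 2k) is embedded into functions on words in two letters, the spin-chain
representation. A function killed by all generators is, up to an explicit weight, symmetric in the
positions, so it is fixed by one scalar. A weighted sum over words with a prescribed prefix of
length A annihilates every cup diagram when A < k. On the symmetric function it equals the scalar
times a non-zero factor times a Gaussian binomial coefficient at Q = τ², with lower index r = k - A
(`eq_zero_of_coeff_ne_zero`). The choice r = 1 settles the case where ℓ does not divide k + 1, and r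
= ℓ settles multiples of ℓ other than ℓ itself.

Diagram identities are checked on matrices of natural numbers that count two-colourings. There a
loop is worth 2, and the matrix determines both the diagram and the number of loops
(`Mono.sem_injective`), so an identity verified there holds for every loop value. -/

/-- A colouring of the marked points that is constant on the strands. -/
def Compat {m n : ℕ} (a : Diagram m n) (s : Fin m → Bool) (t : Fin n → Bool) : Prop :=
  ∀ x, Sum.elim s t (a.partner x) = Sum.elim s t x

instance {m n : ℕ} (a : Diagram m n) (s : Fin m → Bool) (t : Fin n → Bool) :
    Decidable (Compat a s t) :=
  inferInstanceAs (Decidable (∀ x, Sum.elim s t (a.partner x) = Sum.elim s t x))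

/-- The matrix of a diagram. -/
def ev {m n : ℕ} (a : Diagram m n) : Matrix (Fin m → Bool) (Fin n → Bool) ℕ :=
  fun s t => if Compat a s t then 1 else 0

theorem compat_const {m n : ℕ} (a : Diagram m n) : Compat a (fun _ => true) (fun _ => true) := by
  intro x
  rcases x with x | x <;> rcases a.partner (_ : Fin m ⊕ Fin n) with y | y <;> rfl

theorem ev_const {m n : ℕ} (a : Diagram m n) : ev a (fun _ => true) (fun _ => true) = 1 :=
  if_pos (compat_const a)

/-- Mark only x and its `a`-partner. This colouring suits `a`, hence `b`, so the `b`-partner of x is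
marked too; as it is not x, it is the `a`-partner. -/
theorem eq_of_compat_imp {m n : ℕ} {a b : Diagram m n} (h : ∀ s t, Compat a s t → Compat b s t) :
    a = b := by
  apply Diagram.ext
  funext x
  let v : Fin m ⊕ Fin n → Bool := fun y => decide (y = x ∨ y = a.partner x)
  have hv : Sum.elim (v ∘ Sum.inl) (v ∘ Sum.inr) = v := Sum.elim_comp_inl_inr v
  have h1 : Compat a (v ∘ Sum.inl) (v ∘ Sum.inr) := by
    intro y
    rw [hv]
    have : (a.partner y = x ∨ a.partner y = a.partner x) ↔ (y = x ∨ y = a.partner x) := by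
      constructor
      · rintro (h | h)
        · right; rw [← h, a.partner_partner]
        · left; rw [← a.partner_partner y, h, a.partner_partner]
      · rintro (h | h)
        · right; rw [h]
        · left; rw [h, a.partner_partner]
    simp only [v, this]
  have h2 := h _ _ h1 x
  rw [hv] at h2
  have h3 : b.partner x = x ∨ b.partner x = a.partner x := by simpa [v] using h2
  exact (h3.resolve_left (b.partner_ne x)).symm

/-- Functions on a quotient are the functions that respect the relation. -/
def quotFunEquiv {X β : Type*} (r : X → X → Prop) :
    {v : X → β // ∀ x y, r x y → v x = v y} ≃ (Quot r → β) where
  toFun v := Quot.lift v.1 v.2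
  invFun g := ⟨fun x => g (Quot.mk r x), fun _ _ h => congrArg g (Quot.sound h)⟩
  left_inv _ := rfl
  right_inv g := by
    funext q
    induction q using Quot.ind
    rfl

/-- The number of extensions of a partially defined two-colouring. -/
theorem card_extension {C O : Type*} [Finite C] (o : O → C) (v : O → Bool)
    (h : ∀ x y, o x = o y → v x = v y) :
    Nat.card {g : C → Bool // ∀ x, g (o x) = v x} = 2 ^ Nat.card {q : C // ∀ x, o x ≠ q} := by
  classical
  rw [← Nat.card_eq_two_iff.2 ⟨false, true, by decide, by ext b; cases b <;> simp⟩, ← Nat.card_fun]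
  refine Nat.card_congr
    { toFun := fun g q => g.1 q.1
      -- On the image of `o` the colour is forced, and `h` makes the chosen preimage immaterial; off
      -- the image it is free.
      invFun := fun r => ⟨fun q => if hq : ∃ x, o x = q then v hq.choose else
        r ⟨q, fun x hx => hq ⟨x, hx⟩⟩, fun x => ?_⟩
      left_inv := ?_
      right_inv := ?_ }
  · have hx : ∃ y, o y = o x := ⟨x, rfl⟩
    beta_reduce
    rw [dif_pos hx]
    exact h _ _ hx.choose_spec
  · intro g
    apply Subtype.ext
    funext q
    by_cases hq : ∃ x, o x = q
    · simp only [dif_pos hq]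
      rw [← g.2, hq.choose_spec]
    · simp only [dif_neg hq]
  · intro r
    funext q
    have hq : ¬ ∃ x, o x = q.1 := fun ⟨x, hx⟩ => q.2 x hx
    simp only [dif_neg hq]

/-- The product counts colourings of the middle points, that is, colourings of the components
extending the given outer colours. Each interior loop contributes a free colour, and an extension
exists exactly when the outer colours agree along the strands of the composite. -/
theorem ev_mul_ev {l m n : ℕ} (a : Diagram l m) (b : Diagram m n) :
    ev a * ev b = 2 ^ loops a b • ev (b.comp a) := by
  ext s u
  have key : ∀ t, ((∀ x y, Glue a b x y →
      (Sum.elim s (Sum.elim t u) x : Bool) = Sum.elim s (Sum.elim t u) y) ↔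
        Compat a s t ∧ Compat b t u) := by
    intro t
    have e1 : ∀ x, Sum.elim s (Sum.elim t u) (Sum.map id Sum.inl x) = Sum.elim s t x := by
      rintro (x | x) <;> rfl
    constructor
    · intro h
      refine ⟨fun x => ?_, fun y => (h _ _ (.lower y)).symm⟩
      have := h _ _ (.upper x)
      rw [e1, e1] at this
      exact this.symm
    · rintro ⟨h1, h2⟩ _ _ (x | y)
      · rw [e1, e1]; exact (h1 x).symm
      · exact (h2 y).symm
  have h1 : (ev a * ev b) s u = Nat.card {t : Fin m → Bool // Compat a s t ∧ Compat b t u} := by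
    rw [Matrix.mul_apply, Nat.card_eq_fintype_card, Fintype.card_subtype, Finset.card_filter]
    refine Finset.sum_congr rfl fun t _ => ?_
    simp only [ev, ite_and, mul_ite, mul_one, mul_zero]
    split_ifs <;> rfl
  have h2 : Nat.card {t : Fin m → Bool // Compat a s t ∧ Compat b t u} =
      Nat.card {g : Component a b → Bool // ∀ x, g (outer a b x) = Sum.elim s u x} := by
    refine Nat.card_congr
      { toFun := fun t => ⟨quotFunEquiv (Glue a b)
          ⟨Sum.elim s (Sum.elim t.1 u), (key t.1).2 t.2⟩, ?_⟩
        invFun := fun g => ⟨fun j => g.1 (Quot.mk _ (.inr (.inl j))), ?_⟩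
        left_inv := ?_
        right_inv := ?_ }
    · rintro (x | x) <;> rfl
    · rw [← key]
      have e : Sum.elim s (Sum.elim (fun j => g.1 (Quot.mk _ (.inr (.inl j)))) u) =
          fun x => g.1 (Quot.mk _ x) := by
        funext x
        rcases x with x | x | x
        · exact (g.2 (.inl x)).symm
        · rfl
        · exact (g.2 (.inr x)).symm
      rw [e]
      exact fun x y h => congrArg g.1 (Quot.sound h)
    · intro t; rfl
    · intro g
      apply Subtype.ext
      funext q
      induction q using Quot.ind with | _ x => ?_
      rcases x with x | x | x
      · exact (g.2 (.inl x)).symm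
      · rfl
      · exact (g.2 (.inr x)).symm
  rw [h1, h2, Matrix.smul_apply, smul_eq_mul, ev]
  split_ifs with hc
  · rw [mul_one, card_extension]
    · rfl
    · intro x y hxy
      by_cases h : x = y
      · rw [h]
      · rw [← (b.comp_spec a x y h).2 hxy]
        exact (hc x).symm
  · rw [mul_zero, Nat.card_eq_zero]
    left
    constructor
    rintro ⟨g, hg⟩
    apply hc
    intro x
    rw [← hg, ← hg, (b.comp_spec a x _ ((b.comp a).partner_ne x).symm).1 rfl]

/-- A non-zero diagonal entry is a colouring that is also constant along the closing arcs, hence one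
free colour per loop of the closure. -/
theorem trace_ev {n : ℕ} (a : Diagram n n) : Matrix.trace (ev a) = 2 ^ closureLoops a := by
  have h1 : Matrix.trace (ev a) = Nat.card {s : Fin n → Bool // Compat a s s} := by
    rw [Nat.card_eq_fintype_card, Fintype.card_subtype, Finset.card_filter]
    rfl
  rw [h1, closureLoops]
  conv_rhs => rw [← Nat.card_eq_two_iff.2
    ⟨false, true, by decide, by ext b; cases b <;> simp⟩, ← Nat.card_fun,
    ← Nat.card_congr (quotFunEquiv (Closure a))]
  refine Nat.card_congr
    { toFun := fun s => ⟨Sum.elim s.1 s.1, ?_⟩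
      invFun := fun v => ⟨fun i => v.1 (.inl i), ?_⟩
      left_inv := fun s => rfl
      right_inv := ?_ }
  · rintro x _ (_ | i)
    · exact (s.2 x).symm
    · rfl
  · have e : Sum.elim (fun i => v.1 (.inl i)) (fun i => v.1 (.inl i)) = v.1 := by
      funext x
      rcases x with x | x
      · rfl
      · exact v.2 _ _ (.arc x)
    intro x
    rw [e]
    exact (v.2 _ _ (.strand x)).symm
  · intro v
    apply Subtype.ext
    funext x
    rcases x with x | x
    · rfl
    · exact v.2 _ _ (.arc x)

theorem ev_tensor {m n m' n' : ℕ} (a : Diagram m n) (b : Diagram m' n')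
    (s : Fin (m + m') → Bool) (t : Fin (n + n') → Bool) :
    ev (a.tensor b) s t = ev a (s ∘ Fin.castAdd m') (t ∘ Fin.castAdd n') *
      ev b (s ∘ Fin.natAdd m) (t ∘ Fin.natAdd n) := by
  have e1 : ∀ u, Sum.elim s t ((splitPoints m m' n n').symm (.inl u)) =
      Sum.elim (s ∘ Fin.castAdd m') (t ∘ Fin.castAdd n') u := by
    rintro (u | u) <;> rfl
  have e2 : ∀ u, Sum.elim s t ((splitPoints m m' n n').symm (.inr u)) =
      Sum.elim (s ∘ Fin.natAdd m) (t ∘ Fin.natAdd n) u := by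
    rintro (u | u) <;> rfl
  have : Compat (a.tensor b) s t ↔ Compat a (s ∘ Fin.castAdd m') (t ∘ Fin.castAdd n') ∧
      Compat b (s ∘ Fin.natAdd m) (t ∘ Fin.natAdd n) := by
    unfold Compat
    rw [(splitPoints m m' n n').symm.surjective.forall, Sum.forall]
    simp only [Diagram.tensor, Equiv.apply_symm_apply, Sum.map_inl, Sum.map_inr, e1, e2]
  simp only [ev, this, ite_and, mul_ite, mul_one, mul_zero]
  split_ifs <;> rfl

/-! ### Monomials -/

/-- A diagram together with a number of closed loops. -/
@[ext]
structure Mono (m n : ℕ) where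
  loops : ℕ
  diag : Diagram m n

namespace Mono

/-- The matrix of a monomial. -/
def sem {m n : ℕ} (x : Mono m n) : Matrix (Fin m → Bool) (Fin n → Bool) ℕ :=
  2 ^ x.loops • ev x.diag

/-- The entry at the constant colouring is the power of 2 that records the loops; the support of the
matrix then determines the diagram. -/
theorem sem_injective {m n : ℕ} : Function.Injective (sem : Mono m n → _) := by
  rintro ⟨r, a⟩ ⟨r', a'⟩ h
  have h0 := congrFun (congrFun h (fun _ => true)) (fun _ => true)
  simp only [sem, Matrix.smul_apply, ev_const, smul_eq_mul, mul_one] at h0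
  have hr : r = r' := Nat.pow_right_injective le_rfl h0
  subst hr
  congr
  refine eq_of_compat_imp fun s t hs => ?_
  have h1 := congrFun (congrFun h s) t
  by_contra hc
  simp [sem, ev, hs, hc] at h1

/-- A diagram as a monomial. -/
def of {m n : ℕ} (a : Diagram m n) : Mono m n := ⟨0, a⟩

@[simp] theorem sem_of {m n : ℕ} (a : Diagram m n) : sem (of a) = ev a := by simp [sem, of]

/-- Composition of monomials. -/
noncomputable def comp {l m n : ℕ} (y : Mono m n) (x : Mono l m) : Mono l n :=
  ⟨y.loops + x.loops + TemperleyLieb.loops x.diag y.diag, y.diag.comp x.diag⟩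

/-- Rows belong to the top edge, so the factors appear in the order in which the diagrams are
stacked from above. -/
theorem sem_comp {l m n : ℕ} (y : Mono m n) (x : Mono l m) : sem (y.comp x) = sem x * sem y := by
  simp only [sem, comp, Matrix.smul_mul, Matrix.mul_smul, ev_mul_ev, smul_smul]
  congr 1
  ring

/-- Tensor product of monomials. -/
def tensor {m n m' n' : ℕ} (x : Mono m n) (y : Mono m' n') : Mono (m + m') (n + n') :=
  ⟨x.loops + y.loops, x.diag.tensor y.diag⟩

theorem sem_tensor {m n m' n' : ℕ} (x : Mono m n) (y : Mono m' n')
    (s : Fin (m + m') → Bool) (t : Fin (n + n') → Bool) :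
    sem (x.tensor y) s t = sem x (s ∘ Fin.castAdd m') (t ∘ Fin.castAdd n') *
      sem y (s ∘ Fin.natAdd m) (t ∘ Fin.natAdd n) := by
  simp only [sem, tensor, Matrix.smul_apply, smul_eq_mul, ev_tensor]
  ring

/-- The number of loops of the closure. -/
noncomputable def closure {n : ℕ} (x : Mono n n) : ℕ := x.loops + closureLoops x.diag

theorem trace_sem {n : ℕ} (x : Mono n n) : Matrix.trace (sem x) = 2 ^ x.closure := by
  simp only [sem, closure, Matrix.trace_smul, trace_ev, smul_eq_mul, pow_add]

theorem closure_eq_of_trace_sem_eq {m n : ℕ} {x : Mono m m} {y : Mono n n}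
    (h : Matrix.trace (sem x) = Matrix.trace (sem y)) : x.closure = y.closure := by
  rw [trace_sem, trace_sem] at h
  exact Nat.pow_right_injective le_rfl h

/-- The morphism given by a monomial. -/
noncomputable def hom (τ : ℂ) {m n : ℕ} (x : Mono m n) : Hom m n :=
  Finsupp.single x.diag (loopValue τ ^ x.loops)

variable (τ : ℂ)

/-- Loops are recorded as a number and evaluated only here. This carries monomial identities over to
arbitrary τ. -/
theorem comp_hom {l m n : ℕ} (y : Mono m n) (x : Mono l m) :
    TemperleyLieb.comp τ (y.hom τ) (x.hom τ) = (y.comp x).hom τ := by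
  simp only [hom, TemperleyLieb.comp, Finsupp.linearCombination_single, LinearMap.smul_apply,
    Finsupp.smul_single, smul_eq_mul, comp]
  congr 1
  ring

theorem tensor_hom {m n m' n' : ℕ} (x : Mono m n) (y : Mono m' n') :
    TemperleyLieb.tensor (x.hom τ) (y.hom τ) = (x.tensor y).hom τ := by
  simp only [hom, TemperleyLieb.tensor, Finsupp.linearCombination_single, LinearMap.smul_apply,
    Finsupp.smul_single, smul_eq_mul, tensor]
  congr 1
  ring

theorem trace_hom {n : ℕ} (x : Mono n n) :
    TemperleyLieb.trace τ (x.hom τ) = loopValue τ ^ x.closure := by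
  simp only [hom, TemperleyLieb.trace, Finsupp.linearCombination_single, smul_eq_mul, closure,
    pow_add]

end Mono

/-- The morphism given by a diagram. -/
noncomputable def bas {m n : ℕ} (a : Diagram m n) : Hom m n := Finsupp.single a 1

theorem hom_of (τ : ℂ) {m n : ℕ} (a : Diagram m n) : (Mono.of a).hom τ = bas a := by
  simp [Mono.hom, Mono.of, bas]

/-- Morphisms are linear combinations of diagrams. -/
theorem hom_induction {m n : ℕ} {motive : Hom m n → Prop} (f : Hom m n) (zero : motive 0)
    (add : ∀ f g, motive f → motive g → motive (f + g))
    (smul : ∀ (c : ℂ) f, motive f → motive (c • f)) (bas : ∀ a, motive (bas a)) : motive f := by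
  induction f using Finsupp.induction_linear with
  | zero => exact zero
  | add f g hf hg => exact add f g hf hg
  | single a c =>
    have : Finsupp.single a c = c • TemperleyLieb.bas a := by simp [TemperleyLieb.bas]
    rw [this]
    exact smul c _ (bas a)

end TemperleyLieb

namespace TemperleyLieb

/-! ### Some diagrams -/

namespace Diagram

/-- The identity diagram. -/
def one (n : ℕ) : Diagram n n where
  partner := Sum.swap
  partner_partner := Sum.swap_swap
  partner_ne := by rintro (x | x) <;> simp
  noncrossing := by
    rintro (x | x) (y | y) <;> simp only [pos, Sum.swap_inl, Sum.swap_inr, Fin.val_rev] <;> omega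

/-- The transport of a diagram along equalities. -/
def cast {m n m' n' : ℕ} (hm : m = m') (hn : n = n') (a : Diagram m n) : Diagram m' n' :=
  hm ▸ hn ▸ a

/-- Nested cups. -/
def cup (m : ℕ) : Diagram 0 (m + m) where
  partner := Sum.map id Fin.rev
  partner_partner := by rintro (x | x) <;> simp
  partner_ne := by
    rintro (x | x)
    · exact x.elim0
    · intro h
      have := congrArg Fin.val (Sum.inr_injective h)
      rw [Fin.val_rev] at this
      omega
  noncrossing := by
    rintro (x | x) (y | y)
    · exact x.elim0
    · exact x.elim0
    · exact y.elim0
    · simp only [pos, Sum.map_inr, Fin.val_rev]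
      omega

/-- Nested caps. -/
def cap (m : ℕ) : Diagram (m + m) 0 where
  partner := Sum.map Fin.rev id
  partner_partner := by rintro (x | x) <;> simp
  partner_ne := by
    rintro (x | x)
    · intro h
      have := congrArg Fin.val (Sum.inl_injective h)
      rw [Fin.val_rev] at this
      omega
    · exact x.elim0
  noncrossing := by
    rintro (x | x) (y | y)
    · simp only [pos, Sum.map_inl, Fin.val_rev]
      omega
    · exact y.elim0
    · exact x.elim0
    · exact x.elim0

/-- Nested cups to the left of through strands. -/
def cupL (m n : ℕ) : Diagram n (m + (m + n)) :=
  ((cup m).tensor (one n)).cast (Nat.zero_add n) (Nat.add_assoc m m n)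

/-- Nested caps to the left of through strands. -/
def capL (m n : ℕ) : Diagram (m + (m + n)) n :=
  ((cap m).tensor (one n)).cast (Nat.add_assoc m m n) (Nat.zero_add n)

/-- Nested cups to the right of through strands. -/
def cupR (m n : ℕ) : Diagram n (n + m + m) :=
  ((one n).tensor (cup m)).cast (Nat.add_zero n) (Nat.add_assoc n m m).symm

/-- Nested caps to the right of through strands. -/
def capR (m n : ℕ) : Diagram (n + m + m) n :=
  ((one n).tensor (cap m)).cast (Nat.add_assoc n m m).symm (Nat.add_zero n)

end Diagram

/-! ### Matrices of the identity and of nested cups and caps. -/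

theorem ev_one (n : ℕ) : ev (Diagram.one n) = 1 := by
  ext s t
  have : Compat (Diagram.one n) s t ↔ s = t := by
    unfold Compat
    rw [Sum.forall, funext_iff]
    simp only [Diagram.one, Sum.swap_inl, Sum.swap_inr, Sum.elim_inl, Sum.elim_inr]
    exact ⟨fun h i => h.2 i, fun h => ⟨fun i => (h i).symm, h⟩⟩
  simp only [ev, this, Matrix.one_apply]

theorem ev_cast {m n m' n' : ℕ} (hm : m = m') (hn : n = n') (a : Diagram m n) (s : Fin m' → Bool)
    (t : Fin n' → Bool) : ev (a.cast hm hn) s t = ev a (s ∘ Fin.cast hm) (t ∘ Fin.cast hn) := by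
  subst hm hn
  rfl

theorem forall_rev {m : ℕ} (u v : Fin m → Bool) :
    (∀ i, Fin.append u v (Fin.rev i) = Fin.append u v i) ↔ v = u ∘ Fin.rev := by
  rw [funext_iff]
  have e1 : ∀ i : Fin m, Fin.rev (Fin.natAdd m i) = Fin.castAdd m (Fin.rev i) := by
    intro i; ext; simp only [Fin.val_rev, Fin.val_natAdd, Fin.val_castAdd]; omega
  have e2 : ∀ i : Fin m, Fin.rev (Fin.castAdd m i) = Fin.natAdd m (Fin.rev i) := by
    intro i; ext; simp only [Fin.val_rev, Fin.val_natAdd, Fin.val_castAdd]; omega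
  constructor
  · intro h i
    have := h (Fin.natAdd m i)
    rw [e1, Fin.append_left, Fin.append_right] at this
    exact this.symm
  · intro h i
    refine Fin.addCases (fun i => ?_) (fun i => ?_) i
    · rw [e2, Fin.append_left, Fin.append_right, h]
      simp
    · rw [e1, Fin.append_left, Fin.append_right, h]
      simp

theorem ev_cup {m : ℕ} (s : Fin 0 → Bool) (u v : Fin m → Bool) :
    ev (Diagram.cup m) s (Fin.append u v) = if v = u ∘ Fin.rev then 1 else 0 := by
  have : Compat (Diagram.cup m) s (Fin.append u v) ↔ v = u ∘ Fin.rev := by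
    unfold Compat
    rw [Sum.forall, ← forall_rev]
    exact ⟨fun h => h.2, fun h => ⟨fun x => x.elim0, h⟩⟩
  simp only [ev, this]

theorem ev_cap {m : ℕ} (t : Fin 0 → Bool) (u v : Fin m → Bool) :
    ev (Diagram.cap m) (Fin.append u v) t = if v = u ∘ Fin.rev then 1 else 0 := by
  have : Compat (Diagram.cap m) (Fin.append u v) t ↔ v = u ∘ Fin.rev := by
    unfold Compat
    rw [Sum.forall, ← forall_rev]
    exact ⟨fun h => h.1, fun h => ⟨h, fun x => x.elim0⟩⟩
  simp only [ev, this]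

@[simp] theorem append_comp_castAdd {m n : ℕ} (u : Fin m → Bool) (v : Fin n → Bool) :
    Fin.append u v ∘ Fin.castAdd n = u := funext fun i => Fin.append_left u v i

@[simp] theorem append_comp_natAdd {m n : ℕ} (u : Fin m → Bool) (v : Fin n → Bool) :
    Fin.append u v ∘ Fin.natAdd m = v := funext fun i => Fin.append_right u v i

/-- A sum over the words of length `m + n`. -/
theorem sum_append {M : Type*} [AddCommMonoid M] {m n : ℕ} (g : (Fin (m + n) → Bool) → M) :
    ∑ s, g s = ∑ u, ∑ v, g (Fin.append u v) := by
  rw [← Fintype.sum_prod_type']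
  exact (Fintype.sum_equiv (Fin.appendEquiv m n) _ _ fun _ => rfl).symm

theorem append_injective_iff {m n : ℕ} {u u' : Fin m → Bool} {v v' : Fin n → Bool} :
    Fin.append u v = Fin.append u' v' ↔ u = u' ∧ v = v' := by
  constructor
  · intro h
    exact ⟨by rw [← append_comp_castAdd u v, h, append_comp_castAdd],
      by rw [← append_comp_natAdd u v, h, append_comp_natAdd]⟩
  · rintro ⟨rfl, rfl⟩
    rfl

theorem ev_cupL {m n : ℕ} (s : Fin n → Bool) (u v : Fin m → Bool) (w : Fin n → Bool) :
    ev (Diagram.cupL m n) s (Fin.append u (Fin.append v w)) =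
      (if v = u ∘ Fin.rev then 1 else 0) * (if s = w then 1 else 0) := by
  rw [Diagram.cupL, ev_cast, ev_tensor, ev_one]
  have e : Fin.append u (Fin.append v w) ∘ Fin.cast (Nat.add_assoc m m n) =
      Fin.append (Fin.append u v) w := by
    rw [Fin.append_assoc]
  have e2 : (s ∘ Fin.cast (Nat.zero_add n)) ∘ Fin.natAdd 0 = s := by
    funext i
    exact congrArg s (Fin.ext (by simp))
  rw [e, append_comp_castAdd, append_comp_natAdd, ev_cup, e2, Matrix.one_apply]

theorem ev_capL {m n : ℕ} (s : Fin n → Bool) (u v : Fin m → Bool) (w : Fin n → Bool) :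
    ev (Diagram.capL m n) (Fin.append u (Fin.append v w)) s =
      (if v = u ∘ Fin.rev then 1 else 0) * (if w = s then 1 else 0) := by
  rw [Diagram.capL, ev_cast, ev_tensor, ev_one]
  have e : Fin.append u (Fin.append v w) ∘ Fin.cast (Nat.add_assoc m m n) =
      Fin.append (Fin.append u v) w := by
    rw [Fin.append_assoc]
  have e2 : (s ∘ Fin.cast (Nat.zero_add n)) ∘ Fin.natAdd 0 = s := by
    funext i
    exact congrArg s (Fin.ext (by simp))
  rw [e, append_comp_castAdd, append_comp_natAdd, ev_cap, e2, Matrix.one_apply]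

theorem ev_cupR {m n : ℕ} (s : Fin n → Bool) (u v : Fin m → Bool) (w : Fin n → Bool) :
    ev (Diagram.cupR m n) s (Fin.append (Fin.append w u) v) =
      (if s = w then 1 else 0) * (if v = u ∘ Fin.rev then 1 else 0) := by
  rw [Diagram.cupR, ev_cast, ev_tensor, ev_one]
  have e : Fin.append (Fin.append w u) v ∘ Fin.cast (Nat.add_assoc n m m).symm =
      Fin.append w (Fin.append u v) := by
    rw [Fin.append_assoc]
    funext i
    simp
  have e2 : (s ∘ Fin.cast (Nat.add_zero n)) ∘ Fin.castAdd 0 = s := by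
    funext i
    exact congrArg s (Fin.ext (by simp))
  rw [e, append_comp_castAdd, append_comp_natAdd, ev_cup, e2, Matrix.one_apply]

theorem ev_capR {m n : ℕ} (s : Fin n → Bool) (u v : Fin m → Bool) (w : Fin n → Bool) :
    ev (Diagram.capR m n) (Fin.append (Fin.append w u) v) s =
      (if w = s then 1 else 0) * (if v = u ∘ Fin.rev then 1 else 0) := by
  rw [Diagram.capR, ev_cast, ev_tensor, ev_one]
  have e : Fin.append (Fin.append w u) v ∘ Fin.cast (Nat.add_assoc n m m).symm =
      Fin.append w (Fin.append u v) := by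
    rw [Fin.append_assoc]
    funext i
    simp
  have e2 : (s ∘ Fin.cast (Nat.add_zero n)) ∘ Fin.castAdd 0 = s := by
    funext i
    exact congrArg s (Fin.ext (by simp))
  rw [e, append_comp_castAdd, append_comp_natAdd, ev_cap, e2, Matrix.one_apply]

/-! ### Identities between monomials -/

theorem sem_one_tensor {m n n' : ℕ} (y : Mono n n') (u u' : Fin m → Bool) (v : Fin n → Bool)
    (v' : Fin n' → Bool) :
    ((Mono.of (Diagram.one m)).tensor y).sem (Fin.append u v) (Fin.append u' v') =
      if u = u' then y.sem v v' else 0 := by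
  simp [Mono.sem_tensor, ev_one, Matrix.one_apply]

theorem sem_tensor_one {m n n' : ℕ} (y : Mono n n') (u u' : Fin m → Bool) (v : Fin n → Bool)
    (v' : Fin n' → Bool) :
    (y.tensor (Mono.of (Diagram.one m))).sem (Fin.append v u) (Fin.append v' u') =
      if u = u' then y.sem v v' else 0 := by
  simp [Mono.sem_tensor, ev_one, Matrix.one_apply]

/-- Words of length `m + n` are concatenations. -/
theorem exists_append {m n : ℕ} (s : Fin (m + n) → Bool) : ∃ u v, s = Fin.append u v :=
  ⟨s ∘ Fin.castAdd n, s ∘ Fin.natAdd m, (Fin.append_castAdd_natAdd (f := s)).symm⟩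

/-- Partial closure of the left strands. -/
noncomputable def Mono.ptraceL {m n n' : ℕ} (x : Mono (m + n) (m + n')) : Mono n n' :=
  (Mono.of (Diagram.capL m n')).comp
    (((Mono.of (Diagram.one m)).tensor x).comp (Mono.of (Diagram.cupL m n)))

/-- Partial closure of the right strands. -/
noncomputable def Mono.ptraceR {m n n' : ℕ} (x : Mono (n + m) (n' + m)) : Mono n n' :=
  (Mono.of (Diagram.capR m n')).comp
    ((x.tensor (Mono.of (Diagram.one m))).comp (Mono.of (Diagram.cupR m n)))

@[simp] theorem comp_rev_comp_rev {m : ℕ} (u : Fin m → Bool) : (u ∘ Fin.rev) ∘ Fin.rev = u := by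
  funext i
  simp

theorem comp_rev_inj {m : ℕ} {u v : Fin m → Bool} : u ∘ Fin.rev = v ∘ Fin.rev ↔ u = v :=
  Fin.rev_surjective.injective_comp_right.eq_iff

theorem sem_ptraceL {m n n' : ℕ} (x : Mono (m + n) (m + n')) (s : Fin n → Bool)
    (t : Fin n' → Bool) :
    x.ptraceL.sem s t = ∑ u, x.sem (Fin.append u s) (Fin.append u t) := by
  simp only [Mono.ptraceL, Mono.sem_comp, Mono.sem_of, Matrix.mul_apply, sum_append, ev_cupL,
    ev_capL, sem_one_tensor]
  simp only [mul_ite, ite_mul, mul_one, mul_zero, zero_mul, one_mul, Finset.sum_ite_eq,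
    Finset.sum_ite_eq', Finset.mem_univ, if_true, Finset.sum_const_zero, Finset.sum_ite_irrel]
  -- The nested arcs produce the closing word in mirror image; the sum over all words does not
  -- notice the reversal.
  exact Fintype.sum_equiv (Equiv.arrowCongr Fin.revPerm (Equiv.refl _)) _ _ fun _ => rfl

theorem sem_ptraceR {m n n' : ℕ} (x : Mono (n + m) (n' + m)) (s : Fin n → Bool)
    (t : Fin n' → Bool) :
    x.ptraceR.sem s t = ∑ u, x.sem (Fin.append s u) (Fin.append t u) := by
  simp only [Mono.ptraceR, Mono.sem_comp, Mono.sem_of, Matrix.mul_apply, sum_append, ev_cupR,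
    ev_capR, sem_tensor_one]
  simp only [mul_ite, ite_mul, mul_one, mul_zero, zero_mul, one_mul, Finset.sum_ite_eq,
    Finset.sum_ite_eq', Finset.mem_univ, if_true, Finset.sum_const_zero, Finset.sum_ite_irrel,
    comp_rev_inj]

/-- On matrices a partial closure is a partial trace, and a trace can be taken in two stages. This
is what makes negligibility stable under tensor products. -/
theorem Mono.closure_one_tensor_comp {m n n' : ℕ} (y : Mono n' n) (x : Mono (m + n) (m + n')) :
    (((Mono.of (Diagram.one m)).tensor y).comp x).closure = (y.comp x.ptraceL).closure := by
  apply Mono.closure_eq_of_trace_sem_eq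
  simp only [Mono.sem_comp, Matrix.trace, Matrix.diag, Matrix.mul_apply, sum_append,
    sem_one_tensor, sem_ptraceL, Finset.sum_mul]
  simp only [mul_ite, mul_zero, Finset.sum_ite_irrel, Finset.sum_const_zero,
    Finset.sum_ite_eq', Finset.mem_univ, if_true]
  rw [Finset.sum_comm]
  refine Finset.sum_congr rfl fun _ _ => ?_
  rw [Finset.sum_comm]

theorem Mono.closure_tensor_one_comp {m n n' : ℕ} (y : Mono n' n) (x : Mono (n + m) (n' + m)) :
    ((y.tensor (Mono.of (Diagram.one m))).comp x).closure = (y.comp x.ptraceR).closure := by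
  apply Mono.closure_eq_of_trace_sem_eq
  simp only [Mono.sem_comp, Matrix.trace, Matrix.diag, Matrix.mul_apply, sum_append,
    sem_tensor_one, sem_ptraceR, Finset.sum_mul]
  simp only [mul_ite, mul_zero, Finset.sum_ite_eq', Finset.mem_univ, if_true]
  refine Finset.sum_congr rfl fun _ _ => ?_
  rw [Finset.sum_comm]

theorem Mono.closure_comp_comm {m n : ℕ} (y : Mono m n) (x : Mono n m) :
    (y.comp x).closure = (x.comp y).closure := by
  apply Mono.closure_eq_of_trace_sem_eq
  rw [Mono.sem_comp, Mono.sem_comp, Matrix.trace_mul_comm]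

theorem Mono.comp_assoc {l m n k : ℕ} (z : Mono n k) (y : Mono m n) (x : Mono l m) :
    z.comp (y.comp x) = (z.comp y).comp x := by
  apply Mono.sem_injective
  simp only [Mono.sem_comp, Matrix.mul_assoc]

theorem Mono.one_comp {m n : ℕ} (x : Mono m n) : (Mono.of (Diagram.one n)).comp x = x := by
  apply Mono.sem_injective
  rw [Mono.sem_comp, Mono.sem_of, ev_one, Matrix.mul_one]

theorem Mono.comp_one {m n : ℕ} (x : Mono m n) : x.comp (Mono.of (Diagram.one m)) = x := by
  apply Mono.sem_injective
  rw [Mono.sem_comp, Mono.sem_of, ev_one, Matrix.one_mul]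

theorem Mono.tensor_comp {l m n l' m' n' : ℕ} (y : Mono m n) (x : Mono l m) (y' : Mono m' n')
    (x' : Mono l' m') :
    (y.comp x).tensor (y'.comp x') = (y.tensor y').comp (x.tensor x') := by
  apply Mono.sem_injective
  ext s t
  simp only [Mono.sem_comp, Mono.sem_tensor, Matrix.mul_apply, sum_append, append_comp_castAdd,
    append_comp_natAdd, Finset.sum_mul_sum]
  exact Finset.sum_congr rfl fun _ _ => Finset.sum_congr rfl fun _ _ => by ring

theorem Diagram.one_tensor_one (m n : ℕ) :
    (Diagram.one m).tensor (Diagram.one n) = Diagram.one (m + n) := by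
  have : Mono.of ((Diagram.one m).tensor (Diagram.one n)) = Mono.of (Diagram.one (m + n)) := by
    apply Mono.sem_injective
    ext s t
    obtain ⟨u, v, rfl⟩ := exists_append s
    obtain ⟨u', v', rfl⟩ := exists_append t
    simp [ev_tensor, ev_one, Matrix.one_apply, append_injective_iff, ite_and]
    split_ifs <;> rfl
  exact congrArg Mono.diag this

theorem Diagram.tensor_one_zero {m n : ℕ} (a : Diagram m n) : a.tensor (Diagram.one 0) = a := by
  have : Mono.of (a.tensor (Diagram.one 0)) = Mono.of a := by
    apply Mono.sem_injective
    ext s t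
    rw [Mono.sem_of, Mono.sem_of, ev_tensor, ev_one, Matrix.one_apply,
      if_pos (Subsingleton.elim _ _), mul_one]
    rfl
  exact congrArg Mono.diag this

theorem Diagram.tensor_one_succ {m n : ℕ} (a : Diagram m n) (j : ℕ) :
    (a.tensor (Diagram.one j)).tensor (Diagram.one 1) = a.tensor (Diagram.one (j + 1)) := by
  have : Mono.of ((a.tensor (Diagram.one j)).tensor (Diagram.one 1)) =
      Mono.of (a.tensor (Diagram.one (j + 1))) := by
    apply Mono.sem_injective
    ext s t
    simp only [Mono.sem_of]
    rw [ev_tensor, ev_tensor, mul_assoc]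
    refine Eq.trans ?_ (ev_tensor a (Diagram.one (j + 1)) s t).symm
    -- The lengths k + j + 1 and k + (j + 1) agree definitionally, so the words need no cast.
    have e : ∀ (k : ℕ) (s : Fin (k + j + 1) → Bool), s ∘ Fin.natAdd (k + j) =
        ((show Fin (k + (j + 1)) → Bool from s) ∘ Fin.natAdd k) ∘ Fin.natAdd j := fun k s =>
      funext fun i => congrArg s (Fin.ext (Nat.add_assoc k j i))
    rw [← Diagram.one_tensor_one j 1, ev_tensor, e, e]
    rfl
  exact congrArg Mono.diag this

theorem Mono.cap_comp_one_tensor_comp_cup {m : ℕ} (x : Mono m m) :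
    (Mono.of (Diagram.cap m)).comp
      (((Mono.of (Diagram.one m)).tensor x).comp (Mono.of (Diagram.cup m))) =
      ⟨x.closure, Diagram.one 0⟩ := by
  apply Mono.sem_injective
  ext s t
  have : (Mono.sem ⟨x.closure, Diagram.one 0⟩) s t = Matrix.trace x.sem := by
    rw [Mono.trace_sem, Mono.sem, ev_one, Matrix.smul_apply, Matrix.one_apply,
      if_pos (Subsingleton.elim _ _), smul_eq_mul, mul_one]
  rw [this]
  simp only [Mono.sem_comp, Mono.sem_of, Matrix.mul_apply, sum_append, ev_cup,
    ev_cap, sem_one_tensor, Matrix.trace, Matrix.diag]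
  simp only [mul_ite, ite_mul, mul_one, mul_zero, zero_mul, one_mul,
    Finset.sum_ite_eq', Finset.mem_univ, if_true, Finset.sum_const_zero, Finset.sum_ite_irrel]
  exact Fintype.sum_equiv (Equiv.arrowCongr Fin.revPerm (Equiv.refl _)) _ _ fun _ => rfl

/-- Bending the top points down. -/
noncomputable def Mono.bend {m n : ℕ} (x : Mono m n) : Mono 0 (m + n) :=
  ((Mono.of (Diagram.one m)).tensor x).comp (Mono.of (Diagram.cup m))

theorem Mono.sem_bend {m n : ℕ} (x : Mono m n) (s : Fin 0 → Bool) (u : Fin m → Bool)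
    (v : Fin n → Bool) : x.bend.sem s (Fin.append u v) = x.sem (u ∘ Fin.rev) v := by
  simp only [Mono.bend, Mono.sem_comp, Mono.sem_of, Matrix.mul_apply, sum_append, ev_cup,
    sem_one_tensor]
  simp

/-- Bending the left half of the bottom points up. -/
noncomputable def Mono.unbend {m n : ℕ} (x : Mono 0 (m + n)) : Mono m n :=
  (Mono.of (Diagram.capL m n)).comp ((Mono.of (Diagram.one m)).tensor x)

theorem Mono.sem_unbend {m n : ℕ} (x : Mono 0 (m + n)) (s : Fin m → Bool) (t : Fin n → Bool) :
    x.unbend.sem s t = x.sem (fun _ => true) (Fin.append (s ∘ Fin.rev) t) := by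
  have e : s = Fin.append s (fun _ : Fin 0 => true) := by
    funext i
    exact (Fin.append_left s _ i).symm
  conv_lhs => rw [e]
  simp only [Mono.unbend, Mono.sem_comp, Mono.sem_of, Matrix.mul_apply, sum_append, ev_capL]
  refine (Finset.sum_congr rfl fun _ _ => Finset.sum_congr rfl fun _ _ => Finset.sum_congr rfl
    fun _ _ => congrArg₂ _ (sem_one_tensor x _ _ _ _) rfl).trans ?_
  simp only [mul_ite, mul_one, mul_zero, Finset.sum_ite_eq,
    Finset.sum_ite_eq', Finset.mem_univ, if_true]

/-- Bending only reverses the top word and reads it as part of the bottom word, so no matrix entry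
is lost. -/
theorem Mono.bend_injective {m n : ℕ} : Function.Injective (Mono.bend : Mono m n → _) := by
  intro x y h
  apply Mono.sem_injective
  ext s t
  have h1 := Mono.sem_bend x (fun _ => true) (s ∘ Fin.rev) t
  rwa [h, Mono.sem_bend, comp_rev_comp_rev, eq_comm] at h1

theorem Mono.unbend_injective {m n : ℕ} :
    Function.Injective (Mono.unbend : Mono 0 (m + n) → _) := by
  intro x y h
  apply Mono.sem_injective
  ext s t
  obtain ⟨u, v, rfl⟩ := exists_append t
  rw [Subsingleton.elim s (fun _ => true)]
  have h1 := Mono.sem_unbend x (u ∘ Fin.rev) v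
  rwa [h, Mono.sem_unbend, comp_rev_comp_rev, eq_comm] at h1

/-- A monomial has no loops if its matrix has no entry larger than `1`. -/
theorem Mono.loops_eq_zero {m n : ℕ} {x : Mono m n}
    (h : x.sem (fun _ => true) (fun _ => true) = 1) : x.loops = 0 := by
  rw [Mono.sem, Matrix.smul_apply, ev_const, smul_eq_mul, mul_one] at h
  exact (Nat.pow_eq_one.1 h).resolve_left (by norm_num)

/-- Without new loops, bending sends basis diagrams to basis diagrams with coefficient 1. -/
theorem Mono.bend_of_loops {m n : ℕ} (a : Diagram m n) : (Mono.of a).bend.loops = 0 := by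
  apply Mono.loops_eq_zero
  have e : (fun _ => true : Fin (m + n) → Bool) =
      Fin.append (fun _ => true) (fun _ => true) := by
    funext i
    refine Fin.addCases (fun i => ?_) (fun i => ?_) i <;> simp
  rw [e, Mono.sem_bend, Mono.sem_of]
  exact ev_const a

theorem Mono.unbend_of_loops {m n : ℕ} (a : Diagram 0 (m + n)) :
    (Mono.of a).unbend.loops = 0 := by
  apply Mono.loops_eq_zero
  have e : (fun _ => true : Fin (m + n) → Bool) =
      Fin.append (fun _ => true) (fun _ => true) := by
    funext i
    refine Fin.addCases (fun i => ?_) (fun i => ?_) i <;> simp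
  rw [Mono.sem_unbend, Mono.sem_of, ← ev_const a, e]
  rfl

end TemperleyLieb

namespace TemperleyLieb

/-! ### The Temperley–Lieb category -/

variable (τ : ℂ)

/-- The identity morphism. -/
noncomputable def idh (n : ℕ) : Hom n n := bas (Diagram.one n)

theorem comp_assoc {l m n k : ℕ} (h : Hom n k) (g : Hom m n) (f : Hom l m) :
    comp τ h (comp τ g f) = comp τ (comp τ h g) f := by
  induction h using hom_induction with
  | zero => simp
  | add h h' ih ih' => simp [ih, ih']
  | smul c h ih => simp [ih]
  | bas c =>
    induction g using hom_induction with
    | zero => simp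
    | add g g' ih ih' => simp [ih, ih']
    | smul c g ih => simp [ih]
    | bas b =>
      induction f using hom_induction with
      | zero => simp
      | add f f' ih ih' => simp [ih, ih']
      | smul c f ih => simp [ih]
      | bas a => simp only [← hom_of τ, Mono.comp_hom, Mono.comp_assoc]

@[simp] theorem idh_comp {m n : ℕ} (f : Hom m n) : comp τ (idh n) f = f := by
  induction f using hom_induction with
  | zero => simp
  | add f f' ih ih' => simp [ih, ih']
  | smul c f ih => simp [ih]
  | bas a => simp only [idh, ← hom_of τ, Mono.comp_hom, Mono.one_comp]

@[simp] theorem comp_idh {m n : ℕ} (f : Hom m n) : comp τ f (idh m) = f := by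
  induction f using hom_induction with
  | zero => simp
  | add f f' ih ih' => simp [ih, ih']
  | smul c f ih => simp [ih]
  | bas a => simp only [idh, ← hom_of τ, Mono.comp_hom, Mono.comp_one]

theorem tensor_comp {l m n l' m' n' : ℕ} (g : Hom m n) (f : Hom l m) (g' : Hom m' n')
    (f' : Hom l' m') :
    tensor (comp τ g f) (comp τ g' f') = comp τ (tensor g g') (tensor f f') := by
  induction g using hom_induction with
  | zero => simp
  | add h h' ih ih' => simp [ih, ih']
  | smul c h ih => simp [ih]
  | bas c =>
    induction g' using hom_induction with
    | zero => simp
    | add g g' ih ih' => simp [ih, ih']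
    | smul c g ih => simp [ih]
    | bas b =>
      induction f using hom_induction with
      | zero => simp
      | add f f' ih ih' => simp [ih, ih']
      | smul c f ih => simp [ih]
      | bas a =>
        induction f' using hom_induction with
        | zero => simp
        | add f f' ih ih' => simp [ih, ih']
        | smul c f ih => simp [ih]
        | bas a =>
          simp only [← hom_of τ, Mono.comp_hom, Mono.tensor_hom, Mono.tensor_comp]

theorem tensor_bas {m n m' n' : ℕ} (a : Diagram m n) (b : Diagram m' n') :
    tensor (bas a) (bas b) = bas (a.tensor b) := by
  simp [tensor, bas]

theorem idh_tensor_idh (m n : ℕ) : tensor (idh m) (idh n) = idh (m + n) := by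
  rw [idh, idh, idh, tensor_bas, Diagram.one_tensor_one]

theorem tensor_idh_zero {m n : ℕ} (f : Hom m n) : tensor f (idh 0) = f := by
  induction f using hom_induction with
  | zero => simp
  | add f f' ih ih' => rw [map_add, LinearMap.add_apply, ih, ih']
  | smul c f ih => rw [map_smul, LinearMap.smul_apply, ih]
  | bas a => rw [idh, tensor_bas, Diagram.tensor_one_zero]

theorem tensor_idh_succ {m n : ℕ} (f : Hom m n) (j : ℕ) :
    tensor (tensor f (idh j)) (idh 1) = tensor f (idh (j + 1)) := by
  induction f using hom_induction with
  | zero => simp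
  | add f f' ih ih' =>
    rw [map_add, LinearMap.add_apply, map_add, LinearMap.add_apply, ih, ih', map_add]; rfl
  | smul c f ih =>
    rw [map_smul, LinearMap.smul_apply, map_smul, LinearMap.smul_apply, ih, map_smul]; rfl
  | bas a =>
    simp only [idh, tensor_bas]
    rw [Diagram.tensor_one_succ]

theorem trace_comm {m n : ℕ} (g : Hom m n) (f : Hom n m) :
    trace τ (comp τ g f) = trace τ (comp τ f g) := by
  induction g using hom_induction with
  | zero => simp
  | add g g' ih ih' => simp [ih, ih']
  | smul c g ih => simp [ih]
  | bas b =>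
    induction f using hom_induction with
    | zero => simp
    | add f f' ih ih' => simp [ih, ih']
    | smul c f ih => simp [ih]
    | bas a =>
      simp only [← hom_of τ, Mono.comp_hom, Mono.trace_hom]
      rw [Mono.closure_comp_comm]

/-- Partial closure of the left strands. -/
noncomputable def ptraceL {m n n' : ℕ} (f : Hom (m + n) (m + n')) : Hom n n' :=
  comp τ (bas (Diagram.capL m n')) (comp τ (tensor (idh m) f) (bas (Diagram.cupL m n)))

/-- Partial closure of the right strands. -/
noncomputable def ptraceR {m n n' : ℕ} (f : Hom (n + m) (n' + m)) : Hom n n' :=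
  comp τ (bas (Diagram.capR m n')) (comp τ (tensor f (idh m)) (bas (Diagram.cupR m n)))

theorem trace_idh_tensor_comp {m n n' : ℕ} (g : Hom n' n) (f : Hom (m + n) (m + n')) :
    trace τ (comp τ (tensor (idh m) g) f) = trace τ (comp τ g (ptraceL τ f)) := by
  unfold ptraceL
  induction g using hom_induction with
  | zero => simp
  | add g g' ih ih' => simp [ih, ih']
  | smul c g ih => simp [ih]
  | bas b =>
    induction f using hom_induction with
    | zero => simp
    | add f f' ih ih' => simp [ih, ih']
    | smul c f ih => simp [ih]
    | bas a =>
      simp only [idh, ← hom_of τ, Mono.comp_hom, Mono.tensor_hom, Mono.trace_hom,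
        Mono.closure_one_tensor_comp, Mono.ptraceL]

theorem trace_tensor_idh_comp {m n n' : ℕ} (g : Hom n' n) (f : Hom (n + m) (n' + m)) :
    trace τ (comp τ (tensor g (idh m)) f) = trace τ (comp τ g (ptraceR τ f)) := by
  unfold ptraceR
  induction g using hom_induction with
  | zero => simp
  | add g g' ih ih' => simp [ih, ih']
  | smul c g ih => simp [ih]
  | bas b =>
    induction f using hom_induction with
    | zero => simp
    | add f f' ih ih' => simp [ih, ih']
    | smul c f ih => simp [ih]
    | bas a =>
      simp only [idh, ← hom_of τ, Mono.comp_hom, Mono.tensor_hom, Mono.trace_hom,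
        Mono.closure_tensor_one_comp, Mono.ptraceR]

/-- This expresses the trace by operations under which ideals are closed, so an ideal element of
non-zero trace yields the identity of 0. -/
theorem cap_comp_idh_tensor_comp_cup {m : ℕ} (f : Hom m m) :
    comp τ (bas (Diagram.cap m)) (comp τ (tensor (idh m) f) (bas (Diagram.cup m))) =
      trace τ f • idh 0 := by
  induction f using hom_induction with
  | zero => simp
  | add f f' ih ih' => simp [ih, ih', add_smul]
  | smul c f ih => simp [ih, mul_smul]
  | bas a =>
    simp only [idh, ← hom_of τ, Mono.comp_hom, Mono.tensor_hom,
      Mono.cap_comp_one_tensor_comp_cup, Mono.trace_hom]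
    simp [Mono.hom, Mono.of]

/-- The map is induced by an injection of the bases of diagrams, hence injective on linear
combinations. -/
theorem bend_injective {m n : ℕ} : Function.Injective
    fun f : Hom m n => comp τ (tensor (idh m) f) (bas (Diagram.cup m)) := by
  have : (fun f : Hom m n => comp τ (tensor (idh m) f) (bas (Diagram.cup m))) =
      Finsupp.mapDomain fun a => (Mono.of a).bend.diag := by
    funext f
    induction f using hom_induction with
    | zero => simp
    | add f f' ih ih' => simp [Finsupp.mapDomain_add, ← ih, ← ih']
    | smul c f ih => simp [Finsupp.mapDomain_smul, ← ih]
    | bas a =>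
      simp only [idh, ← hom_of τ, Mono.comp_hom, Mono.tensor_hom]
      change Mono.hom τ (Mono.of a).bend = _
      rw [Mono.hom, Mono.bend_of_loops, hom_of, bas, Finsupp.mapDomain_single, pow_zero]
  rw [this]
  refine Finsupp.mapDomain_injective fun a b h => ?_
  exact congrArg Mono.diag (Mono.bend_injective (Mono.ext
    ((Mono.bend_of_loops a).trans (Mono.bend_of_loops b).symm) h))

theorem unbend_injective {m n : ℕ} : Function.Injective
    fun f : Hom 0 (m + n) => comp τ (bas (Diagram.capL m n)) (tensor (idh m) f) := by
  have : (fun f : Hom 0 (m + n) => comp τ (bas (Diagram.capL m n)) (tensor (idh m) f)) =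
      Finsupp.mapDomain fun a => (Mono.of a).unbend.diag := by
    funext f
    induction f using hom_induction with
    | zero => simp
    | add f f' ih ih' => rw [Finsupp.mapDomain_add, ← ih, ← ih']; simp
    | smul c f ih => rw [Finsupp.mapDomain_smul, ← ih]; simp
    | bas a =>
      simp only [idh, ← hom_of τ, Mono.comp_hom, Mono.tensor_hom]
      change Mono.hom τ (Mono.of a).unbend = _
      rw [Mono.hom, Mono.unbend_of_loops, hom_of, bas, Finsupp.mapDomain_single, pow_zero]
  rw [this]
  refine Finsupp.mapDomain_injective fun a b h => ?_
  exact congrArg Mono.diag (Mono.unbend_injective (Mono.ext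
    ((Mono.unbend_of_loops a).trans (Mono.unbend_of_loops b).symm) h))

/-- The partner map is a fixed-point-free involution, so the ones attached to the points cancel in
pairs modulo 2. -/
theorem card_diagram {m n : ℕ} (a : Diagram m n) : Even (m + n) := by
  have h : ∑ _x : Fin m ⊕ Fin n, (1 : ZMod 2) = 0 :=
    Finset.sum_involution (fun x _ => a.partner x) (fun _ _ => by decide)
      (fun x _ _ => a.partner_ne x) (fun _ _ => Finset.mem_univ _) (fun x _ => a.partner_partner x)
  rw [Finset.sum_const, Finset.card_univ, Fintype.card_sum, Fintype.card_fin, Fintype.card_fin,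
    nsmul_one, ZMod.natCast_eq_zero_iff_even] at h
  exact h

/-- There are no morphisms between objects of different parity. -/
theorem hom_eq_zero {m n : ℕ} (h : ¬ Even (m + n)) (f : Hom m n) : f = 0 := by
  have : IsEmpty (Diagram m n) := ⟨fun a => h (card_diagram a)⟩
  exact Subsingleton.elim _ _

/-! ### Negligible morphisms -/

/-- Associativity and cyclicity of the trace move a composed factor into the test morphism. A tensor
factor is first turned into a composition with identity strands, whose trace reduces to testing
against a partial closure. -/
theorem isIdeal_negligible : IsIdeal τ (negligible τ) where
  comp_left g f hf b := by
    rw [← comp_assoc, trace_comm, ← comp_assoc]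
    exact hf _
  comp_right g f hg b := by
    rw [← comp_assoc]
    exact hg _
  tensor_left {m n m' n'} f g hg b := by
    have : tensor f g = comp τ (tensor (idh n.1) g) (tensor f (idh m'.1)) := by
      rw [← tensor_comp, idh_comp, comp_idh]
    rw [this]
    refine (congrArg (trace τ) (comp_assoc τ _ _ _).symm).trans
      ((trace_idh_tensor_comp τ g _).trans (hg _))
  tensor_right {m n m' n'} f g hf b := by
    have : tensor f g = comp τ (tensor f (idh n'.1)) (tensor (idh m.1) g) := by
      rw [← tensor_comp, idh_comp, comp_idh]
    rw [this]
    refine (congrArg (trace τ) (comp_assoc τ _ _ _).symm).trans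
      ((trace_tensor_idh_comp τ f _).trans (hf _))

theorem trace_idh_zero : trace τ (idh 0) = 1 := by
  have h : closureLoops (Diagram.one 0) = 0 := by
    have := trace_ev (Diagram.one 0)
    rw [ev_one, Matrix.trace_one, Fintype.card_eq_one_iff_nonempty_unique.2 ⟨inferInstance⟩] at this
    exact Nat.pow_right_injective le_rfl (by simpa using this.symm)
  simp [idh, bas, trace, h]

theorem negligible_ne_top : negligible τ ≠ ⊤ := by
  intro h
  let z : EvenObj := ⟨0, Even.zero⟩
  have h1 : (idh 0 : EvenHom z z) ∈ negligible τ z z := by rw [h]; trivial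
  have h2 := h1 (idh 0)
  rw [idh_comp] at h2
  exact one_ne_zero ((trace_idh_zero τ).symm.trans h2)

variable {τ} {J : EvenSubspace}

theorem IsIdeal.eq_top (hJ : IsIdeal τ J) (h : idh 0 ∈ J ⟨0, Even.zero⟩ ⟨0, Even.zero⟩) :
    J = ⊤ := by
  ext m n f
  refine ⟨fun _ => trivial, fun _ => ?_⟩
  have := hJ.tensor_left (m := m) (n := n) f _ h
  rwa [tensor_idh_zero] at this

/-- A proper ideal consists of negligible morphisms. -/
theorem IsIdeal.le_negligible (hJ : IsIdeal τ J) (hJt : J ≠ ⊤) : J ≤ negligible τ := by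
  intro m n a ha b
  by_contra hc
  apply hJt
  apply hJ.eq_top
  have h1 := hJ.comp_right a b ha
  -- The closure of `a b` is assembled inside the ideal: tensor with identity strands, put the cups
  -- above and the caps below.
  have h2 := hJ.comp_left (n := ⟨0, Even.zero⟩) (bas (Diagram.cap n.1)) _ (hJ.comp_right
    (l := ⟨0, Even.zero⟩) _ (bas (Diagram.cup n.1)) (hJ.tensor_left (m := n) (idh n.1) _ h1))
  have h3 := cap_comp_idh_tensor_comp_cup τ (comp τ a b)
  have h4 : trace τ (comp τ a b) • idh 0 ∈ J ⟨0, Even.zero⟩ ⟨0, Even.zero⟩ := by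
    rw [← h3]; exact h2
  exact (Submodule.smul_mem_iff _ hc).1 h4

end TemperleyLieb

namespace TemperleyLieb

theorem Diagram.ev_injective {m n : ℕ} : Function.Injective (ev : Diagram m n → _) := by
  intro a b h
  refine congrArg Mono.diag (Mono.sem_injective (a₁ := Mono.of a) (a₂ := Mono.of b) ?_)
  rw [Mono.sem_of, Mono.sem_of, h]

/-! ### Reflection -/

/-- The reflection of a diagram in a horizontal line. -/
def Diagram.flip {m n : ℕ} (a : Diagram m n) : Diagram n m where
  partner x := (a.partner x.swap).swap
  partner_partner x := by simp [a.partner_partner]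
  partner_ne x h := a.partner_ne x.swap (by rw [← Sum.swap_swap (a.partner _), h])
  noncrossing x y := by
    -- Reflection reverses the order of the boundary points, so a crossing of the reflected diagram
    -- is a crossing of `a` read from the partners.
    have key : ∀ z : Fin m ⊕ Fin n, pos z.swap + pos z + 1 = m + n := by
      rintro (z | z) <;> simp only [pos, Sum.swap_inl, Sum.swap_inr, Fin.val_rev] <;> omega
    have h := a.noncrossing (a.partner y.swap) (a.partner x.swap)
    rw [a.partner_partner, a.partner_partner] at h
    have h1 := key x.swap
    have h2 := key y.swap
    rw [Sum.swap_swap] at h1 h2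
    have h3 := key (a.partner x.swap)
    have h4 := key (a.partner y.swap)
    omega

theorem ev_flip {m n : ℕ} (a : Diagram m n) : ev a.flip = (ev a).transpose := by
  ext s t
  have : Compat a.flip s t ↔ Compat a t s := by
    unfold Compat
    have e : ∀ x : Fin m ⊕ Fin n, (Sum.elim s t x.swap : Bool) = Sum.elim t s x := by
      rintro (x | x) <;> rfl
    rw [(Equiv.sumComm (Fin m) (Fin n)).surjective.forall]
    simp only [Diagram.flip, Equiv.sumComm_apply, Sum.swap_swap, e]
  simp only [ev, this, Matrix.transpose_apply]

/-! ### The generators -/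

/-- The diagram with a cap and a cup at the positions `i`, `i + 1`, and through strands otherwise. -/
def Diagram.gen (n i : ℕ) (h : i + 1 < n) : Diagram n n where
  partner := Sum.elim
    (fun x => if x.1 = i then .inl ⟨i + 1, h⟩ else if x.1 = i + 1 then .inl ⟨i, Nat.lt_of_succ_lt h⟩ else .inr x)
    (fun x => if x.1 = i then .inr ⟨i + 1, h⟩ else if x.1 = i + 1 then .inr ⟨i, Nat.lt_of_succ_lt h⟩ else .inl x)
  partner_partner := by
    rintro (x | x)
    · by_cases h1 : x.1 = i
      · simp [h1]; exact Fin.ext h1.symm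
      · by_cases h2 : x.1 = i + 1
        · simp [h2]; exact Fin.ext h2.symm
        · simp [h1, h2]
    · by_cases h1 : x.1 = i
      · simp [h1]; exact Fin.ext h1.symm
      · by_cases h2 : x.1 = i + 1
        · simp [h2]; exact Fin.ext h2.symm
        · simp [h1, h2]
  partner_ne := by
    rintro (x | x)
    · by_cases h1 : x.1 = i
      · simp [h1, Fin.ext_iff]
      · by_cases h2 : x.1 = i + 1
        · simp [h2, Fin.ext_iff]
        · simp [h1, h2]
    · by_cases h1 : x.1 = i
      · simp [h1, Fin.ext_iff]
      · by_cases h2 : x.1 = i + 1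
        · simp [h2, Fin.ext_iff]
        · simp [h1, h2]
  noncrossing := by
    rintro (x | x) (y | y) <;> simp only [Sum.elim_inl, Sum.elim_inr] <;> split_ifs <;>
      simp only [pos, Fin.val_rev] <;> omega

section

variable {n i : ℕ} (h : i + 1 < n)

theorem compat_gen (s t : Fin n → Bool) : Compat (Diagram.gen n i h) s t ↔
    s ⟨i, Nat.lt_of_succ_lt h⟩ = s ⟨i + 1, h⟩ ∧ t ⟨i, Nat.lt_of_succ_lt h⟩ = t ⟨i + 1, h⟩ ∧
      ∀ x : Fin n, x.1 ≠ i → x.1 ≠ i + 1 → s x = t x := by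
  unfold Compat Diagram.gen
  rw [Sum.forall]
  simp only [Sum.elim_inl, Sum.elim_inr]
  constructor
  · rintro ⟨h1, h2⟩
    refine ⟨?_, ?_, fun x hx hx' => ?_⟩
    · simpa using (h1 ⟨i, Nat.lt_of_succ_lt h⟩).symm
    · simpa using (h2 ⟨i, Nat.lt_of_succ_lt h⟩).symm
    · simpa [hx, hx'] using h2 x
  · rintro ⟨h1, h2, h3⟩
    refine ⟨fun x => ?_, fun x => ?_⟩
    · by_cases h4 : x.1 = i
      · have : x = ⟨i, Nat.lt_of_succ_lt h⟩ := Fin.ext h4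
        subst this
        simpa using h1.symm
      · by_cases h5 : x.1 = i + 1
        · have : x = ⟨i + 1, h⟩ := Fin.ext h5
          subst this
          simpa using h1
        · simp [h4, h5, h3]
    · by_cases h4 : x.1 = i
      · have : x = ⟨i, Nat.lt_of_succ_lt h⟩ := Fin.ext h4
        subst this
        simpa using h2.symm
      · by_cases h5 : x.1 = i + 1
        · have : x = ⟨i + 1, h⟩ := Fin.ext h5
          subst this
          simpa using h2
        · simp [h4, h5, h3]

theorem ev_gen_symm (s t : Fin n → Bool) :
    ev (Diagram.gen n i h) s t = ev (Diagram.gen n i h) t s := by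
  have : Compat (Diagram.gen n i h) s t ↔ Compat (Diagram.gen n i h) t s := by
    rw [compat_gen, compat_gen]
    constructor
    · rintro ⟨h1, h2, h3⟩
      exact ⟨h2, h1, fun x hx hx' => (h3 x hx hx').symm⟩
    · rintro ⟨h1, h2, h3⟩
      exact ⟨h2, h1, fun x hx hx' => (h3 x hx hx').symm⟩
  simp only [ev, this]

/-- Recolouring the positions `i` and `i + 1`. -/
def recolour (i : ℕ) (s : Fin n → Bool) (b : Bool) : Fin n → Bool :=
  fun x => if x.1 = i ∨ x.1 = i + 1 then b else s x

/-- Once the cap accepts s, the only freedom left is the colour of the cup. Multiplying by a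
generator thus becomes a sum of two terms. -/
theorem ev_gen (s t : Fin n → Bool) : ev (Diagram.gen n i h) s t =
    if s ⟨i, Nat.lt_of_succ_lt h⟩ = s ⟨i + 1, h⟩ then
      (if t = recolour i s false then 1 else 0) + (if t = recolour i s true then 1 else 0)
    else 0 := by
  have key : Compat (Diagram.gen n i h) s t ↔ s ⟨i, Nat.lt_of_succ_lt h⟩ = s ⟨i + 1, h⟩ ∧
      t = recolour i s (t ⟨i, Nat.lt_of_succ_lt h⟩) := by
    rw [compat_gen, funext_iff]
    refine and_congr_right fun _ => ?_
    constructor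
    · rintro ⟨h1, h2⟩ x
      by_cases h4 : x.1 = i
      · have : x = ⟨i, Nat.lt_of_succ_lt h⟩ := Fin.ext h4
        subst this
        simp [recolour]
      · by_cases h5 : x.1 = i + 1
        · have : x = ⟨i + 1, h⟩ := Fin.ext h5
          subst this
          simp [recolour, h1]
        · simp [recolour, h4, h5, h2]
    · intro h1
      refine ⟨?_, fun x hx hx' => ?_⟩
      · rw [h1 ⟨i + 1, h⟩]; simp [recolour]
      · rw [h1 x]; simp [recolour, hx, hx']
  have hne : ∀ b, t = recolour i s b → b = t ⟨i, Nat.lt_of_succ_lt h⟩ := by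
    rintro b rfl
    simp [recolour]
  simp only [ev, key, ite_and]
  refine if_congr Iff.rfl ?_ rfl
  generalize ht : t ⟨i, Nat.lt_of_succ_lt h⟩ = b at hne
  cases b
  · rw [if_neg (c := t = recolour i s true) (fun h => Bool.noConfusion (hne _ h)), add_zero]
  · rw [if_neg (c := t = recolour i s false) (fun h => Bool.noConfusion (hne _ h)), zero_add]

theorem ev_gen_mul {k : ℕ} (M : Matrix (Fin n → Bool) (Fin k → Bool) ℕ) (s : Fin n → Bool)
    (t : Fin k → Bool) : (ev (Diagram.gen n i h) * M) s t =
    if s ⟨i, Nat.lt_of_succ_lt h⟩ = s ⟨i + 1, h⟩ then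
      M (recolour i s false) t + M (recolour i s true) t else 0 := by
  simp only [Matrix.mul_apply, ev_gen]
  split_ifs <;> simp [add_mul, Finset.sum_add_distrib]

theorem mul_ev_gen {k : ℕ} (M : Matrix (Fin k → Bool) (Fin n → Bool) ℕ) (s : Fin k → Bool)
    (t : Fin n → Bool) : (M * ev (Diagram.gen n i h)) s t =
    if t ⟨i, Nat.lt_of_succ_lt h⟩ = t ⟨i + 1, h⟩ then
      M s (recolour i t false) + M s (recolour i t true) else 0 := by
  have := ev_gen_mul h M.transpose t s
  rw [← Matrix.transpose_apply (M := M * _), Matrix.transpose_mul]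
  have e : (ev (Diagram.gen n i h)).transpose = ev (Diagram.gen n i h) := by
    ext u v
    exact ev_gen_symm h v u
  rw [e, this]
  rfl

/-- The cap closes the cup of `a` into one loop and the new cup replaces the old one; on matrices
both recolourings give the same entry, whence the factor 2. -/
theorem Mono.gen_comp_of_partner {m : ℕ} (a : Diagram m n)
    (ha : a.partner (.inr ⟨i, Nat.lt_of_succ_lt h⟩) = .inr ⟨i + 1, h⟩) :
    (Mono.of (Diagram.gen n i h)).comp (Mono.of a) = ⟨1, a⟩ := by
  apply Mono.sem_injective
  have ha' : a.partner (.inr ⟨i + 1, h⟩) = .inr ⟨i, Nat.lt_of_succ_lt h⟩ := by rw [← ha, a.partner_partner]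
  ext s t
  rw [Mono.sem_comp, Mono.sem_of, Mono.sem_of, mul_ev_gen, Mono.sem, Matrix.smul_apply]
  split_ifs with ht
  · have : ∀ b, ev a s (recolour i t b) = ev a s t := by
      intro b
      have h1 : Compat a s (recolour i t b) ↔ Compat a s t := by
        refine forall_congr' fun x => ?_
        by_cases h1 : x = .inr ⟨i, Nat.lt_of_succ_lt h⟩
        · subst h1
          simp [ha, recolour, ht]
        · by_cases h2 : x = .inr ⟨i + 1, h⟩
          · subst h2
            simp [ha', recolour, ht]
          · have key : ∀ y : Fin m ⊕ Fin n, y ≠ .inr ⟨i, Nat.lt_of_succ_lt h⟩ → y ≠ .inr ⟨i + 1, h⟩ →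
                (Sum.elim s (recolour i t b) y : Bool) = Sum.elim s t y := by
              rintro (y | y) h3 h4
              · rfl
              · have h3' : y.1 ≠ i := fun h => h3 (congrArg _ (Fin.ext h))
                have h4' : y.1 ≠ i + 1 := fun h => h4 (congrArg _ (Fin.ext h))
                simp [recolour, h3', h4']
            rw [key x h1 h2, key (a.partner x)]
            · intro h3
              exact h2 (by rw [← a.partner_partner x, h3, ha])
            · intro h3
              exact h1 (by rw [← a.partner_partner x, h3, ha'])
      simp only [ev, h1]
    rw [this, this, smul_eq_mul]
    ring
  · have : ¬ Compat a s t := by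
      intro hc
      have := hc (.inr ⟨i, Nat.lt_of_succ_lt h⟩)
      rw [ha] at this
      exact ht this.symm
    simp [ev, this]

end

theorem Diagram.gen_tensor_one {n i : ℕ} (h : i + 1 < n) :
    (Diagram.gen n i h).tensor (Diagram.one 1) =
      Diagram.gen (n + 1) i (Nat.lt_succ_of_lt h) := by
  apply Diagram.ev_injective
  ext s t
  rw [ev_tensor, ev_one, Matrix.one_apply, mul_ite, mul_one, mul_zero, ev,
    ev, ← ite_and]
  refine if_congr ?_ rfl rfl
  rw [compat_gen, compat_gen, funext_iff, Fin.forall_fin_one, Fin.forall_fin_succ']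
  constructor
  · rintro ⟨h1, h2, h3, h4⟩
    exact ⟨h2, h3, h4, fun _ _ => h1⟩
  · rintro ⟨h2, h3, h4, h1⟩
    exact ⟨h1 (by simp; omega) (by simp; omega), h2, h3, h4⟩

theorem Diagram.one_tensor_gen (m : ℕ) :
    (Diagram.one m).tensor (Diagram.gen 2 0 (by omega)) = Diagram.gen (m + 2) m (by omega) := by
  apply Diagram.ev_injective
  ext s t
  rw [ev_tensor, ev_one, Matrix.one_apply, ite_mul, one_mul, zero_mul, ev,
    ev, ← ite_and]
  refine if_congr ?_ rfl rfl
  rw [compat_gen, compat_gen, funext_iff]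
  constructor
  · rintro ⟨h1, h2, h3, h4⟩
    refine ⟨h2, h3, fun x hx hx' => ?_⟩
    have := h1 ⟨x.1, by omega⟩
    exact this
  · rintro ⟨h2, h3, h4⟩
    refine ⟨fun x => h4 _ ?_ ?_, h2, h3, fun x => ?_⟩
    · have := x.2; simp only [Fin.val_castAdd]; omega
    · have := x.2; simp only [Fin.val_castAdd]; omega
    · omega

theorem Diagram.gen_two : Mono.of (Diagram.gen 2 0 (by omega)) =
    (Mono.of (Diagram.cup 1)).comp (Mono.of (Diagram.cap 1)) := by
  apply Mono.sem_injective
  ext s t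
  obtain ⟨u, v, rfl⟩ := exists_append (m := 1) (n := 1) s
  obtain ⟨u', v', rfl⟩ := exists_append (m := 1) (n := 1) t
  rw [Mono.sem_comp, Mono.sem_of, Mono.sem_of, Mono.sem_of, Matrix.mul_apply, Fintype.sum_unique,
    ev_cup, ev_cap, ev, mul_ite, mul_one, mul_zero, ← ite_and]
  refine if_congr ?_ rfl rfl
  rw [compat_gen, funext_iff, funext_iff, Fin.forall_fin_one, Fin.forall_fin_one]
  have e : ∀ (u v : Fin 1 → Bool) (h : 0 < 2) (h' : 1 < 2),
      Fin.append u v (⟨0, h⟩ : Fin (1 + 1)) = u 0 ∧ Fin.append u v (⟨1, h'⟩ : Fin (1 + 1)) = v 0 :=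
    fun u v _ _ => ⟨Fin.append_left u v 0, Fin.append_right u v 0⟩
  have e1 := e u v (by omega) (by omega)
  have e2 := e u' v' (by omega) (by omega)
  constructor
  · rintro ⟨h1, h2, -⟩
    exact ⟨e2.2.symm.trans (h2.symm.trans e2.1), e1.2.symm.trans (h1.symm.trans e1.1)⟩
  · rintro ⟨h2, h1⟩
    exact ⟨e1.1.trans (h1.symm.trans e1.2.symm), e2.1.trans (h2.symm.trans e2.2.symm),
      fun x hx hx' => by omega⟩

theorem recolour_recolour {n : ℕ} (i : ℕ) (h : i < n) (s : Fin n → Bool) (b c : Bool) :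
    recolour (i + 1) (recolour i (recolour (i + 1) s b) (s ⟨i, h⟩)) c = recolour (i + 1) s c := by
  funext x
  simp only [recolour]
  by_cases h1 : x.1 = i
  · have : x = ⟨i, h⟩ := Fin.ext h1
    simp [this]
  · by_cases h2 : x.1 = i + 1
    · simp [h2]
    · by_cases h3 : x.1 = i + 1 + 1
      · simp [h3]
      · simp [h1, h2, h3]

/-- This is the straightening of a zigzag: both intermediate colours are forced to equal the colour
of s at position i, leaving one term of each sum. -/
theorem Mono.gen_comp_gen_comp_gen (n i : ℕ) (h : i + 2 < n) :
    (Mono.of (Diagram.gen n (i + 1) h)).comp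
      ((Mono.of (Diagram.gen n i (Nat.lt_of_succ_lt h))).comp
        (Mono.of (Diagram.gen n (i + 1) h))) = Mono.of (Diagram.gen n (i + 1) h) := by
  apply Mono.sem_injective
  ext s t
  simp only [Mono.sem_comp, Mono.sem_of, Matrix.mul_assoc]
  rw [ev_gen_mul, ev_gen_mul, ev_gen_mul]
  simp only [ev_gen]
  refine if_congr Iff.rfl ?_ rfl
  have e := recolour_recolour i (by omega) s
  have e1 : ∀ (s : Fin n → Bool) (b : Bool) (h : i < n), recolour (i + 1) s b ⟨i, h⟩ = s ⟨i, h⟩ :=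
    fun s b h => if_neg (by simp only; omega)
  have e2 : ∀ (j : ℕ) (s : Fin n → Bool) (b : Bool) (h : j + 1 < n),
      recolour j s b ⟨j + 1, h⟩ = b := fun j s b h => by simp [recolour]
  have e3 : ∀ (s : Fin n → Bool) (b : Bool) (h : i + 1 + 1 < n),
      recolour i s b ⟨i + 1 + 1, h⟩ = s ⟨i + 1 + 1, h⟩ := fun s b h => if_neg (by simp only; omega)
  have e4 : ∀ (s : Fin n → Bool) (b : Bool) (h : i + 1 < n),
      recolour (i + 1) s b ⟨i + 1, h⟩ = b := fun s b h => by simp [recolour]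
  simp only [e1, e2, e3, e4]
  rcases hs : s ⟨i, by omega⟩ <;> simp only [hs] at e <;> simp [e]

/-- The closing arc joins the cap to the cup into one through strand; in the partial trace the
colour of the arc is forced, so no loop factor appears. -/
theorem Mono.ptraceR_gen (n : ℕ) (h : n + 1 < n + 1 + 1) :
    (Mono.of (Diagram.gen (n + 1 + 1) n h)).ptraceR = Mono.of (Diagram.one (n + 1)) := by
  apply Mono.sem_injective
  ext s t
  have key : ∀ u : Fin 1 → Bool, Compat (Diagram.gen (n + 1 + 1) n h) (Fin.append s u)
      (Fin.append t u) ↔ u = (fun _ => s (Fin.last n)) ∧ s = t := by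
    intro u
    have e : ∀ (s : Fin (n + 1) → Bool) (h : n < n + 1 + 1) (h' : n + 1 < n + 1 + 1),
        Fin.append s u (⟨n, h⟩ : Fin (n + 1 + 1)) = s (Fin.last n) ∧
        Fin.append s u (⟨n + 1, h'⟩ : Fin (n + 1 + 1)) = u 0 :=
      fun s _ _ => ⟨Fin.append_left s u (Fin.last n), Fin.append_right s u 0⟩
    rw [compat_gen, (e s (Nat.lt_of_succ_lt h) h).1, (e s (Nat.lt_of_succ_lt h) h).2,
      (e t (Nat.lt_of_succ_lt h) h).1, (e t (Nat.lt_of_succ_lt h) h).2, funext_iff, funext_iff,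
      Fin.forall_fin_one]
    constructor
    · rintro ⟨h1, h2, h3⟩
      refine ⟨h1.symm, fun x => ?_⟩
      by_cases hx : x = Fin.last n
      · rw [hx, h1, h2]
      · have h4 := h3 (Fin.castAdd 1 x) (fun h => hx (Fin.ext h)) x.2.ne
        rwa [Fin.append_left, Fin.append_left] at h4
    · rintro ⟨h1, h2⟩
      refine ⟨h1.symm, by rw [← h2, h1], fun x _ _ => ?_⟩
      rw [funext h2]
  rw [sem_ptraceR]
  simp only [Mono.sem_of, ev, key, ite_and]
  rw [Finset.sum_ite_eq' Finset.univ _ fun _ => _, if_pos (Finset.mem_univ _)]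
  exact (congrFun (congrFun (ev_one (n + 1)) s) t).symm

theorem Mono.ptraceR_one (n : ℕ) :
    (Mono.of (Diagram.one (n + 1))).ptraceR = ⟨1, Diagram.one n⟩ := by
  apply Mono.sem_injective
  ext s t
  rw [sem_ptraceR]
  simp only [Mono.sem_of, ev_one, Matrix.one_apply, append_injective_iff, and_true]
  rw [Mono.sem, Matrix.smul_apply, ev_one, Matrix.one_apply]
  simp

end TemperleyLieb

namespace TemperleyLieb

/-! ### Relations between the generators -/

section Generators

variable (τ : ℂ)

theorem tensor_idh_comp {l m n : ℕ} (k : ℕ) (g : Hom m n) (f : Hom l m) :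
    tensor (comp τ g f) (idh k) = comp τ (tensor g (idh k)) (tensor f (idh k)) := by
  rw [← tensor_comp, idh_comp]

theorem tensor_one_one {m n : ℕ} (f : Hom m n) :
    tensor (tensor f (idh 1)) (idh 1) = tensor f (idh 2) := tensor_idh_succ f 1

theorem gen_tensor_idh {n i : ℕ} (h : i + 1 < n) :
    tensor (bas (Diagram.gen n i h)) (idh 1) =
      bas (Diagram.gen (n + 1) i (Nat.lt_succ_of_lt h)) := by
  rw [idh, tensor_bas, Diagram.gen_tensor_one]

theorem gen_comp_bas {m n i : ℕ} (h : i + 1 < n) (a : Diagram m n)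
    (ha : a.partner (.inr ⟨i, Nat.lt_of_succ_lt h⟩) = .inr ⟨i + 1, h⟩) :
    comp τ (bas (Diagram.gen n i h)) (bas a) = loopValue τ • bas a := by
  rw [← hom_of τ, ← hom_of τ, Mono.comp_hom, Mono.gen_comp_of_partner h a ha]
  simp [Mono.hom, Mono.of]

theorem gen_comp_gen {n i : ℕ} (h : i + 1 < n) :
    comp τ (bas (Diagram.gen n i h)) (bas (Diagram.gen n i h)) =
      loopValue τ • bas (Diagram.gen n i h) :=
  gen_comp_bas τ h _ (by simp [Diagram.gen])

theorem gen_comp_gen_comp_gen {n i : ℕ} (h : i + 2 < n) :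
    comp τ (bas (Diagram.gen n (i + 1) h)) (comp τ (bas (Diagram.gen n i (Nat.lt_of_succ_lt h)))
      (bas (Diagram.gen n (i + 1) h))) = bas (Diagram.gen n (i + 1) h) := by
  simp only [← hom_of τ, Mono.comp_hom, Mono.gen_comp_gen_comp_gen]

theorem gen_eq_tensor (m : ℕ) (h : m + 1 < m + 2) :
    bas (Diagram.gen (m + 2) m h) = tensor (idh m) (bas (Diagram.gen 2 0 (by omega))) := by
  rw [idh, tensor_bas, Diagram.one_tensor_gen]

/-- A cup at the right end. -/
noncomputable def lastCup (m : ℕ) : Hom m (m + 2) := tensor (idh m) (bas (Diagram.cup 1))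

/-- A cap at the right end. -/
noncomputable def lastCap (m : ℕ) : Hom (m + 2) m := tensor (idh m) (bas (Diagram.cap 1))

theorem gen_eq_lastCup_comp_lastCap (m : ℕ) (h : m + 1 < m + 2) :
    bas (Diagram.gen (m + 2) m h) = comp τ (lastCup m) (lastCap m) := by
  have h1 : bas (Diagram.gen 2 0 (by omega)) =
      comp τ (bas (Diagram.cup 1)) (bas (Diagram.cap 1)) := by
    rw [← hom_of τ, ← hom_of τ, ← hom_of τ, Mono.comp_hom, Diagram.gen_two]
  rw [gen_eq_tensor, h1]
  have := tensor_comp τ (idh m) (idh m) (bas (Diagram.cup 1)) (bas (Diagram.cap 1))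
  rw [idh_comp] at this
  exact this

theorem lastCap_comp_tensor {m n : ℕ} (f : Hom m n) :
    comp τ (lastCap n) (tensor f (idh 2)) = comp τ f (lastCap m) := by
  have h1 := tensor_comp τ (idh n) f (bas (Diagram.cap 1)) (idh 2)
  have h2 := tensor_comp τ f (idh m) (idh 0) (bas (Diagram.cap 1))
  rw [idh_comp, comp_idh] at h1
  rw [idh_comp, comp_idh, tensor_idh_zero] at h2
  exact h1.symm.trans h2

theorem gen_comp_tensor {m : ℕ} (f : Hom m m) (h : m + 1 < m + 2) :
    comp τ (bas (Diagram.gen (m + 2) m h)) (tensor f (idh 2)) =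
      comp τ (tensor f (idh 2)) (bas (Diagram.gen (m + 2) m h)) := by
  rw [gen_eq_tensor, ← tensor_comp, ← tensor_comp, idh_comp, comp_idh, idh_comp, comp_idh]

/-- Every generator factors through an object with two points less. -/
theorem exists_gen_eq_comp (n i : ℕ) (h : i + 1 < n + 2) :
    ∃ (u : Hom n (n + 2)) (c : Hom (n + 2) n), bas (Diagram.gen (n + 2) i h) = comp τ u c := by
  induction n with
  | zero =>
    obtain rfl : i = 0 := by omega
    exact ⟨_, _, gen_eq_lastCup_comp_lastCap τ 0 h⟩
  | succ n ih =>
    by_cases hi : i = n + 1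
    · subst hi
      exact ⟨_, _, gen_eq_lastCup_comp_lastCap τ _ h⟩
    -- Unless the generator sits at the right end, its last strand is a through strand and can be
    -- split off.
    · obtain ⟨u, c, huc⟩ := ih (by omega)
      exact ⟨tensor u (idh 1), tensor c (idh 1), (gen_tensor_idh (n := n + 2) (by omega)).symm.trans
        ((congrArg (fun f => tensor f (idh 1)) huc).trans (tensor_idh_comp τ 1 u c))⟩

theorem trace_tensor_idh {n : ℕ} (f : Hom n n) :
    trace τ (tensor f (idh 1)) = loopValue τ * trace τ f := by
  have h1 := trace_tensor_idh_comp τ (m := 1) f (idh (n + 1))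
  have h2 : ptraceR τ (m := 1) (idh (n + 1)) = loopValue τ • idh n := by
    simp only [ptraceR, idh, ← hom_of τ, Mono.comp_hom, Mono.tensor_hom]
    refine (congrArg (Mono.hom τ) (Mono.ptraceR_one n)).trans ?_
    simp [Mono.hom, Mono.of]
  rw [h2, comp_idh, map_smul, comp_idh, map_smul, smul_eq_mul] at h1
  exact h1

theorem trace_tensor_idh_comp_gen {n : ℕ} (f : Hom (n + 1) (n + 1)) (h : n + 1 < n + 2) :
    trace τ (comp τ (tensor f (idh 1)) (bas (Diagram.gen (n + 2) n h))) = trace τ f := by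
  have h1 := trace_tensor_idh_comp τ (m := 1) f (bas (Diagram.gen (n + 2) n h))
  have h2 : ptraceR τ (m := 1) (bas (Diagram.gen (n + 2) n h)) = idh (n + 1) := by
    simp only [ptraceR, idh, ← hom_of τ, Mono.comp_hom, Mono.tensor_hom]
    exact congrArg (Mono.hom τ) (Mono.ptraceR_gen n h)
  rw [h2, comp_idh] at h1
  exact h1

end Generators

/-! ### Quantum integers -/

/-- The quantum integers. -/
noncomputable def qint (τ : ℂ) : ℕ → ℂ
  | 0 => 0
  | 1 => 1
  | n + 2 => loopValue τ * qint τ (n + 1) - qint τ n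

theorem mul_qint {τ : ℂ} (h0 : τ ≠ 0) : ∀ n, (τ - τ⁻¹) * qint τ n = τ ^ n - τ⁻¹ ^ n
  | 0 => by simp [qint]
  | 1 => by simp [qint]
  | n + 2 => by
    have h1 := mul_qint h0 (n + 1)
    have h2 := mul_qint h0 n
    have h3 : τ * τ⁻¹ = 1 := mul_inv_cancel₀ h0
    rw [qint, mul_sub, mul_left_comm, h1, h2, loopValue, pow_succ τ (n + 1), pow_succ τ n,
      pow_succ τ⁻¹ (n + 1), pow_succ τ⁻¹ n]
    linear_combination (τ ^ n - τ⁻¹ ^ n) * h3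

/-- Since ℓ > 1 the factor τ - τ⁻¹ is non-zero, so vanishing means τⁿ = τ⁻ⁿ, that is, (τ²)ⁿ = 1. -/
theorem qint_eq_zero_iff {τ : ℂ} {ℓ : ℕ} (hone : 1 < ℓ) (hτ : IsPrimitiveRoot (τ ^ 2) ℓ) (n : ℕ) :
    qint τ n = 0 ↔ ℓ ∣ n := by
  have h0 : τ ≠ 0 := by
    rintro rfl
    exact hτ.ne_zero (by omega) (by simp)
  have h1 : τ - τ⁻¹ ≠ 0 := by
    intro h
    have : τ ^ 2 = 1 := by
      have h2 := congrArg (τ * ·) h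
      simp only [mul_sub, mul_inv_cancel₀ h0, mul_zero] at h2
      linear_combination h2
    exact hτ.ne_one hone this
  rw [← hτ.pow_eq_one_iff_dvd, ← mul_eq_zero_iff_left h1, mul_qint h0, sub_eq_zero,
    inv_pow, ← pow_mul, mul_comm 2, pow_mul, sq, mul_eq_one_iff_eq_inv₀ (pow_ne_zero _ h0)]

/-! ### Jones–Wenzl projections -/

section JonesWenzl

variable (τ : ℂ)

/-- The generator at the right end. -/
noncomputable def lastGen : ∀ n : ℕ, Hom (n + 1) (n + 1)
  -- A single strand carries no generator; with the value 0 the recursion gives the identity on one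
  -- strand.
  | 0 => 0
  | m + 1 => bas (Diagram.gen (m + 2) m (Nat.lt_succ_self _))

/-- The Jones–Wenzl projections. -/
noncomputable def jw : ∀ n : ℕ, Hom n n
  | 0 => idh 0
  | n + 1 => tensor (jw n) (idh 1) - (qint τ n / qint τ (n + 1)) •
      comp τ (tensor (jw n) (idh 1)) (comp τ (lastGen n) (tensor (jw n) (idh 1)))

theorem jw_succ (n : ℕ) : jw τ (n + 1) = tensor (jw τ n) (idh 1) - (qint τ n / qint τ (n + 1)) •
      comp τ (tensor (jw τ n) (idh 1)) (comp τ (lastGen n) (tensor (jw τ n) (idh 1))) := rfl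

variable {τ}

theorem lastGen_comp_lastGen_comp_lastGen (k : ℕ) :
    comp τ (lastGen (k + 2)) (comp τ (tensor (lastGen (k + 1)) (idh 1)) (lastGen (k + 2))) =
      lastGen (k + 2) :=
  (congrArg (fun f : Hom (k + 3) (k + 3) => comp τ (lastGen (k + 2)) (comp τ f (lastGen (k + 2))))
    (gen_tensor_idh (n := k + 2) (Nat.lt_succ_self _))).trans
    (gen_comp_gen_comp_gen τ (n := k + 3) (i := k) (Nat.lt_succ_self _))

/-- Expand the middle projection by its recursion. The smaller projection commutes with the last
generator; one term then gives the loop value and the other straightens, and d - [m]/[m+1] =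
[m+2]/[m+1]. -/
theorem lastGen_comp_jw_comp_lastGen (m : ℕ) (hq : qint τ (m + 1) ≠ 0)
    (hi : comp τ (jw τ m) (jw τ m) = jw τ m) :
    comp τ (lastGen (m + 1)) (comp τ (tensor (jw τ (m + 1)) (idh 1)) (lastGen (m + 1))) =
      (qint τ (m + 2) / qint τ (m + 1)) •
        comp τ (tensor (jw τ m) (idh 2)) (lastGen (m + 1)) := by
  -- The coefficient is kept because straightening fails for m = 0, where `lastGen` is 0; there [0]
  -- = 0.
  have hG : (qint τ m / qint τ (m + 1)) • comp τ (lastGen (m + 1))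
      (comp τ (tensor (lastGen m) (idh 1)) (lastGen (m + 1))) =
      (qint τ m / qint τ (m + 1)) • lastGen (m + 1) := by
    cases m with
    | zero => simp [qint]
    | succ k => rw [lastGen_comp_lastGen_comp_lastGen]
  set X := tensor (jw τ m) (idh 2) with hX
  set E := lastGen (m + 1) with hE
  have hXX : comp τ X X = X := by rw [hX, ← tensor_idh_comp, hi]
  have hEX : comp τ E X = comp τ X E := gen_comp_tensor τ (jw τ m) _
  have hEE : comp τ E E = loopValue τ • E := gen_comp_gen τ _
  have h1 : tensor (jw τ (m + 1)) (idh 1) = X - (qint τ m / qint τ (m + 1)) •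
      comp τ X (comp τ (tensor (lastGen m) (idh 1)) X) := by
    rw [jw_succ, map_sub, map_smul, LinearMap.sub_apply, LinearMap.smul_apply, tensor_idh_comp,
      tensor_idh_comp, tensor_one_one]
  have h2 : comp τ E (comp τ (comp τ X (comp τ (tensor (lastGen m) (idh 1)) X)) E) =
      comp τ X (comp τ (comp τ E (comp τ (tensor (lastGen m) (idh 1)) E)) X) := by
    simp only [comp_assoc, hEX]
    simp only [← comp_assoc, hEX]
  have h3 : comp τ E (comp τ X E) = loopValue τ • comp τ X E := by
    rw [comp_assoc, hEX, ← comp_assoc, hEE, map_smul]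
  have h4 := congrArg (fun Z => comp τ X (comp τ Z X)) hG
  simp only [map_smul, LinearMap.smul_apply] at h4
  rw [h1, map_sub, LinearMap.sub_apply, map_sub, h3, map_smul, LinearMap.smul_apply, map_smul, h2,
    h4, hEX, comp_assoc, hXX, ← sub_smul]
  congr 1
  rw [qint]
  field_simp

theorem jw_absorb {n : ℕ} (hi : comp τ (jw τ n) (jw τ n) = jw τ n) :
    comp τ (tensor (jw τ n) (idh 1)) (jw τ (n + 1)) = jw τ (n + 1) := by
  have h : comp τ (tensor (jw τ n) (idh 1)) (tensor (jw τ n) (idh 1)) =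
      tensor (jw τ n) (idh 1) := by rw [← tensor_idh_comp, hi]
  rw [jw_succ, map_sub, map_smul, comp_assoc, h]

/-- The Jones–Wenzl projection is an idempotent that is annihilated by the generators. -/
theorem jw_idem_and_gen_comp (n : ℕ) (hq : ∀ k, 1 ≤ k → k ≤ n → qint τ k ≠ 0) :
    comp τ (jw τ n) (jw τ n) = jw τ n ∧
      ∀ i (h : i + 1 < n), comp τ (bas (Diagram.gen n i h)) (jw τ n) = 0 := by
  induction n using Nat.strong_induction_on with
  | _ n ih =>
  match n with
  | 0 => exact ⟨idh_comp τ _, fun i h => by omega⟩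
  | 1 =>
    have : jw τ 1 = idh 1 := by
      rw [jw_succ]
      simp only [qint, zero_div, zero_smul, sub_zero]
      exact idh_tensor_idh 0 1
    rw [this]
    exact ⟨idh_comp τ _, fun i h => by omega⟩
  | m + 2 =>
    obtain ⟨hi, hg⟩ := ih (m + 1) (by omega) fun k h1 h2 => hq k h1 (by omega)
    obtain ⟨hi', -⟩ := ih m (by omega) fun k h1 h2 => hq k h1 (by omega)
    have hq1 := hq (m + 1) (by omega) (by omega)
    have hq2 := hq (m + 2) (by omega) (by omega)
    have hP := jw_absorb hi
    set P := tensor (jw τ (m + 1)) (idh 1) with hPdef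
    set E := lastGen (m + 1) with hE
    -- Only the newest generator needs the recursion: its coefficient is the inverse of the ratio
    -- just computed. The earlier generators already kill P, which is absorbed by the projection.
    have hE0 : comp τ E (jw τ (m + 2)) = 0 := by
      have h1 : comp τ (tensor (jw τ m) (idh 2)) P = P := by
        rw [hPdef, ← tensor_one_one, ← tensor_idh_comp, jw_absorb hi']
      have h2 : comp τ E (tensor (jw τ m) (idh 2)) = comp τ (tensor (jw τ m) (idh 2)) E :=
        gen_comp_tensor τ (jw τ m) _
      have h3 := lastGen_comp_jw_comp_lastGen m hq1 hi'
      rw [← hPdef, ← hE] at h3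
      have h4 : comp τ E (comp τ P (comp τ E P)) =
          (qint τ (m + 2) / qint τ (m + 1)) • comp τ E P := by
        rw [comp_assoc τ P, comp_assoc, h3, map_smul, LinearMap.smul_apply, ← h2, ← comp_assoc, h1]
      rw [jw_succ, ← hPdef, ← hE, map_sub, map_smul, h4, smul_smul]
      have h5 : qint τ (m + 1) / qint τ (m + 1 + 1) * (qint τ (m + 2) / qint τ (m + 1)) = 1 := by
        field_simp
      rw [h5, one_smul, sub_self]
    constructor
    · have key : ∀ f : Hom (m + 2) (m + 2), comp τ (jw τ (m + 2)) f = comp τ P f -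
          (qint τ (m + 1) / qint τ (m + 2)) • comp τ P (comp τ E (comp τ P f)) := by
        intro f
        rw [jw_succ, ← hPdef, ← hE, map_sub, LinearMap.sub_apply, map_smul, LinearMap.smul_apply,
          ← comp_assoc, ← comp_assoc]
      rw [key, hP, hE0, map_zero, smul_zero, sub_zero]
    · intro i h
      by_cases him : i = m
      · subst him
        exact hE0
      · have h1 : comp τ (bas (Diagram.gen (m + 2) i h)) P = 0 := by
          rw [hPdef, ← gen_tensor_idh (n := m + 1) (by omega), ← tensor_idh_comp, hg, map_zero,
            LinearMap.zero_apply]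
        rw [← hP, comp_assoc, h1, map_zero, LinearMap.zero_apply]

end JonesWenzl

end TemperleyLieb

namespace TemperleyLieb

/-! ### Diagrams with and without adjacent pairs -/

/-- An innermost arc below the given one joins neighbours. If j and j' are not adjacent, the point
next to j is trapped between them by noncrossing and starts a shorter arc. -/
theorem Diagram.exists_bottom_pair_of_partner {m n : ℕ} (a : Diagram m n) {j j' : Fin n}
    (h : a.partner (.inr j) = .inr j') : ∃ (i : ℕ) (h : i + 1 < n),
      a.partner (.inr ⟨i, Nat.lt_of_succ_lt h⟩) = .inr ⟨i + 1, h⟩ := by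
  have key : ∀ (d : ℕ) (j j' : Fin n), j.1 < j'.1 → j'.1 - j.1 ≤ d →
      a.partner (.inr j) = .inr j' → ∃ (i : ℕ) (h : i + 1 < n),
        a.partner (.inr ⟨i, Nat.lt_of_succ_lt h⟩) = .inr ⟨i + 1, h⟩ := by
    intro d
    induction d with
    | zero => intro j j' h1 h2; omega
    | succ d ih =>
      intro j j' h1 h2 h3
      by_cases h4 : j'.1 = j.1 + 1
      · have e : j' = ⟨j.1 + 1, by omega⟩ := Fin.ext h4
        exact ⟨j.1, by omega, by rw [← e, ← h3]⟩
      · have h3' : a.partner (.inr j') = .inr j := by rw [← h3, a.partner_partner]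
        have hlt : j.1 + 1 < n := by omega
        have n1 := a.noncrossing (a.partner (.inr ⟨j.1 + 1, hlt⟩)) (.inr j')
        have n2 := a.noncrossing (.inr j') (.inr ⟨j.1 + 1, hlt⟩)
        rw [h3', a.partner_partner] at n1
        rw [h3'] at n2
        have n3 := a.partner_ne (.inr ⟨j.1 + 1, hlt⟩)
        have n4 : a.partner (.inr ⟨j.1 + 1, hlt⟩) ≠ .inr j := by
          intro h
          rw [← h, a.partner_partner, Sum.inr.injEq, Fin.ext_iff] at h3
          exact h4 h3.symm
        have n5 : a.partner (.inr ⟨j.1 + 1, hlt⟩) ≠ .inr j' := by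
          intro h
          rw [← h, a.partner_partner, Sum.inr.injEq, Fin.ext_iff] at h3'
          simp at h3'
        rcases hk : a.partner (.inr ⟨j.1 + 1, hlt⟩) with k | k
        · rw [hk] at n1
          simp only [pos, Fin.val_rev] at n1
          omega
        · rw [hk] at n1 n2 n3 n4 n5
          simp only [pos, Fin.val_rev, ne_eq, Sum.inr.injEq, Fin.ext_iff] at n1 n2 n3 n4 n5
          exact ih ⟨j.1 + 1, hlt⟩ k (by simp only; omega) (by simp only; omega) hk
  rcases lt_trichotomy j.1 j'.1 with h1 | h1 | h1
  · exact key _ _ _ h1 le_rfl h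
  · rw [← Fin.ext h1] at h
    exact absurd h (a.partner_ne _)
  · exact key _ _ _ h1 le_rfl (by rw [← h, a.partner_partner])

theorem Diagram.exists_top_of_no_bottom_pair {m n : ℕ} (a : Diagram m n)
    (h : ¬ ∃ (i : ℕ) (h : i + 1 < n),
      a.partner (.inr ⟨i, Nat.lt_of_succ_lt h⟩) = .inr ⟨i + 1, h⟩) (j : Fin n) :
    ∃ i, a.partner (.inr j) = .inl i := by
  rcases hj : a.partner (.inr j) with i | i
  · exact ⟨i, rfl⟩
  · exact absurd (a.exists_bottom_pair_of_partner hj) h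

/-- Otherwise all bottom points would be joined injectively to the fewer top points. -/
theorem Diagram.exists_bottom_pair {m n : ℕ} (a : Diagram m n) (hmn : m < n) :
    ∃ (i : ℕ) (h : i + 1 < n),
      a.partner (.inr ⟨i, Nat.lt_of_succ_lt h⟩) = .inr ⟨i + 1, h⟩ := by
  by_contra hc
  choose g hg using a.exists_top_of_no_bottom_pair hc
  have : Function.Injective g := fun j j' h =>
    Sum.inr_injective (by rw [← a.partner_partner (.inr j), hg, h, ← hg, a.partner_partner])
  have := Fintype.card_le_of_injective g this
  simp only [Fintype.card_fin] at this
  omega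

theorem Diagram.exists_bottom_pair_of_ne_one {n : ℕ} (a : Diagram n n) (ha : a ≠ one n) :
    ∃ (i : ℕ) (h : i + 1 < n),
      a.partner (.inr ⟨i, Nat.lt_of_succ_lt h⟩) = .inr ⟨i + 1, h⟩ := by
  by_contra hc
  apply ha
  choose g hg using a.exists_top_of_no_bottom_pair hc
  have hg' : ∀ j, a.partner (.inl (g j)) = .inr j := fun j => by rw [← hg, a.partner_partner]
  have hinj : Function.Injective g := fun j j' h =>
    Sum.inr_injective (by rw [← hg', h, hg'])
  have hmono : StrictMono g := by
    intro j j' hj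
    have h1 := a.noncrossing (.inl (g j')) (.inl (g j))
    rw [hg', hg'] at h1
    simp only [pos, Fin.val_rev] at h1
    have h2 : (g j).1 ≠ (g j').1 := fun h => hj.ne (hinj (Fin.ext h))
    rw [Fin.lt_def] at hj ⊢
    omega
  -- Noncrossing through strands preserve the order, and an order-preserving bijection of a finite
  -- chain is the identity.
  have hid : g = id := hmono.range_inj strictMono_id |>.1 (by
    rw [(Finite.injective_iff_surjective.1 hinj).range_eq, Set.range_id])
  apply Diagram.ext
  funext x
  rcases x with x | x
  · have := hg' x
    rw [hid] at this
    exact this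
  · rw [hg, hid]; rfl

theorem Diagram.gen_partner_inl {n i : ℕ} (h : i + 1 < n) :
    (gen n i h).partner (.inl ⟨i, Nat.lt_of_succ_lt h⟩) = .inl ⟨i + 1, h⟩ := by
  simp [gen]

/-! ### Properties of the Jones–Wenzl projections -/

section

variable (τ : ℂ)

/-- Reflection of morphisms in a horizontal line. -/
noncomputable def flip {m n : ℕ} : Hom m n →ₗ[ℂ] Hom n m := Finsupp.lmapDomain ℂ ℂ Diagram.flip

theorem flip_bas {m n : ℕ} (a : Diagram m n) : flip (bas a) = bas a.flip := by
  simp [flip, bas, Finsupp.mapDomain_single]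

theorem flip_comp {l m n : ℕ} (g : Hom m n) (f : Hom l m) :
    flip (comp τ g f) = comp τ (flip f) (flip g) := by
  induction g using hom_induction with
  | zero => simp
  | add g g' ih ih' => simp [ih, ih']
  | smul c g ih => simp [ih]
  | bas b =>
    induction f using hom_induction with
    | zero => simp
    | add f f' ih ih' => simp [ih, ih']
    | smul c f ih => simp [ih]
    | bas a =>
      have : (⟨loops a b, (b.comp a).flip⟩ : Mono n l) = (Mono.of a.flip).comp (Mono.of b.flip) := by
        apply Mono.sem_injective
        rw [Mono.sem_comp, Mono.sem_of, Mono.sem_of, ev_flip, ev_flip, ← Matrix.transpose_mul,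
          ev_mul_ev, Mono.sem, ev_flip, Matrix.transpose_smul]
      rw [flip_bas, flip_bas, ← hom_of τ a.flip, ← hom_of τ b.flip, Mono.comp_hom, ← this]
      simp [bas, comp, flip, Finsupp.mapDomain_single, Mono.hom]

theorem flip_tensor {m n m' n' : ℕ} (f : Hom m n) (g : Hom m' n') :
    flip (tensor f g) = tensor (flip f) (flip g) := by
  induction f using hom_induction with
  | zero => simp
  | add g g' ih ih' => simp [ih, ih']
  | smul c g ih => simp [ih]
  | bas a =>
    induction g using hom_induction with
    | zero => simp
    | add f f' ih ih' => simp [ih, ih']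
    | smul c f ih => simp [ih]
    | bas b =>
      rw [tensor_bas, flip_bas, flip_bas, flip_bas, tensor_bas]
      congr 1
      apply Diagram.ev_injective
      ext s t
      simp only [ev_flip, Matrix.transpose_apply, ev_tensor]

theorem flip_idh (n : ℕ) : flip (idh n) = idh n := by
  rw [idh, flip_bas]
  congr 1
  apply Diagram.ev_injective
  rw [ev_flip, ev_one, Matrix.transpose_one]

theorem flip_gen {n i : ℕ} (h : i + 1 < n) :
    flip (bas (Diagram.gen n i h)) = bas (Diagram.gen n i h) := by
  rw [flip_bas]
  congr 1
  apply Diagram.ev_injective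
  ext s t
  rw [ev_flip, Matrix.transpose_apply, ev_gen_symm]

theorem flip_lastGen (n : ℕ) : flip (lastGen n) = lastGen n := by
  cases n with
  | zero => exact map_zero _
  | succ n => exact flip_gen _

/-- The recursion reads the same upside down. Consequently annihilation on one side gives
annihilation on the other. -/
theorem flip_jw (n : ℕ) : flip (jw τ n) = jw τ n := by
  induction n with
  | zero => exact flip_idh 0
  | succ n ih =>
    rw [jw_succ, map_sub, map_smul, flip_comp, flip_comp, flip_tensor, ih, flip_idh, flip_lastGen,
      comp_assoc]

variable {τ} {n : ℕ}

theorem jw_comp_jw (hq : ∀ k, 1 ≤ k → k ≤ n → qint τ k ≠ 0) :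
    comp τ (jw τ n) (jw τ n) = jw τ n := (jw_idem_and_gen_comp n hq).1

theorem gen_comp_jw (hq : ∀ k, 1 ≤ k → k ≤ n → qint τ k ≠ 0) {i : ℕ} (h : i + 1 < n) :
    comp τ (bas (Diagram.gen n i h)) (jw τ n) = 0 := (jw_idem_and_gen_comp n hq).2 i h

theorem jw_comp_gen (hq : ∀ k, 1 ≤ k → k ≤ n → qint τ k ≠ 0) {i : ℕ} (h : i + 1 < n) :
    comp τ (jw τ n) (bas (Diagram.gen n i h)) = 0 := by
  have := congrArg flip (gen_comp_jw hq h)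
  rwa [flip_comp, flip_gen, flip_jw, map_zero] at this

/-- A cup at neighbouring points lets d times the diagram be written as a generator times the
diagram, and the projection kills the generator; d is invertible. -/
theorem jw_comp_bas_eq_zero (hd : loopValue τ ≠ 0) (hq : ∀ k, 1 ≤ k → k ≤ n → qint τ k ≠ 0)
    {m : ℕ} (a : Diagram m n) (h : ∃ (i : ℕ) (h : i + 1 < n),
      a.partner (.inr ⟨i, Nat.lt_of_succ_lt h⟩) = .inr ⟨i + 1, h⟩) :
    comp τ (jw τ n) (bas a) = 0 := by
  obtain ⟨i, h, hi⟩ := h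
  have h1 := gen_comp_bas τ h a hi
  have h2 := comp_assoc τ (jw τ n) (bas (Diagram.gen n i h)) (bas a)
  rw [h1, jw_comp_gen hq, map_smul, map_zero, LinearMap.zero_apply] at h2
  exact (smul_eq_zero.1 h2).resolve_left hd

/-- Multiplication by a Jones–Wenzl projection only sees the coefficient of the identity. -/
theorem jw_comp_eq_smul (hd : loopValue τ ≠ 0) (hq : ∀ k, 1 ≤ k → k ≤ n → qint τ k ≠ 0)
    (f : Hom n n) : comp τ (jw τ n) f = f (Diagram.one n) • jw τ n := by
  induction f using hom_induction with
  | zero => simp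
  | add f f' ih ih' => rw [map_add, ih, ih', Finsupp.add_apply, add_smul]
  | smul c f ih => rw [map_smul, ih, Finsupp.smul_apply, smul_assoc]
  | bas a =>
    by_cases ha : a = Diagram.one n
    · rw [ha, bas, Finsupp.single_eq_same, one_smul]
      exact comp_idh τ _
    · rw [jw_comp_bas_eq_zero hd hq a (a.exists_bottom_pair_of_ne_one ha), bas,
        Finsupp.single_eq_of_ne (Ne.symm ha), zero_smul]

theorem jw_comp_eq_zero (hd : loopValue τ ≠ 0) (hq : ∀ k, 1 ≤ k → k ≤ n → qint τ k ≠ 0)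
    {m : ℕ} (hmn : m < n) (f : Hom m n) : comp τ (jw τ n) f = 0 := by
  induction f using hom_induction with
  | zero => simp
  | add f f' ih ih' => rw [map_add, ih, ih', add_zero]
  | smul c f ih => rw [map_smul, ih, smul_zero]
  | bas a => exact jw_comp_bas_eq_zero hd hq a (a.exists_bottom_pair hmn)

theorem comp_jw_eq_zero (hd : loopValue τ ≠ 0) (hq : ∀ k, 1 ≤ k → k ≤ n → qint τ k ≠ 0)
    {m : ℕ} (hmn : m < n) (f : Hom n m) : comp τ f (jw τ n) = 0 := by
  have e : flip (flip f) = f := by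
    induction f using hom_induction with
    | zero => simp
    | add f f' ih ih' => rw [map_add, map_add, ih, ih']
    | smul c f ih => rw [map_smul, map_smul, ih]
    | bas a =>
      rw [flip_bas, flip_bas]
      congr 1
      apply Diagram.ev_injective
      rw [ev_flip, ev_flip, Matrix.transpose_transpose]
  have := congrArg flip (jw_comp_eq_zero hd hq hmn (flip f))
  rwa [flip_comp, flip_jw, e, map_zero] at this

/-- In the trace of the recursion an extra strand contributes d, while in the correction term the
Markov property removes the last generator. What remains is the recursion of the quantum integers.
-/
theorem trace_jw (hq : ∀ k, 1 ≤ k → k ≤ n → qint τ k ≠ 0) :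
    trace τ (jw τ n) = qint τ (n + 1) := by
  induction n with
  | zero => exact trace_idh_zero τ
  | succ n ih =>
    have ih := ih fun k h1 h2 => hq k h1 (by omega)
    have hP : comp τ (tensor (jw τ n) (idh 1)) (tensor (jw τ n) (idh 1)) =
        tensor (jw τ n) (idh 1) := by
      rw [← tensor_idh_comp, jw_comp_jw fun k h1 h2 => hq k h1 (by omega)]
    have hq1 := hq (n + 1) (by omega) le_rfl
    have h1 : (qint τ n / qint τ (n + 1)) • trace τ (comp τ (tensor (jw τ n) (idh 1))
        (comp τ (lastGen n) (tensor (jw τ n) (idh 1)))) = qint τ n := by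
      cases n with
      | zero => simp [qint]
      | succ k =>
        rw [trace_comm, ← comp_assoc, hP, trace_comm, lastGen, trace_tensor_idh_comp_gen, ih,
          smul_eq_mul, div_mul_cancel₀ _ hq1]
    rw [jw_succ, map_sub, map_smul, h1, trace_tensor_idh, ih, qint]

/-- The left ideal that is generated by the generators. -/
noncomputable def genIdeal (τ : ℂ) (n : ℕ) : Submodule ℂ (Hom n n) :=
  Submodule.span ℂ {f | ∃ (i : ℕ) (h : i + 1 < n) (g : Hom n n),
    f = comp τ g (bas (Diagram.gen n i h))}

theorem comp_mem_genIdeal (g : Hom n n) {f : Hom n n} (hf : f ∈ genIdeal τ n) :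
    comp τ g f ∈ genIdeal τ n := by
  induction hf using Submodule.span_induction with
  | mem f hf =>
    obtain ⟨i, h, g', rfl⟩ := hf
    exact Submodule.subset_span ⟨i, h, comp τ g g', comp_assoc τ _ _ _⟩
  | zero => rw [map_zero]; exact zero_mem _
  | add f f' _ _ ih ih' => rw [map_add]; exact add_mem ih ih'
  | smul c f _ ih => rw [map_smul]; exact Submodule.smul_mem _ _ ih

theorem tensor_mem_genIdeal {f : Hom n n} (hf : f ∈ genIdeal τ n) :
    tensor f (idh 1) ∈ genIdeal τ (n + 1) := by
  induction hf using Submodule.span_induction with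
  | mem f hf =>
    obtain ⟨i, h, g', rfl⟩ := hf
    exact Submodule.subset_span ⟨i, Nat.lt_succ_of_lt h, tensor g' (idh 1), by
      rw [tensor_idh_comp, gen_tensor_idh]⟩
  | zero => rw [map_zero, LinearMap.zero_apply]; exact zero_mem _
  | add f f' _ _ ih ih' => rw [map_add]; exact add_mem ih ih'
  | smul c f _ ih => rw [map_smul]; exact Submodule.smul_mem _ _ ih

/-- Every correction term in the recursion contains a generator, whatever its coefficient; no
quantum integer has to be invertible. -/
theorem jw_sub_idh_mem (τ : ℂ) (n : ℕ) : jw τ n - idh n ∈ genIdeal τ n := by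
  induction n with
  | zero => rw [jw, sub_self]; exact zero_mem _
  | succ n ih =>
    have h1 := tensor_mem_genIdeal ih
    rw [map_sub, LinearMap.sub_apply, idh_tensor_idh] at h1
    have h2 : comp τ (lastGen n) (tensor (jw τ n) (idh 1)) ∈ genIdeal τ (n + 1) := by
      rw [← sub_add_cancel (tensor (jw τ n) (idh 1)) (idh (n + 1)), map_add, comp_idh]
      refine add_mem (comp_mem_genIdeal _ h1) ?_
      cases n with
      | zero => exact zero_mem _
      | succ k => exact Submodule.subset_span ⟨k, Nat.lt_succ_self _, idh _, (idh_comp τ _).symm⟩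
    rw [jw_succ, sub_right_comm]
    exact sub_mem h1 (Submodule.smul_mem _ _ (comp_mem_genIdeal _ h2))

/-- The projection differs from the identity by an element of the left ideal of the generators,
which annihilates f. -/
theorem jw_comp_eq_self {m : ℕ} (f : Hom m n)
    (hf : ∀ i (h : i + 1 < n), comp τ (bas (Diagram.gen n i h)) f = 0) :
    comp τ (jw τ n) f = f := by
  have key : ∀ g ∈ genIdeal τ n, comp τ g f = 0 := by
    intro g hg
    induction hg using Submodule.span_induction with
    | mem g hg =>
      obtain ⟨i, h, g', rfl⟩ := hg
      rw [← comp_assoc, hf, map_zero]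
    | zero => rw [map_zero, LinearMap.zero_apply]
    | add g g' _ _ ih ih' => rw [map_add, LinearMap.add_apply, ih, ih', add_zero]
    | smul c g _ ih => rw [map_smul, LinearMap.smul_apply, ih, smul_zero]
  have := key _ (jw_sub_idh_mem τ n)
  rwa [map_sub, LinearMap.sub_apply, idh_comp, sub_eq_zero] at this

/-- The cap at the top of the generator survives in every composite, so the identity diagram cannot
occur. Hence the identity has coefficient 1 in each Jones–Wenzl element. -/
theorem comp_gen_apply_one {i : ℕ} (h : i + 1 < n) (g : Hom n n) :
    (comp τ g (bas (Diagram.gen n i h))) (Diagram.one n) = 0 := by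
  induction g using hom_induction with
  | zero => simp
  | add g g' ih ih' => rw [map_add, LinearMap.add_apply, Finsupp.add_apply, ih, ih', add_zero]
  | smul c g ih => rw [map_smul, LinearMap.smul_apply, Finsupp.smul_apply, ih, smul_zero]
  | bas a =>
    have h1 : a.comp (Diagram.gen n i h) ≠ Diagram.one n := by
      intro hc
      have h2 : (a.comp (Diagram.gen n i h)).partner (.inl ⟨i, Nat.lt_of_succ_lt h⟩) =
          .inl ⟨i + 1, h⟩ := by
        rw [Diagram.comp_spec _ _ _ _ (by simp [Fin.ext_iff])]
        have := Quot.sound (Glue.upper (b := a) (a := Diagram.gen n i h)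
          (.inl ⟨i, Nat.lt_of_succ_lt h⟩))
        rw [Diagram.gen_partner_inl] at this
        exact this
      rw [hc] at h2
      exact Sum.inr_ne_inl h2
    rw [← hom_of τ, ← hom_of τ, Mono.comp_hom, Mono.hom]
    exact Finsupp.single_eq_of_ne (Ne.symm h1)

theorem jw_ne_zero (τ : ℂ) (n : ℕ) : jw τ n ≠ 0 := by
  intro h
  have key : ∀ g ∈ genIdeal τ n, g (Diagram.one n) = 0 := by
    intro g hg
    induction hg using Submodule.span_induction with
    | mem g hg =>
      obtain ⟨i, h, g', rfl⟩ := hg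
      exact comp_gen_apply_one h g'
    | zero => rfl
    | add g g' _ _ ih ih' => rw [Finsupp.add_apply, ih, ih', add_zero]
    | smul c g _ ih => rw [Finsupp.smul_apply, ih, smul_zero]
  have := key _ (jw_sub_idh_mem τ n)
  rw [h, zero_sub, Finsupp.neg_apply, idh, bas, Finsupp.single_eq_same] at this
  norm_num at this

end

end TemperleyLieb

namespace TemperleyLieb

/-! ### The ideal generated by the first negligible Jones–Wenzl projection -/

section

variable {τ : ℂ} {m : ℕ}

/-- Sums of endomorphisms that factor through Jones–Wenzl projections on less than `m` strands, or
through `m` strands with the Jones–Wenzl projection and further strands. -/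
noncomputable def jwSpan (τ : ℂ) (m n : ℕ) : Submodule ℂ (Hom n n) :=
  Submodule.span ℂ ({f | ∃ (k : ℕ) (_ : k < m) (u : Hom k n) (v : Hom n k),
      f = comp τ u (comp τ (jw τ k) v)} ∪
    {f | ∃ (j : ℕ) (x : Hom (m + j) n) (y : Hom n (m + j)),
      f = comp τ x (comp τ (tensor (jw τ m) (idh j)) y)})

theorem tensor_jw_eq (k : ℕ) : tensor (jw τ k) (idh 1) = jw τ (k + 1) +
    (qint τ k / qint τ (k + 1)) •
      comp τ (tensor (jw τ k) (idh 1)) (comp τ (lastGen k) (tensor (jw τ k) (idh 1))) := by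
  rw [jw_succ, sub_add_cancel]

/-- Split the generator into cup and cap. The larger projection absorbs the smaller one, which then
slides through the cap; so the correction term of the recursion factors through a projection on
fewer strands. -/
theorem lastGen_comp_tensor_jw (k : ℕ) (hq : ∀ i, 1 ≤ i → i ≤ k → qint τ i ≠ 0) :
    comp τ (lastGen (k + 1)) (tensor (jw τ (k + 1)) (idh 1)) =
      comp τ (lastCup k) (comp τ (jw τ k) (comp τ (lastCap k) (tensor (jw τ (k + 1)) (idh 1)))) := by
  have h1 : comp τ (tensor (jw τ k) (idh 2)) (tensor (jw τ (k + 1)) (idh 1)) =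
      tensor (jw τ (k + 1)) (idh 1) := by
    rw [← tensor_one_one, ← tensor_idh_comp, jw_absorb (jw_comp_jw hq)]
  rw [comp_assoc τ (jw τ k), ← lastCap_comp_tensor, ← comp_assoc, h1, comp_assoc]
  exact congrArg (fun f => comp τ f _) (gen_eq_lastCup_comp_lastCap τ k _)

/-- Adding a strand to the projection on k strands gives the one on k + 1 strands plus a morphism
through k - 1 strands. Once m strands are reached, further strands are merely tensored on. -/
theorem tensor_mem_jwSpan (hq : ∀ k, 1 ≤ k → k ≤ m → qint τ k ≠ 0) {n : ℕ} {f : Hom n n}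
    (hf : f ∈ jwSpan τ m n) : tensor f (idh 1) ∈ jwSpan τ m (n + 1) := by
  induction hf using Submodule.span_induction with
  | mem f hf =>
    obtain ⟨k, hk, u, v, rfl⟩ | ⟨j, x, y, rfl⟩ := hf
    · rw [tensor_idh_comp, tensor_idh_comp, tensor_jw_eq, map_add, LinearMap.add_apply, map_add,
        map_smul, LinearMap.smul_apply, map_smul]
      refine add_mem ?_ (Submodule.smul_mem _ _ ?_)
      · by_cases hkm : k + 1 < m
        · exact Submodule.subset_span (.inl ⟨k + 1, hkm, _, _, rfl⟩)
        -- The threshold: the term enters the second family with j = 0 extra strands.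
        · obtain rfl : m = k + 1 := by omega
          refine Submodule.subset_span (.inr ⟨0, tensor u (idh 1), tensor v (idh 1), ?_⟩)
          rw [tensor_idh_zero]
      · cases k with
        | zero =>
          have : lastGen 0 = 0 := rfl
          rw [this, map_zero, LinearMap.zero_apply, map_zero, map_zero, LinearMap.zero_apply,
            map_zero]
          exact zero_mem _
        | succ k =>
          rw [lastGen_comp_tensor_jw k fun i h1 h2 => hq i h1 (by omega)]
          refine Submodule.subset_span (.inl ⟨k, by omega,
            comp τ (tensor u (idh 1)) (comp τ (tensor (jw τ (k + 1)) (idh 1)) (lastCup k)),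
            comp τ (lastCap k) (comp τ (tensor (jw τ (k + 1)) (idh 1)) (tensor v (idh 1))), ?_⟩)
          simp only [← comp_assoc]
    · refine Submodule.subset_span (.inr ⟨j + 1, tensor x (idh 1), tensor y (idh 1), ?_⟩)
      rw [tensor_idh_comp, tensor_idh_comp, tensor_idh_succ]
  | zero => rw [map_zero, LinearMap.zero_apply]; exact zero_mem _
  | add f f' _ _ ih ih' => rw [map_add]; exact add_mem ih ih'
  | smul c f _ ih => rw [map_smul]; exact Submodule.smul_mem _ _ ih

theorem idh_mem_jwSpan (hm : 0 < m) (hq : ∀ k, 1 ≤ k → k ≤ m → qint τ k ≠ 0) (n : ℕ) :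
    idh n ∈ jwSpan τ m n := by
  induction n with
  | zero =>
    refine Submodule.subset_span (.inl ⟨0, hm, idh 0, idh 0, ?_⟩)
    rw [comp_idh, idh_comp, jw]
  | succ n ih =>
    rw [← idh_tensor_idh]
    exact tensor_mem_jwSpan hq ih

/-- The product is a scalar times the projection. Testing b against the projection gives this scalar
times [k+1] = 0, and [k+1] is assumed non-zero. -/
theorem jw_comp_eq_zero_of_negligible (hd : loopValue τ ≠ 0) {k : EvenObj}
    (hq : ∀ i, 1 ≤ i → i ≤ k.1 + 1 → qint τ i ≠ 0) {b : EvenHom k k} (hb : b ∈ negligible τ k k) :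
    comp τ (jw τ k.1) b = 0 := by
  have hq' : ∀ i, 1 ≤ i → i ≤ k.1 → qint τ i ≠ 0 := fun i h1 h2 => hq i h1 (by omega)
  have h1 := hb (jw τ k.1)
  rw [trace_comm, jw_comp_eq_smul hd hq', map_smul, trace_jw hq', smul_eq_mul] at h1
  rw [jw_comp_eq_smul hd hq', (mul_eq_zero.1 h1).resolve_right (hq _ (by omega) le_rfl), zero_smul]

theorem jw_mem_negligible (hd : loopValue τ ≠ 0) (hq : ∀ k, 1 ≤ k → k ≤ m → qint τ k ≠ 0)
    (hz : qint τ (m + 1) = 0) (hm : Even m) : jw τ m ∈ negligible τ ⟨m, hm⟩ ⟨m, hm⟩ := by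
  intro b
  rw [jw_comp_eq_smul hd hq, map_smul, trace_jw hq, hz, smul_zero]

theorem negligible_ne_bot (hd : loopValue τ ≠ 0) (hq : ∀ k, 1 ≤ k → k ≤ m → qint τ k ≠ 0)
    (hz : qint τ (m + 1) = 0) (hm : Even m) : negligible τ ≠ ⊥ := by
  intro h
  have := jw_mem_negligible hd hq hz hm
  rw [h] at this
  exact jw_ne_zero τ m this

variable {J : EvenSubspace}

/-- Every ideal that contains the first negligible Jones–Wenzl projection contains all negligible
morphisms. -/
theorem IsIdeal.negligible_le (hJ : IsIdeal τ J) (hd : loopValue τ ≠ 0)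
    (hq : ∀ k, 1 ≤ k → k ≤ m → qint τ k ≠ 0) (hm : Even m) (hm0 : 0 < m)
    (hmem : jw τ m ∈ J ⟨m, hm⟩ ⟨m, hm⟩) : negligible τ ≤ J := by
  intro n₁ n₂ a ha
  have hN := isIdeal_negligible τ
  -- The factorisations may pass through odd objects, which the ideal does not see; the morphisms to
  -- and from them are zero.
  have even_of : ∀ {k : ℕ} (n : EvenObj), Even (k + n.1) → Even k := fun n h =>
    (Nat.even_add.1 h).2 n.2
  have hmem' : ∀ j (hj : Even j), tensor (jw τ m) (idh j) ∈
      J ⟨m + j, hm.add hj⟩ ⟨m + j, hm.add hj⟩ := fun j hj =>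
    hJ.tensor_right (m' := ⟨j, hj⟩) (n' := ⟨j, hj⟩) _ _ hmem
  have key : ∀ X ∈ jwSpan τ m n₂.1, ∀ Y ∈ jwSpan τ m n₁.1, comp τ X (comp τ a Y) ∈ J n₁ n₂ := by
    intro X hX Y hY
    induction hX using Submodule.span_induction with
    | mem X hX =>
      obtain ⟨k, hk, u, v, rfl⟩ | ⟨j, x, y, rfl⟩ := hX
      · induction hY using Submodule.span_induction with
        | mem Y hY =>
          obtain ⟨k', hk', u', v', rfl⟩ | ⟨j, x, y, rfl⟩ := hY
          · by_cases hke : Even k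
            · by_cases hke' : Even k'
              · have hb : comp τ v (comp τ a u') ∈ negligible τ ⟨k', hke'⟩ ⟨k, hke⟩ :=
                  hN.comp_left (m := n₂) (n := ⟨k, hke⟩) v _
                    (hN.comp_right (l := ⟨k', hke'⟩) a u' ha)
                -- For k different from k' the projection on more strands kills everything coming
                -- from fewer; for k = k' negligibility is used, with k + 1 ≤ m ensuring a non-zero
                -- trace.
                have h0 : comp τ (comp τ (jw τ k) (comp τ v (comp τ a u'))) (jw τ k') = 0 := by
                  rcases lt_trichotomy k k' with h | h | h
                  · exact comp_jw_eq_zero hd (fun i h1 h2 => hq i h1 (by omega)) h _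
                  · subst h
                    rw [jw_comp_eq_zero_of_negligible hd (k := ⟨k, hke⟩)
                      (fun i h1 h2 => hq i h1 (h2.trans hk)) hb, map_zero, LinearMap.zero_apply]
                  · rw [jw_comp_eq_zero hd (fun i h1 h2 => hq i h1 (by omega)) h, map_zero,
                      LinearMap.zero_apply]
                have e : comp τ (comp τ u (comp τ (jw τ k) v))
                    (comp τ a (comp τ u' (comp τ (jw τ k') v'))) = comp τ u
                    (comp τ (comp τ (comp τ (jw τ k) (comp τ v (comp τ a u'))) (jw τ k')) v') := by
                  simp only [← comp_assoc]
                rw [e, h0, map_zero, LinearMap.zero_apply, map_zero]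
                exact zero_mem _
              · rw [hom_eq_zero (fun h => hke' (even_of _ h)) u']
                simp only [map_zero, LinearMap.zero_apply]
                exact zero_mem _
            · rw [hom_eq_zero (fun h => hke (even_of _ h)) u]
              simp only [map_zero, LinearMap.zero_apply]
              exact zero_mem _
          · by_cases hj : Even j
            · rw [comp_assoc, comp_assoc]
              exact hJ.comp_left (l := n₁) (m := ⟨m + j, hm.add hj⟩) (n := n₂) _ _
                (hJ.comp_right _ _ (hmem' j hj))
            · rw [hom_eq_zero (fun h => hj ((Nat.even_add.1 (even_of _ h)).1 hm)) x]
              simp only [map_zero, LinearMap.zero_apply]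
              exact zero_mem _
        | zero => rw [map_zero, map_zero]; exact zero_mem _
        | add f f' _ _ ih ih' => rw [map_add, map_add]; exact add_mem ih ih'
        | smul c f _ ih => rw [map_smul, map_smul]; exact Submodule.smul_mem _ _ ih
      · by_cases hj : Even j
        · rw [← comp_assoc, ← comp_assoc]
          exact hJ.comp_left (l := n₁) (m := ⟨m + j, hm.add hj⟩) (n := n₂) _ _
            (hJ.comp_right _ _ (hmem' j hj))
        · rw [hom_eq_zero (fun h => hj ((Nat.even_add.1 (even_of _ h)).1 hm)) x]
          simp only [map_zero, LinearMap.zero_apply]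
          exact zero_mem _
    | zero => rw [map_zero]; exact zero_mem _
    | add f f' _ _ ih ih' => rw [map_add]; exact add_mem ih ih'
    | smul c f _ ih => rw [map_smul]; exact Submodule.smul_mem _ _ ih
  have := key _ (idh_mem_jwSpan hm0 hq _) _ (idh_mem_jwSpan hm0 hq _)
  rwa [comp_idh, idh_comp] at this

end

end TemperleyLieb

namespace TemperleyLieb

/-! ### Cup diagrams as tensors

The diagrams without top points are sent to functions on words in two letters, `true` and `false`.
A cup takes the value `1` on the word `true, false` and the value `τ` on `false, true`. -/

/-- The partner of a point of a cup diagram. -/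
def Diagram.mate {n : ℕ} (a : Diagram 0 n) (x : Fin n) : Fin n :=
  Sum.elim (fun y => y.elim0) id (a.partner (.inr x))

namespace Diagram

variable {n : ℕ} (a : Diagram 0 n)

theorem partner_inr (x : Fin n) : a.partner (.inr x) = .inr (a.mate x) := by
  unfold mate
  rcases a.partner (.inr x) with y | y
  · exact y.elim0
  · rfl

theorem mate_mate (x : Fin n) : a.mate (a.mate x) = x :=
  Sum.inr_injective (by rw [← partner_inr, ← partner_inr, a.partner_partner])

theorem mate_ne (x : Fin n) : a.mate x ≠ x := fun h =>
  a.partner_ne (.inr x) (by rw [partner_inr, h])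

theorem mate_noncrossing (x y : Fin n) :
    ¬ (x.1 < y.1 ∧ y.1 < (a.mate x).1 ∧ (a.mate x).1 < (a.mate y).1) := by
  -- Boundary positions along the bottom edge run from right to left, so the condition is read at
  -- the mates in reverse order.
  have h := a.noncrossing (.inr (a.mate y)) (.inr (a.mate x))
  rw [partner_inr, partner_inr, mate_mate, mate_mate] at h
  simp only [pos, Fin.val_rev] at h
  omega

theorem mate_ext {a b : Diagram 0 n} (h : ∀ x, a.mate x = b.mate x) : a = b := by
  apply Diagram.ext
  funext x
  rcases x with x | x
  · exact x.elim0
  · rw [partner_inr, partner_inr, h]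

theorem mate_injective : Function.Injective a.mate := fun x y h => by
  rw [← a.mate_mate x, h, a.mate_mate]

/-- The permutation that exchanges partners. -/
def matePerm : Equiv.Perm (Fin n) := ⟨a.mate, a.mate, a.mate_mate, a.mate_mate⟩

/-- The word whose letters are `true` at the left ends of the cups. -/
def opening (x : Fin n) : Bool := decide (x < a.mate x)

theorem opening_mate (x : Fin n) : a.opening (a.mate x) = !a.opening x := by
  have h := a.mate_ne x
  unfold opening
  rw [mate_mate, ← decide_not, decide_eq_decide, not_lt]
  exact ⟨le_of_lt, fun h' => lt_of_le_of_ne h' h⟩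

/-- A cup diagram is determined by the left ends of its cups. -/
theorem opening_injective : Function.Injective (opening : Diagram 0 n → _) := by
  intro a b h
  have hop : ∀ x, x < a.mate x ↔ x < b.mate x := fun x => by
    have := congrFun h x
    simpa [opening] using this
  have hcl : ∀ x, a.mate x < x ↔ b.mate x < x := fun x => by
    have h1 := hop x
    have h2 := a.mate_ne x
    have h3 := b.mate_ne x
    rw [Fin.lt_def, Fin.lt_def] at h1
    rw [Ne, Fin.ext_iff] at h2 h3
    rw [Fin.lt_def, Fin.lt_def]
    omega
  -- Induction on the width of the cup: the cups of `a` nested inside it are already cups of `b`.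
  have key : ∀ (d : ℕ) (x : Fin n), x < a.mate x → (a.mate x).1 - x.1 ≤ d →
      b.mate x = a.mate x := by
    intro d
    induction d with
    | zero => intro x h1 h2; rw [Fin.lt_def] at h1; omega
    | succ d ih =>
      intro x hx hd
      have inside : ∀ z : Fin n, x < z → z < a.mate x → x < b.mate z ∧ b.mate z < a.mate x := by
        intro z h1 h2
        have n1 := a.mate_noncrossing x z
        have n2 := a.mate_noncrossing (a.mate z) x
        have e := a.mate_mate z
        rw [e] at n2
        have n3 : a.mate z ≠ x := by
          intro h
          rw [← h, e] at h2
          exact lt_irrefl _ h2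
        have n4 : a.mate z ≠ a.mate x := fun h => h1.ne' (a.mate_injective h)
        rw [Ne, Fin.ext_iff] at n3 n4
        rw [Fin.lt_def] at h1 h2 hx
        have h3 : x.1 < (a.mate z).1 ∧ (a.mate z).1 < (a.mate x).1 := by omega
        have h4 : b.mate z = a.mate z := by
          rcases lt_trichotomy z.1 (a.mate z).1 with h5 | h5 | h5
          · exact ih z h5 (by omega)
          · exact absurd (Fin.ext h5.symm) (a.mate_ne z)
          · have h6 := ih (a.mate z) (by rw [e]; exact h5) (by rw [e]; omega)
            rw [e] at h6
            rw [← h6, b.mate_mate]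
            exact h6.symm ▸ rfl
        rw [h4]
        exact h3
      have h1 : a.mate x ≤ b.mate x := by
        by_contra hc
        have := inside (b.mate x) ((hop x).1 hx) (not_le.1 hc)
        rw [b.mate_mate] at this
        exact lt_irrefl _ this.1
      have h2 : b.mate (a.mate x) ≤ x := by
        by_contra hc
        have h3 := (hcl (a.mate x)).1 (by rwa [a.mate_mate])
        have := inside _ (not_le.1 hc) h3
        rw [b.mate_mate] at this
        exact lt_irrefl _ this.2
      by_contra hne
      have h3 : b.mate (a.mate x) ≠ x := fun h => hne (by
        have := congrArg b.mate h
        rw [b.mate_mate] at this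
        exact this.symm)
      -- The interior being used up, both ends of the cup could only be joined outwards in `b`, and
      -- these two cups would cross.
      have n1 := b.mate_noncrossing (b.mate (a.mate x)) x
      rw [b.mate_mate] at n1
      rw [Fin.ext_iff] at hne
      rw [Ne, Fin.ext_iff] at h3
      rw [Fin.le_def] at h1 h2
      rw [Fin.lt_def] at hx
      omega
  refine mate_ext fun x => ?_
  rcases lt_trichotomy x (a.mate x) with h1 | h1 | h1
  · exact (key _ x h1 le_rfl).symm
  · exact absurd h1.symm (a.mate_ne x)
  · have := key _ (a.mate x) (by rwa [a.mate_mate]) le_rfl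
    rw [a.mate_mate] at this
    conv_rhs => rw [← this]
    rw [b.mate_mate]

end Diagram

variable (τ : ℂ) {n : ℕ}

/-- The function on words that is given by a cup diagram. -/
noncomputable def vec (a : Diagram 0 n) (s : Fin n → Bool) : ℂ :=
  if ∀ x, s (a.mate x) = !s x then ∏ x, if s x = false ∧ x < a.mate x then τ else 1 else 0

/-- The linear extension of `vec`. -/
noncomputable def hvec (s : Fin n → Bool) : Hom 0 n →ₗ[ℂ] ℂ :=
  Finsupp.linearCombination ℂ fun a => vec τ a s

theorem hvec_bas (s : Fin n → Bool) (a : Diagram 0 n) : hvec τ s (bas a) = vec τ a s := by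
  simp [hvec, bas]

theorem vec_opening (a : Diagram 0 n) : vec τ a a.opening = 1 := by
  rw [vec, if_pos a.opening_mate]
  refine Finset.prod_eq_one fun x _ => if_neg ?_
  rintro ⟨h1, h2⟩
  simp [Diagram.opening, h2] at h1

/-- Twice the sum of the left ends of the cups. -/
def Diagram.height (a : Diagram 0 n) : ℕ := ∑ x : Fin n, min x.1 (a.mate x).1

theorem two_mul_sum_eq (a : Diagram 0 n) (s : Fin n → Bool) :
    2 * (∑ x : Fin n, if s x then x.1 else 0) =
      ∑ x : Fin n, ((if s x then x.1 else 0) + if s (a.mate x) then (a.mate x).1 else 0) := by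
  rw [Finset.sum_add_distrib, two_mul]
  congr 1
  exact (Fintype.sum_equiv a.matePerm _ _ fun x => rfl).symm

theorem height_eq (a : Diagram 0 n) :
    a.height = 2 * ∑ x : Fin n, if a.opening x then x.1 else 0 := by
  rw [two_mul_sum_eq a]
  refine Finset.sum_congr rfl fun x _ => ?_
  rw [a.opening_mate]
  by_cases h : x < a.mate x
  · have h1 : a.opening x = true := by simp [Diagram.opening, h]
    rw [h1]
    simpa using min_eq_left (Fin.le_def.1 h.le)
  · have h1 : a.opening x = false := by simp [Diagram.opening, h]
    rw [h1]
    simpa using Fin.le_def.1 (not_lt.1 h)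

theorem min_mate_le (a : Diagram 0 n) {s : Fin n → Bool} (h : ∀ x, s (a.mate x) = !s x)
    (x : Fin n) : min x.1 (a.mate x).1 ≤
      (if s x then x.1 else 0) + if s (a.mate x) then (a.mate x).1 else 0 := by
  rw [h]
  cases s x <;> simp

/-- A word on which the cup diagram does not vanish for trivial reasons has one `true` per cup, and
its position sum is least when every `true` is at a left end. This gives the order for the
triangularity argument. -/
theorem height_le (a : Diagram 0 n) {s : Fin n → Bool} (h : ∀ x, s (a.mate x) = !s x) :
    a.height ≤ 2 * ∑ x : Fin n, if s x then x.1 else 0 := by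
  rw [two_mul_sum_eq a]
  exact Finset.sum_le_sum fun x _ => min_mate_le a h x

theorem opening_eq_of_height_eq (a : Diagram 0 n) {s : Fin n → Bool}
    (h : ∀ x, s (a.mate x) = !s x)
    (he : a.height = 2 * ∑ x : Fin n, if s x then x.1 else 0) : a.opening = s := by
  rw [two_mul_sum_eq a] at he
  have h1 := (Finset.sum_eq_sum_iff_of_le fun x _ => min_mate_le a h x).1 he
  funext x
  have h2 := h1 x (Finset.mem_univ x)
  rw [h] at h2
  have h3 := a.mate_ne x
  rw [Ne, Fin.ext_iff] at h3
  unfold Diagram.opening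
  rcases hs : s x
  · rw [hs] at h2
    simp only [Bool.false_eq_true, Bool.not_false, if_true, if_false] at h2
    rw [decide_eq_false_iff_not, Fin.lt_def]
    omega
  · rw [hs] at h2
    simp only [Bool.false_eq_true, Bool.not_true, if_true, if_false] at h2
    rw [decide_eq_true_iff, Fin.lt_def]
    omega

/-- A linear combination of cup diagrams is determined by its function on words. -/
theorem eq_zero_of_hvec_eq_zero (f : Hom 0 n) (hf : ∀ s, hvec τ s f = 0) : f = 0 := by
  by_contra hne
  -- At the opening word of a diagram of least height no other diagram of the support contributes:
  -- the values are unitriangular.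
  obtain ⟨a, ha, hmin⟩ := Finset.exists_min_image f.support Diagram.height
    (Finsupp.support_nonempty_iff.2 hne)
  have h1 := hf a.opening
  rw [hvec, Finsupp.linearCombination_apply, Finsupp.sum, Finset.sum_eq_single_of_mem a ha] at h1
  · rw [vec_opening, smul_eq_mul, mul_one] at h1
    exact Finsupp.mem_support_iff.1 ha h1
  · intro b hb hba
    rw [vec]
    split_ifs with hc
    · exfalso
      apply hba
      apply Diagram.opening_injective
      apply opening_eq_of_height_eq b hc
      rw [← height_eq]
      refine le_antisymm ?_ (hmin b hb)
      rw [height_eq a]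
      exact height_le b hc
    · rw [smul_zero]

end TemperleyLieb

namespace TemperleyLieb

/-! ### The action of the generators on words -/

section

variable {τ : ℂ} {n i : ℕ} (h : i + 1 < n)

/-- Exchanging the letters at the positions `i` and `i + 1`. -/
def adj (h : i + 1 < n) : Equiv.Perm (Fin n) := Equiv.swap ⟨i, Nat.lt_of_succ_lt h⟩ ⟨i + 1, h⟩

/-- The cap fuses the two cups ending at i and i + 1 into one cup between their other ends, and the
new cup takes the freed positions. -/
theorem mate_gen_comp (a : Diagram 0 n) (ha : a.mate ⟨i, Nat.lt_of_succ_lt h⟩ ≠ ⟨i + 1, h⟩) :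
    ((Diagram.gen n i h).comp a).mate ⟨i, Nat.lt_of_succ_lt h⟩ = ⟨i + 1, h⟩ ∧
    ((Diagram.gen n i h).comp a).mate (a.mate ⟨i, Nat.lt_of_succ_lt h⟩) = a.mate ⟨i + 1, h⟩ ∧
    ∀ x : Fin n, x ≠ ⟨i, Nat.lt_of_succ_lt h⟩ → x ≠ ⟨i + 1, h⟩ →
      x ≠ a.mate ⟨i, Nat.lt_of_succ_lt h⟩ → x ≠ a.mate ⟨i + 1, h⟩ →
      ((Diagram.gen n i h).comp a).mate x = a.mate x := by
  set p : Fin n := ⟨i, Nat.lt_of_succ_lt h⟩ with hp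
  set q : Fin n := ⟨i + 1, h⟩ with hq
  have hpq : p ≠ q := by simp [hp, hq, Fin.ext_iff]
  have up : ∀ x : Fin n, Quot.mk (Glue a (Diagram.gen n i h)) (.inr (.inl x)) =
      Quot.mk _ (.inr (.inl (a.mate x))) := by
    intro x
    have := Quot.sound (Glue.upper (a := a) (b := Diagram.gen n i h) (.inr x))
    rw [a.partner_inr] at this
    exact this
  have low : ∀ y, Quot.mk (Glue a (Diagram.gen n i h)) (.inr y) =
      Quot.mk _ (.inr ((Diagram.gen n i h).partner y)) := fun y => Quot.sound (Glue.lower y)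
  have thr : ∀ x : Fin n, x ≠ p → x ≠ q → Quot.mk (Glue a (Diagram.gen n i h)) (.inr (.inr x)) =
      Quot.mk _ (.inr (.inl x)) := by
    intro x h1 h2
    have h1' : x.1 ≠ i := fun h => h1 (Fin.ext h)
    have h2' : x.1 ≠ i + 1 := fun h => h2 (Fin.ext h)
    rw [low (.inr x)]
    simp [Diagram.gen, h1', h2']
  have hcap : Quot.mk (Glue a (Diagram.gen n i h)) (.inr (.inl p)) =
      Quot.mk _ (.inr (.inl q)) := by
    rw [low (.inl p)]
    simp [Diagram.gen, hp, hq]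
  have hcup : Quot.mk (Glue a (Diagram.gen n i h)) (.inr (.inr p)) =
      Quot.mk _ (.inr (.inr q)) := by
    rw [low (.inr p)]
    simp [Diagram.gen, hp, hq]
  have main : ∀ x y : Fin n, x ≠ y → Quot.mk (Glue a (Diagram.gen n i h)) (.inr (.inr x)) =
      Quot.mk _ (.inr (.inr y)) → ((Diagram.gen n i h).comp a).mate x = y := by
    intro x y hxy hq
    have := (Diagram.comp_spec (Diagram.gen n i h) a (.inr x) (.inr y)
      (fun h => hxy (Sum.inr_injective h))).2 hq
    rw [Diagram.partner_inr] at this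
    exact Sum.inr_injective this
  have ha' : a.mate q ≠ p := fun h => ha (by rw [← h, a.mate_mate])
  refine ⟨main _ _ hpq hcup, main _ _ (fun h => hpq (a.mate_injective h)) ?_,
    fun x h1 h2 h3 h4 => main _ _ (a.mate_ne x).symm ?_⟩
  · rw [thr _ (a.mate_ne p) ha, thr _ ha' (a.mate_ne q), ← up, ← up, hcap]
  · rw [thr _ h1 h2, thr _ (fun h => h3 (by rw [← h, a.mate_mate]))
      (fun h => h4 (by rw [← h, a.mate_mate])), up]

theorem gen_comp_bas_of_ne (a : Diagram 0 n)
    (ha : a.mate ⟨i, Nat.lt_of_succ_lt h⟩ ≠ ⟨i + 1, h⟩) :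
    comp τ (bas (Diagram.gen n i h)) (bas a) = bas ((Diagram.gen n i h).comp a) := by
  have h1 : ((Mono.of (Diagram.gen n i h)).comp (Mono.of a)).loops = 0 := by
    apply Mono.loops_eq_zero
    rw [Mono.sem_comp, Mono.sem_of, Mono.sem_of, mul_ev_gen, if_pos rfl]
    have e : recolour i (fun _ : Fin n => true) true = fun _ => true := by
      funext x
      simp [recolour]
    have h2 : ¬ Compat a (fun _ => true) (recolour i (fun _ : Fin n => true) false) := by
      intro hc
      have := hc (.inr ⟨i, Nat.lt_of_succ_lt h⟩)
      rw [a.partner_inr] at this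
      have h3 : (a.mate ⟨i, Nat.lt_of_succ_lt h⟩).1 ≠ i := fun h => a.mate_ne _ (Fin.ext h)
      have h4 : (a.mate ⟨i, Nat.lt_of_succ_lt h⟩).1 ≠ i + 1 := fun h => ha (Fin.ext h)
      simp [recolour, h3, h4] at this
    rw [e, ev_const, ev, if_neg h2]
  rw [← hom_of τ, ← hom_of τ, Mono.comp_hom, Mono.hom, h1, pow_zero]
  rfl

theorem prod_eq_four_mul {p q x y : Fin n} (h1 : p ≠ q) (h2 : p ≠ x) (h3 : p ≠ y) (h4 : q ≠ x)
    (h5 : q ≠ y) (h6 : x ≠ y) (f : Fin n → ℂ) : ∏ z, f z =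
      f p * (f q * (f x * f y)) * ∏ z ∈ ({p, q, x, y} : Finset (Fin n))ᶜ, f z := by
  rw [← Finset.prod_mul_prod_compl ({p, q, x, y} : Finset (Fin n)),
    Finset.prod_insert (by simp [h1, h2, h3]), Finset.prod_insert (by simp [h4, h5]),
    Finset.prod_insert (by simp [h6]), Finset.prod_singleton]

theorem adj_left (s : Fin n → Bool) :
    (s ∘ adj h) ⟨i, Nat.lt_of_succ_lt h⟩ = s ⟨i + 1, h⟩ := by simp [adj]

theorem adj_right (s : Fin n → Bool) :
    (s ∘ adj h) ⟨i + 1, h⟩ = s ⟨i, Nat.lt_of_succ_lt h⟩ := by simp [adj]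

theorem adj_of_ne (s : Fin n → Bool) {x : Fin n} (h1 : x ≠ ⟨i, Nat.lt_of_succ_lt h⟩)
    (h2 : x ≠ ⟨i + 1, h⟩) : (s ∘ adj h) x = s x := by
  simp [adj, Equiv.swap_apply_of_ne_of_ne h1 h2]

theorem vec_adj_of_mate (a : Diagram 0 n)
    (ha : a.mate ⟨i, Nat.lt_of_succ_lt h⟩ = ⟨i + 1, h⟩) (s : Fin n → Bool)
    (hs : s ⟨i, Nat.lt_of_succ_lt h⟩ = true) (hs' : s ⟨i + 1, h⟩ = false) :
    vec τ a (s ∘ adj h) = τ * vec τ a s := by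
  have ha' : a.mate ⟨i + 1, h⟩ = ⟨i, Nat.lt_of_succ_lt h⟩ := by rw [← ha, a.mate_mate]
  have e1 := adj_left h s
  have e2 := adj_right h s
  have e3 := fun x => adj_of_ne h s (x := x)
  have hpq : (⟨i, Nat.lt_of_succ_lt h⟩ : Fin n) < ⟨i + 1, h⟩ := Nat.lt_succ_self i
  set s' := s ∘ adj h
  set p : Fin n := ⟨i, Nat.lt_of_succ_lt h⟩
  set q : Fin n := ⟨i + 1, h⟩
  have e4 : ∀ z, z ≠ p → z ≠ q → s' (a.mate z) = s (a.mate z) := fun z h1 h2 =>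
    e3 _ (fun h => h2 (by rw [← ha, ← h, a.mate_mate]))
      (fun h => h1 (by rw [← ha', ← h, a.mate_mate]))
  have hc : (∀ z, s' (a.mate z) = !s' z) ↔ ∀ z, s (a.mate z) = !s z := by
    refine forall_congr' fun z => ?_
    by_cases h1 : z = p
    · rw [h1, ha, e1, e2, hs, hs']; decide
    · by_cases h2 : z = q
      · rw [h2, ha', e1, e2, hs, hs']; decide
      · rw [e4 z h1 h2, e3 z h1 h2]
  unfold vec
  rw [mul_ite, mul_zero]
  refine if_congr hc ?_ rfl
  rw [← Finset.prod_mul_prod_compl ({p, q} : Finset (Fin n)),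
    ← Finset.prod_mul_prod_compl ({p, q} : Finset (Fin n)), Finset.prod_pair hpq.ne,
    Finset.prod_pair hpq.ne, ha, ha', e1, e2, hs, hs']
  have : ∏ z ∈ ({p, q} : Finset (Fin n))ᶜ, (if s' z = false ∧ z < a.mate z then τ else 1) =
      ∏ z ∈ ({p, q} : Finset (Fin n))ᶜ, (if s z = false ∧ z < a.mate z then τ else 1) := by
    refine Finset.prod_congr rfl fun z hz => ?_
    simp only [Finset.mem_compl, Finset.mem_insert, Finset.mem_singleton, not_or] at hz
    rw [e3 z hz.1 hz.2]
  rw [this]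
  simp [hpq, hpq.not_gt]

theorem forall_iff_four {p q x y : Fin n} (P : Fin n → Prop) : (∀ z, P z) ↔
    P p ∧ P q ∧ P x ∧ P y ∧ ∀ z, z ≠ p → z ≠ q → z ≠ x → z ≠ y → P z := by
  constructor
  · intro h
    exact ⟨h p, h q, h x, h y, fun z _ _ _ _ => h z⟩
  · rintro ⟨h1, h2, h3, h4, h5⟩ z
    by_cases e1 : z = p
    · exact e1 ▸ h1
    by_cases e2 : z = q
    · exact e2 ▸ h2
    by_cases e3 : z = x
    · exact e3 ▸ h3
    by_cases e4 : z = y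
    · exact e4 ▸ h4
    exact h5 z e1 e2 e3 e4

/-- The value of a cup diagram on a word, with four factors split off. -/
theorem vec_eq_four (a : Diagram 0 n) (s : Fin n → Bool) {p q x y : Fin n} (h1 : p ≠ q)
    (h2 : p ≠ x) (h3 : p ≠ y) (h4 : q ≠ x) (h5 : q ≠ y) (h6 : x ≠ y)
    {O : Prop} [Decidable O] {W : ℂ}
    (hO : (∀ z, z ≠ p → z ≠ q → z ≠ x → z ≠ y → s (a.mate z) = !s z) ↔ O)
    (hW : ∏ z ∈ ({p, q, x, y} : Finset (Fin n))ᶜ, (if s z = false ∧ z < a.mate z then τ else 1) =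
      W) : vec τ a s =
      if (s (a.mate p) = !s p) ∧ (s (a.mate q) = !s q) ∧ (s (a.mate x) = !s x) ∧
          (s (a.mate y) = !s y) ∧ O then
        (if s p = false ∧ p.1 < (a.mate p).1 then τ else 1) *
          ((if s q = false ∧ q.1 < (a.mate q).1 then τ else 1) *
          ((if s x = false ∧ x.1 < (a.mate x).1 then τ else 1) *
          (if s y = false ∧ y.1 < (a.mate y).1 then τ else 1))) * W
      else 0 := by
  rw [vec, ← hW]
  refine if_congr ((forall_iff_four _).trans (by rw [hO])) ?_ rfl
  rw [prod_eq_four_mul h1 h2 h3 h4 h5 h6]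
  rfl

/-- In this representation the cap has the value τ⁻¹ on `true, false` and 1 on `false, true`: a loop
gives τ + τ⁻¹ and a zigzag straightens. The formula is read where the new cup has the value 1. -/
theorem hvec_gen_comp_bas (h0 : τ ≠ 0) (a : Diagram 0 n) (s : Fin n → Bool)
    (hs : s ⟨i, Nat.lt_of_succ_lt h⟩ = true) (hs' : s ⟨i + 1, h⟩ = false) :
    hvec τ s (comp τ (bas (Diagram.gen n i h)) (bas a)) =
      τ⁻¹ * vec τ a s + vec τ a (s ∘ adj h) := by
  by_cases ha : a.mate ⟨i, Nat.lt_of_succ_lt h⟩ = ⟨i + 1, h⟩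
  · rw [vec_adj_of_mate h a ha s hs hs', gen_comp_bas τ h a (by rw [a.partner_inr, ha]), map_smul,
      hvec_bas, smul_eq_mul, loopValue]
    ring
  rw [gen_comp_bas_of_ne h a ha, hvec_bas]
  obtain ⟨b1, b3, b5⟩ := mate_gen_comp h a ha
  have e1 := adj_left h s
  have e2 := adj_right h s
  have e3 := fun x => adj_of_ne h s (x := x)
  have hpi : (⟨i, Nat.lt_of_succ_lt h⟩ : Fin n).1 = i := rfl
  have hqi : (⟨i + 1, h⟩ : Fin n).1 = i + 1 := rfl
  set s' := s ∘ adj h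
  set b := (Diagram.gen n i h).comp a
  set p : Fin n := ⟨i, Nat.lt_of_succ_lt h⟩
  set q : Fin n := ⟨i + 1, h⟩
  have b2 : b.mate q = p := by rw [← b1, b.mate_mate]
  have b4 : b.mate (a.mate q) = a.mate p := by rw [← b3, b.mate_mate]
  have ax := a.mate_mate p
  have ay := a.mate_mate q
  have hpx := a.mate_ne p
  have hqy := a.mate_ne q
  have hxy : a.mate p ≠ a.mate q := fun h => by
    have := congrArg Fin.val (a.mate_injective h)
    omega
  have hpy : a.mate q ≠ p := fun h => ha (by rw [← h, ay])
  have n1 := a.mate_noncrossing p q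
  have n2 := a.mate_noncrossing (a.mate p) (a.mate q)
  have n3 := a.mate_noncrossing (a.mate p) q
  have n4 := a.mate_noncrossing (a.mate q) p
  have n5 := a.mate_noncrossing p (a.mate q)
  have n6 := a.mate_noncrossing (a.mate q) (a.mate p)
  rw [ax, ay] at n2 n6
  rw [ax] at n3
  rw [ay] at n4 n5
  have hpq : p ≠ q := fun h => by have := congrArg Fin.val h; omega
  have ne : ∀ z, z ≠ p → z ≠ q → z ≠ a.mate p → z ≠ a.mate q → s' (a.mate z) = s (a.mate z) :=
    fun z _ _ hz1 hz2 => e3 _ (fun h => hz1 (by rw [← h, a.mate_mate]))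
      (fun h => hz2 (by rw [← h, a.mate_mate]))
  have c1 : (∀ z, z ≠ p → z ≠ q → z ≠ a.mate p → z ≠ a.mate q → s' (a.mate z) = !s' z) ↔
      ∀ z, z ≠ p → z ≠ q → z ≠ a.mate p → z ≠ a.mate q → s (a.mate z) = !s z := by
    refine forall_congr' fun z => forall_congr' fun h1 => forall_congr' fun h2 =>
      forall_congr' fun h3 => forall_congr' fun h4 => ?_
    rw [ne z h1 h2 h3 h4, e3 z h1 h2]
  have c2 : (∀ z, z ≠ p → z ≠ q → z ≠ a.mate p → z ≠ a.mate q → s (b.mate z) = !s z) ↔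
      ∀ z, z ≠ p → z ≠ q → z ≠ a.mate p → z ≠ a.mate q → s (a.mate z) = !s z := by
    refine forall_congr' fun z => forall_congr' fun h1 => forall_congr' fun h2 =>
      forall_congr' fun h3 => forall_congr' fun h4 => ?_
    rw [b5 z h1 h2 h3 h4]
  have w1 : ∏ z ∈ ({p, q, a.mate p, a.mate q} : Finset (Fin n))ᶜ,
      (if s' z = false ∧ z < a.mate z then τ else 1) =
      ∏ z ∈ ({p, q, a.mate p, a.mate q} : Finset (Fin n))ᶜ,
      (if s z = false ∧ z < a.mate z then τ else 1) := by
    refine Finset.prod_congr rfl fun z hz => ?_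
    simp only [Finset.mem_compl, Finset.mem_insert, Finset.mem_singleton, not_or] at hz
    rw [e3 z hz.1 hz.2.1]
  have w2 : ∏ z ∈ ({p, q, a.mate p, a.mate q} : Finset (Fin n))ᶜ,
      (if s z = false ∧ z < b.mate z then τ else 1) =
      ∏ z ∈ ({p, q, a.mate p, a.mate q} : Finset (Fin n))ᶜ,
      (if s z = false ∧ z < a.mate z then τ else 1) := by
    refine Finset.prod_congr rfl fun z hz => ?_
    simp only [Finset.mem_compl, Finset.mem_insert, Finset.mem_singleton, not_or] at hz
    rw [b5 z hz.1 hz.2.1 hz.2.2.1 hz.2.2.2]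
  classical
  -- Conditions and factors away from the four affected points are common to all terms. With them
  -- abstracted, a finite check remains.
  obtain ⟨O, hO⟩ : ∃ O : Prop, (∀ z, z ≠ p → z ≠ q → z ≠ a.mate p → z ≠ a.mate q →
      s (a.mate z) = !s z) ↔ O := ⟨_, Iff.rfl⟩
  rw [vec_eq_four a s hpq hpx.symm hpy.symm (Ne.symm ha) hqy.symm hxy hO rfl,
    vec_eq_four a s' hpq hpx.symm hpy.symm (Ne.symm ha) hqy.symm hxy (c1.trans hO) w1,
    vec_eq_four b s hpq hpx.symm hpy.symm (Ne.symm ha) hqy.symm hxy (c2.trans hO) w2, b1, b2, b3, b4, ax, ay, e1, e2, e3 _ hpx ha, e3 _ hpy hqy, hs, hs']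
  have vpx : (a.mate p).1 ≠ i := fun h => hpx (Fin.ext h)
  have vpy : (a.mate q).1 ≠ i := fun h => hpy (Fin.ext h)
  have vqx : (a.mate p).1 ≠ i + 1 := fun h => ha (Fin.ext h)
  have vqy : (a.mate q).1 ≠ i + 1 := fun h => hqy (Fin.ext h)
  have vxy : (a.mate p).1 ≠ (a.mate q).1 := fun h => hxy (Fin.ext h)
  clear hO c1 c2 w1 w2 ne e1 e2 e3 b1 b2 b3 b4 b5 ax ay hpx hqy hpy hxy ha
  generalize ∏ z ∈ ({p, q, a.mate p, a.mate q} : Finset (Fin n))ᶜ,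
      (if s z = false ∧ z < a.mate z then τ else 1) = W
  generalize s (a.mate p) = sx
  generalize s (a.mate q) = sy
  rw [hpi, hqi] at *
  generalize (a.mate p).1 = x at *
  generalize (a.mate q).1 = y at *
  by_cases hO : O
  swap
  · simp [hO]
  -- Noncrossing leaves three positions for the other ends: both left, one on each side, or both
  -- right.
  have hor : (y < x ∧ x < i) ∨ (x < i ∧ i + 1 < y) ∨ (i + 1 < y ∧ y < x) := by omega
  clear n1 n2 n3 n4 n5 n6
  rcases hor with ⟨o1, o2⟩ | ⟨o1, o2⟩ | ⟨o1, o2⟩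
  · have f1 : ¬ x < y := by omega
    have f2 : ¬ i + 1 < y := by omega
    have f3 : ¬ i < x := by omega
    have f4 : y < i + 1 := by omega
    cases sx <;> cases sy <;> simp [hO, o1, o2, f1, f2, f3, f4, h0]
  · have f1 : x < y := by omega
    have f2 : ¬ y < x := by omega
    have f3 : ¬ i < x := by omega
    have f4 : ¬ y < i + 1 := by omega
    cases sx <;> cases sy <;> simp [hO, o1, o2, f1, f2, f3, f4]
    field_simp
  · have f1 : ¬ x < y := by omega
    have f2 : ¬ x < i := by omega
    have f3 : i < x := by omega
    have f4 : ¬ y < i + 1 := by omega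
    cases sx <;> cases sy <;> simp [hO, o1, o2, f1, f2, f3, f4, h0]

end

end TemperleyLieb

namespace TemperleyLieb

/-! ### Vectors annihilated by the generators -/

section

variable {τ : ℂ} {n i : ℕ} (h : i + 1 < n)

theorem hvec_gen_comp (h0 : τ ≠ 0) (f : Hom 0 n) (s : Fin n → Bool)
    (hs : s ⟨i, Nat.lt_of_succ_lt h⟩ = true) (hs' : s ⟨i + 1, h⟩ = false) :
    hvec τ s (comp τ (bas (Diagram.gen n i h)) f) =
      τ⁻¹ * hvec τ s f + hvec τ (s ∘ adj h) f := by
  induction f using hom_induction with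
  | zero => simp
  | add f g hf hg => simp only [map_add, hf, hg]; ring
  | smul c f hf => simp only [map_smul, hf, smul_eq_mul]; ring
  | bas a => rw [hvec_gen_comp_bas h h0 a s hs hs', hvec_bas, hvec_bas]

theorem adj_adj (s : Fin n → Bool) : (s ∘ adj h) ∘ adj h = s := by
  funext x
  simp [adj]

/-- The weight of a word. -/
noncomputable def weight (τ : ℂ) (s : Fin n → Bool) : ℂ :=
  ∏ x, if s x = false then (-τ) ^ x.1 else 1

theorem weight_ne_zero (h0 : τ ≠ 0) (s : Fin n → Bool) : weight τ s ≠ 0 := by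
  refine Finset.prod_ne_zero_iff.2 fun x _ => ?_
  split_ifs
  · exact pow_ne_zero _ (neg_ne_zero.2 h0)
  · exact one_ne_zero

theorem weight_eq (s : Fin n → Bool)
    (hs : s ⟨i, Nat.lt_of_succ_lt h⟩ = true) (hs' : s ⟨i + 1, h⟩ = false) :
    weight τ s = -τ * weight τ (s ∘ adj h) := by
  have e1 := adj_left h s
  have e2 := adj_right h s
  have e3 := fun x => adj_of_ne h s (x := x)
  have hpq : (⟨i, Nat.lt_of_succ_lt h⟩ : Fin n) ≠ ⟨i + 1, h⟩ := by simp
  unfold weight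
  rw [← Finset.prod_mul_prod_compl {⟨i, Nat.lt_of_succ_lt h⟩, ⟨i + 1, h⟩},
    ← Finset.prod_mul_prod_compl {⟨i, Nat.lt_of_succ_lt h⟩, ⟨i + 1, h⟩}
      (fun x => if (s ∘ adj h) x = false then (-τ) ^ x.1 else 1), Finset.prod_pair hpq,
    Finset.prod_pair hpq, e1, e2, hs, hs', Finset.prod_congr rfl fun x hx => by
      rw [← e3 x (fun h => by simp [h] at hx) (fun h => by simp [h] at hx)]]
  simp only [Bool.true_eq_false, if_true, if_false]
  ring

/-- Annihilation by the generator says that the values at two words differing by an adjacent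
exchange have ratio -τ, and the weight has the same ratio. Cross-multiplication also covers equal
letters. -/
theorem hvec_mul_weight_adj (h0 : τ ≠ 0) (f : Hom 0 n)
    (hf : comp τ (bas (Diagram.gen n i h)) f = 0) (s : Fin n → Bool) :
    hvec τ s f * weight τ (s ∘ adj h) = hvec τ (s ∘ adj h) f * weight τ s := by
  have key : ∀ s : Fin n → Bool, s ⟨i, Nat.lt_of_succ_lt h⟩ = true → s ⟨i + 1, h⟩ = false →
      hvec τ s f * weight τ (s ∘ adj h) = hvec τ (s ∘ adj h) f * weight τ s := by
    intro s hs hs'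
    have h1 := hvec_gen_comp h h0 f s hs hs'
    rw [hf, map_zero] at h1
    rw [weight_eq h s hs hs', eq_neg_of_add_eq_zero_right h1.symm]
    field_simp
  have e1 := adj_left h s
  have e2 := adj_right h s
  by_cases he : s ⟨i, Nat.lt_of_succ_lt h⟩ = s ⟨i + 1, h⟩
  · have : s ∘ adj h = s := by
      funext x
      by_cases h1 : x = ⟨i, Nat.lt_of_succ_lt h⟩
      · rw [h1, e1, he]
      by_cases h2 : x = ⟨i + 1, h⟩
      · rw [h2, e2, he]
      exact adj_of_ne h s h1 h2
    rw [this]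
  · rcases hs : s ⟨i, Nat.lt_of_succ_lt h⟩
    · have hs' : s ⟨i + 1, h⟩ = true := by
        rw [hs] at he
        simpa using Ne.symm he
      have := key (s ∘ adj h) (by rw [e1, hs']) (by rw [e2, hs])
      rw [adj_adj] at this
      exact this.symm
    · have hs' : s ⟨i + 1, h⟩ = false := by
        rw [hs] at he
        simpa using Ne.symm he
      exact key s hs hs'

end

variable {τ : ℂ} {n : ℕ}

/-- Up to the weight, the function of a vector annihilated by the generators is symmetric. -/
theorem hvec_mul_weight_perm (h0 : τ ≠ 0) (f : Hom 0 n)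
    (hf : ∀ i h, comp τ (bas (Diagram.gen n i h)) f = 0) (s : Fin n → Bool)
    (σ : Equiv.Perm (Fin n)) :
    hvec τ s f * weight τ (s ∘ σ) = hvec τ (s ∘ σ) f * weight τ s := by
  rcases n with _ | n
  · rw [Subsingleton.elim (s ∘ σ) s]
  -- Adjacent transpositions generate the symmetric group, already as a monoid.
  have hσ : σ ∈ Submonoid.closure
      (Set.range fun i : Fin n => Equiv.swap i.castSucc i.succ) := by
    rw [Equiv.Perm.mclosure_swap_castSucc_succ]
    trivial
  induction hσ using Submonoid.closure_induction generalizing s with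
  | mem σ hσ =>
    obtain ⟨i, rfl⟩ := hσ
    exact hvec_mul_weight_adj (i := i.1) (Nat.succ_lt_succ i.2) h0 f (hf _ _) s
  | one => rfl
  | mul σ ρ _ _ ih1 ih2 =>
    have h1 := ih1 s
    have h2 := ih2 (s ∘ σ)
    rw [Equiv.Perm.coe_mul, ← Function.comp_assoc]
    have h3 := weight_ne_zero h0 (s ∘ σ)
    apply mul_right_cancel₀ h3
    linear_combination weight τ ((s ∘ ⇑σ) ∘ ⇑ρ) * h1 + weight τ s * h2

/-- Exchanging mates would be a bijection between the two letters. -/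
theorem vec_eq_zero_of_card_ne (a : Diagram 0 n) (s : Fin n → Bool)
    (hs : 2 * Fintype.card {x // s x = false} ≠ n) : vec τ a s = 0 := by
  refine if_neg fun h => hs ?_
  have h1 : Fintype.card {x // s x = false} = Fintype.card {x // ¬ s x = false} :=
    Fintype.card_congr (a.matePerm.subtypeEquiv fun x => by
      change _ ↔ ¬ s (a.mate x) = false
      rw [h]
      simp)
  have h2 := Fintype.card_subtype_compl fun x => s x = false
  have h3 := Fintype.card_subtype_le fun x => s x = false
  rw [Fintype.card_fin] at h2 h3
  omega

theorem hvec_eq_zero_of_card_ne (f : Hom 0 n) (s : Fin n → Bool)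
    (hs : 2 * Fintype.card {x // s x = false} ≠ n) : hvec τ s f = 0 := by
  induction f using hom_induction with
  | zero => simp
  | add f g hf hg => simp [hf, hg]
  | smul c f hf => simp [hf]
  | bas a => rw [hvec_bas, vec_eq_zero_of_card_ne a s hs]

theorem exists_perm_of_card_eq (s t : Fin n → Bool)
    (h : Fintype.card {x // s x = false} = Fintype.card {x // t x = false}) :
    ∃ σ : Equiv.Perm (Fin n), t = s ∘ σ := by
  obtain ⟨e⟩ := Fintype.card_eq.1 h.symm
  refine ⟨e.extendSubtype, funext fun x => ?_⟩
  rcases hx : t x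
  · exact (e.extendSubtype_mem x hx).symm
  · exact (Bool.eq_true_of_not_eq_false (e.extendSubtype_not_mem x (by simp [hx]))).symm

/-! ### A functional that annihilates the cup diagrams -/

/-- More than A points lie beyond the first A, so they cannot all be joined into that prefix. Some
cup therefore lies entirely beyond it, and an innermost cup below that one joins neighbours. -/
theorem Diagram.exists_mate_eq_succ (a : Diagram 0 n) (A : ℕ) (hA : 2 * A < n) :
    ∃ i, ∃ h : i + 1 < n, A ≤ i ∧ a.mate ⟨i, Nat.lt_of_succ_lt h⟩ = ⟨i + 1, h⟩ := by
  have h1 : ∃ x : Fin n, A ≤ x.1 ∧ x.1 < (a.mate x).1 := by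
    by_contra! hc
    have h2 : ∀ x : Fin n, A ≤ x.1 → (a.mate x).1 < A := fun x hx => by
      by_contra! h3
      have h4 := hc x hx
      have h5 := hc _ h3
      rw [a.mate_mate] at h5
      exact a.mate_ne x (Fin.ext (le_antisymm h4 h5))
    have h3 := Finset.card_le_card_of_injOn (s := Finset.Ico A n) (t := Finset.range A)
      (fun x => if hx : x < n then (a.mate ⟨x, hx⟩).1 else 0) (by
        intro x hx
        simp only [Finset.coe_Ico, Set.mem_Ico] at hx
        simpa [hx.2] using h2 ⟨x, hx.2⟩ hx.1) (by
        intro x hx y hy hxy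
        simp only [Finset.coe_Ico, Set.mem_Ico] at hx hy
        simp only [hx.2, hy.2, dif_pos] at hxy
        have := a.mate_injective (Fin.ext hxy)
        exact congrArg Fin.val this)
    simp only [Nat.card_Ico, Finset.card_range] at h3
    omega
  have key : ∀ (d : ℕ) (x : Fin n), A ≤ x.1 → x.1 < (a.mate x).1 → (a.mate x).1 - x.1 ≤ d →
      ∃ i, ∃ h : i + 1 < n, A ≤ i ∧ a.mate ⟨i, Nat.lt_of_succ_lt h⟩ = ⟨i + 1, h⟩ := by
    intro d
    induction d with
    | zero => intro x _ _ _; omega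
    | succ d ih =>
      intro x hx hlt hd
      have hy : x.1 + 1 < n := by omega
      by_cases he : a.mate x = ⟨x.1 + 1, hy⟩
      · exact ⟨x.1, hy, hx, he⟩
      set z : Fin n := ⟨x.1 + 1, hy⟩ with hz
      have hzv : z.1 = x.1 + 1 := rfl
      have n1 := a.mate_noncrossing x z
      have n2 := a.mate_noncrossing (a.mate z) x
      have e := a.mate_mate z
      rw [e] at n2
      have h3 : a.mate z ≠ x := fun h => he (by rw [← h, e])
      have h4 : a.mate z ≠ a.mate x := fun h => by
        have := congrArg Fin.val (a.mate_injective h)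
        omega
      have h5 := a.mate_ne z
      rw [Ne, Fin.ext_iff] at h3 h4 h5
      rw [Fin.ext_iff] at he
      exact ih z (by omega) (by omega) (by omega)
  obtain ⟨x, hx, hlt⟩ := h1
  exact key _ x hx hlt le_rfl

-- A cup at neighbouring positions beyond the prefix allows the words to be paired by exchanging its
-- two letters. The exchange preserves the prefix condition, and the factors -τ of the weight and τ
-- of the cup make the paired terms cancel.
open Classical in
theorem sum_weight_mul_hvec (f : Hom 0 n) (A : ℕ) (hA : 2 * A < n) :
    ∑ s : Fin n → Bool, (if ∀ x, x.1 < A → s x = false then weight τ s else 0) * hvec τ s f =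
      0 := by
  induction f using hom_induction with
  | zero => simp
  | add f g hf hg => simp only [map_add, mul_add, Finset.sum_add_distrib, hf, hg, add_zero]
  | smul c f hf =>
    simp only [map_smul, smul_eq_mul, mul_left_comm _ c, ← Finset.mul_sum, hf, mul_zero]
  | bas a =>
    simp only [hvec_bas]
    obtain ⟨i, h, hi, ha⟩ := a.exists_mate_eq_succ A hA
    have hadj : ∀ s : Fin n → Bool, (∀ x, x.1 < A → (s ∘ adj h) x = false) ↔
        ∀ x, x.1 < A → s x = false := by
      intro s
      refine forall_congr' fun x => forall_congr' fun hx => ?_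
      rw [adj_of_ne h s (fun e => by rw [e] at hx; exact absurd hx (by simpa using hi))
        (fun e => by rw [e] at hx; simp at hx; omega)]
    have key : ∀ s : Fin n → Bool, s ⟨i, Nat.lt_of_succ_lt h⟩ = true → s ⟨i + 1, h⟩ = false →
        weight τ s * vec τ a s + weight τ (s ∘ adj h) * vec τ a (s ∘ adj h) = 0 := by
      intro s hs hs'
      rw [weight_eq h s hs hs', vec_adj_of_mate h a ha s hs hs']
      ring
    have hself : ∀ s : Fin n → Bool, s ⟨i, Nat.lt_of_succ_lt h⟩ = s ⟨i + 1, h⟩ →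
        vec τ a s = 0 := by
      intro s he
      refine if_neg fun hc => ?_
      have := hc ⟨i, Nat.lt_of_succ_lt h⟩
      rw [ha, he] at this
      simp at this
    refine Finset.sum_involution (fun s _ => s ∘ adj h) ?_ ?_ (fun s _ => Finset.mem_univ _)
      (fun s _ => adj_adj h s)
    · intro s _
      simp only [hadj]
      split_ifs
      · have e1 := adj_left h s
        have e2 := adj_right h s
        by_cases he : s ⟨i, Nat.lt_of_succ_lt h⟩ = s ⟨i + 1, h⟩
        · rw [hself s he, hself _ (by rw [e1, e2, he])]
          simp
        rcases hs : s ⟨i, Nat.lt_of_succ_lt h⟩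
        · have hs' : s ⟨i + 1, h⟩ = true := by
            rw [hs] at he
            simpa using Ne.symm he
          have := key (s ∘ adj h) (by rw [e1, hs']) (by rw [e2, hs])
          rw [adj_adj] at this
          rw [add_comm]
          exact this
        · exact key s hs (by rw [hs] at he; simpa using Ne.symm he)
      · simp
    · intro s _ hne he
      apply hne
      rw [hself s (by
        have := congrFun he ⟨i, Nat.lt_of_succ_lt h⟩
        rw [adj_left] at this
        exact this.symm), mul_zero]

end TemperleyLieb

namespace TemperleyLieb

/-! ### The value of the functional -/

open Polynomial in
/-- The generating polynomial of the Gaussian binomial coefficients, shifted by `A`. -/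
noncomputable def gaussPoly (Q : ℂ) (A N : ℕ) : ℂ[X] :=
  ∏ j ∈ Finset.range N, (C (Q ^ (A + j)) * X + 1)

section

open Polynomial

variable {Q : ℂ} {A N : ℕ}

theorem gaussPoly_succ : gaussPoly Q A (N + 1) =
    gaussPoly Q A N * (C (Q ^ (A + N)) * X + 1) := Finset.prod_range_succ _ _

theorem coeff_gaussPoly_zero : (gaussPoly Q A N).coeff 0 = 1 := by
  rw [coeff_zero_eq_eval_zero, gaussPoly, eval_prod]
  simp

theorem coeff_gaussPoly_one : (gaussPoly Q A N).coeff 1 =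
    Q ^ A * ∑ j ∈ Finset.range N, Q ^ j := by
  induction N with
  | zero => simp [gaussPoly, coeff_one]
  | succ N ih =>
    rw [gaussPoly_succ, mul_add, mul_one, coeff_add, ih, mul_left_comm, coeff_C_mul, coeff_mul_X,
      coeff_gaussPoly_zero, Finset.sum_range_succ]
    ring

theorem coeff_gaussPoly_of_lt {r : ℕ} (h : N < r) : (gaussPoly Q A N).coeff r = 0 := by
  induction N generalizing r with
  | zero => simp [gaussPoly, coeff_one, h.ne']
  | succ N ih =>
    obtain ⟨r, rfl⟩ : ∃ k, r = k + 1 := ⟨r - 1, by omega⟩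
    rw [gaussPoly_succ, mul_add, mul_one, coeff_add, ih (by omega), mul_left_comm, coeff_C_mul,
      coeff_mul_X, ih (by omega)]
    simp

/-- The coefficients in ℓ consecutive factors run through all ℓ-th roots of unity; oddness of ℓ
gives the plus sign in 1 + X^ℓ. -/
theorem gaussPoly_add_period {ℓ : ℕ} (hodd : Odd ℓ) (hQ : IsPrimitiveRoot Q ℓ) :
    gaussPoly Q A (N + ℓ) = gaussPoly Q A N * (1 + X ^ ℓ) := by
  rw [gaussPoly, Finset.prod_range_add, ← gaussPoly]
  congr 1
  have hC : IsPrimitiveRoot (C Q) ℓ := hQ.map_of_injective C_injective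
  have h1 := hC.pow_add_pow_eq_prod_add_mul (1 : ℂ[X]) (C (Q ^ (A + N)) * X) hodd
  rw [one_pow, mul_pow, ← C_pow, ← pow_mul, mul_comm (A + N), pow_mul, hQ.pow_eq_one, one_pow, C_1,
    one_mul] at h1
  classical
  rw [h1, nthRootsFinset_def, hC.nthRoots_eq (one_pow ℓ)]
  simp only [mul_one]
  conv_rhs => rw [Finset.prod]
  rw [Multiset.toFinset_val, Multiset.dedup_eq_self.2, Multiset.map_map]
  · refine Finset.prod_congr rfl fun j _ => ?_
    simp only [Function.comp, ← C_pow, ← mul_assoc, ← C_mul, ← pow_add]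
    rw [add_comm 1, add_comm j, add_assoc]
  · refine (Multiset.nodup_map_iff_inj_on (Multiset.nodup_range ℓ)).2 fun i hi j hj h => ?_
    exact hC.pow_inj (Multiset.mem_range.1 hi) (Multiset.mem_range.1 hj) h

/-- The coefficient counts the full periods among the factors, a natural number that cannot vanish
in characteristic zero once there is one. -/
theorem coeff_gaussPoly_period {ℓ : ℕ} (hodd : Odd ℓ) (hQ : IsPrimitiveRoot Q ℓ) :
    ∃ c : ℕ, (gaussPoly Q A N).coeff ℓ = c ∧ (ℓ ≤ N → c ≠ 0) := by
  induction N using Nat.strong_induction_on with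
  | _ N ih =>
    by_cases h : ℓ ≤ N
    · obtain ⟨N, rfl⟩ := Nat.exists_eq_add_of_le' h
      obtain ⟨c, hc, -⟩ := ih N (by have := hodd.pos; omega)
      refine ⟨c + 1, ?_, fun _ => Nat.succ_ne_zero c⟩
      rw [gaussPoly_add_period hodd hQ, mul_add, mul_one, coeff_add, hc,
        coeff_mul_X_pow', if_pos le_rfl, Nat.sub_self, coeff_gaussPoly_zero]
      simp
    · exact ⟨0, by rw [coeff_gaussPoly_of_lt (by omega)]; simp, fun h' => absurd h' h⟩

-- Expanding the product chooses a letter at each position, X marking `false`; the zero summand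
-- forbids `true` inside the prefix.
open Classical in
theorem sum_prefix_eq_coeff (n k : ℕ) : ∑ s : Fin n → Bool,
    (if (∀ x, x.1 < A → s x = false) ∧ Fintype.card {x // s x = false} = k then
      ∏ x, (if s x = false then Q ^ x.1 else 1) else 0) =
    (∏ x : Fin n, (C (Q ^ x.1) * X + if x.1 < A then 0 else 1)).coeff k := by
  have h1 : ∀ x : Fin n, (C (Q ^ x.1) * X + if x.1 < A then 0 else 1 : ℂ[X]) =
      ∑ c : Bool, if c = false then C (Q ^ x.1) * X else if x.1 < A then 0 else 1 := by
    intro x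
    rw [Fintype.sum_bool, add_comm]
    simp
  rw [Finset.prod_congr rfl fun x _ => h1 x, Fintype.prod_sum, finsetSum_coeff]
  refine Finset.sum_congr rfl fun s _ => ?_
  by_cases hs : ∀ x, x.1 < A → s x = false
  · have h2 : ∀ x : Fin n, (if s x = false then C (Q ^ x.1) * X else if x.1 < A then 0 else 1) =
        C (if s x = false then Q ^ x.1 else 1) * (if s x = false then X else 1 : ℂ[X]) := by
      intro x
      by_cases h : s x = false
      · simp [h]
      · rw [if_neg h, if_neg h, if_neg h, if_neg fun h' => h (hs x h')]
        simp
    rw [Finset.prod_congr rfl fun x _ => h2 x, Finset.prod_mul_distrib, ← map_prod, coeff_C_mul,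
      Finset.prod_ite (fun _ => X) (fun _ => 1), Finset.prod_const, Finset.prod_const_one, mul_one,
      coeff_X_pow, ← Fintype.card_subtype]
    by_cases hk : Fintype.card {x // s x = false} = k
    · rw [if_pos ⟨hs, hk⟩, if_pos hk.symm, mul_one]
    · rw [if_neg fun h => hk h.2, if_neg (Ne.symm hk), mul_zero]
  · rw [if_neg fun h => hs h.1]
    push Not at hs
    obtain ⟨x, hx, hx'⟩ := hs
    rw [Finset.prod_eq_zero (Finset.mem_univ x), coeff_zero]
    rw [if_neg hx', if_pos hx]

theorem prod_prefix (n : ℕ) (r : ℕ) (h : A ≤ n) :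
    (∏ x : Fin n, (C (Q ^ x.1) * X + if x.1 < A then 0 else 1)).coeff (A + r) =
      (∏ j ∈ Finset.range A, Q ^ j) * (gaussPoly Q A (n - A)).coeff r := by
  obtain ⟨N, rfl⟩ := Nat.exists_eq_add_of_le h
  rw [Finset.prod_range (fun x => (C (Q ^ x) * X + if x < A then 0 else 1 : ℂ[X])) |>.symm,
    Finset.prod_range_add, Finset.prod_congr rfl fun x hx => by
      rw [if_pos (Finset.mem_range.1 hx), add_zero], Finset.prod_mul_distrib, Finset.prod_const,
    Finset.card_range, ← map_prod, mul_assoc, coeff_C_mul, mul_comm (X ^ A), add_comm A r,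
    coeff_mul_X_pow, gaussPoly, Nat.add_sub_cancel_left]
  simp

end

variable {τ : ℂ}

open Classical in
/-- A vector annihilated by the generators vanishes if the functional does not annihilate the
symmetric word. -/
theorem eq_zero_of_coeff_ne_zero (h0 : τ ≠ 0) {A r : ℕ} (hr : 0 < r)
    (hc : (gaussPoly (τ ^ 2) A (A + 2 * r)).coeff r ≠ 0) (f : Hom 0 (2 * (A + r)))
    (hf : ∀ i h, comp τ (bas (Diagram.gen _ i h)) f = 0) : f = 0 := by
  by_contra hne
  obtain ⟨t, ht⟩ : ∃ t, hvec τ t f ≠ 0 := by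
    by_contra! h
    exact hne (eq_zero_of_hvec_eq_zero τ f h)
  have htc : Fintype.card {x // t x = false} = A + r := by
    by_contra h
    exact ht (hvec_eq_zero_of_card_ne f t (by omega))
  have hw := weight_ne_zero h0 t
  -- All balanced words are permutations of t, so f is a constant multiple of the weight on them.
  have hv : ∀ s : Fin (2 * (A + r)) → Bool, Fintype.card {x // s x = false} = A + r →
      hvec τ s f = hvec τ t f / weight τ t * weight τ s := by
    intro s hs
    obtain ⟨σ, rfl⟩ := exists_perm_of_card_eq t s (by rw [htc, hs])
    have := hvec_mul_weight_perm h0 f hf t σ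
    field_simp
    exact this.symm
  have h1 := sum_weight_mul_hvec (τ := τ) f A (by omega)
  -- One weight comes from the functional and one from f; squaring -τ gives Q = τ².
  have h2 : ∀ s : Fin (2 * (A + r)) → Bool,
      (if ∀ x, x.1 < A → s x = false then weight τ s else 0) * hvec τ s f =
      hvec τ t f / weight τ t *
        if (∀ x, x.1 < A → s x = false) ∧ Fintype.card {x // s x = false} = A + r then
          ∏ x, (if s x = false then (τ ^ 2) ^ x.1 else 1) else 0 := by
    intro s
    by_cases h3 : Fintype.card {x // s x = false} = A + r
    · rw [hv s h3]
      by_cases h4 : ∀ x, x.1 < A → s x = false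
      · rw [if_pos h4, if_pos ⟨h4, h3⟩, mul_left_comm]
        congr 1
        rw [weight, ← Finset.prod_mul_distrib]
        refine Finset.prod_congr rfl fun x _ => ?_
        split_ifs
        · rw [← mul_pow]
          ring
        · rw [mul_one]
      · rw [if_neg h4, if_neg fun h => h4 h.1, zero_mul, mul_zero]
    · rw [hvec_eq_zero_of_card_ne f s (by omega), mul_zero,
        if_neg (c := _ ∧ _) fun h => h3 h.2, mul_zero]
  rw [Finset.sum_congr rfl fun s _ => h2 s, ← Finset.mul_sum, sum_prefix_eq_coeff,
    prod_prefix _ _ (by omega)] at h1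
  rw [show 2 * (A + r) - A = A + 2 * r by omega] at h1
  refine mul_ne_zero (div_ne_zero ht hw) (mul_ne_zero ?_ hc) h1
  exact Finset.prod_ne_zero_iff.2 fun j _ => pow_ne_zero _ (pow_ne_zero _ h0)

/-- Vectors annihilated by the generators exist only on `2 ℓ - 2` points. -/
theorem eq_zero_of_gen_comp_eq_zero {ℓ : ℕ} (hodd : Odd ℓ) (hτ : IsPrimitiveRoot (τ ^ 2) ℓ)
    {k : ℕ} (hk : 0 < k) (hkl : k + 1 ≠ ℓ) (f : Hom 0 (2 * k))
    (hf : ∀ i h, comp τ (bas (Diagram.gen _ i h)) f = 0) : f = 0 := by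
  have h0 : τ ≠ 0 := fun h => by
    have := hτ.ne_zero hodd.pos.ne'
    simp [h] at this
  by_cases hdvd : ℓ ∣ k + 1
  · obtain ⟨c, hc⟩ := hdvd
    -- Here r = ℓ: as k + 1 is a multiple of ℓ other than ℓ, it is at least 2ℓ, which leaves room
    -- for a prefix.
    obtain ⟨A, rfl⟩ : ∃ A, k = A + ℓ := Nat.exists_eq_add_of_le' (by
      have : c ≠ 1 := fun h => hkl (by rw [hc, h, mul_one])
      have : c ≠ 0 := fun h => by simp [h] at hc
      have h2 : ℓ * 2 ≤ ℓ * c := Nat.mul_le_mul_left _ (by omega)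
      have := hodd.pos
      omega)
    refine eq_zero_of_coeff_ne_zero h0 hodd.pos ?_ f hf
    obtain ⟨c, hc, hc'⟩ := coeff_gaussPoly_period (A := A) (N := A + 2 * ℓ) hodd hτ
    rw [hc]
    exact Nat.cast_ne_zero.2 (hc' (by omega))
  -- Here r = 1: up to a unit the coefficient is 1 + Q + ... + Q^k, which is non-zero because
  -- Q^(k+1) is not 1.
  · obtain ⟨A, rfl⟩ : ∃ A, k = A + 1 := Nat.exists_eq_add_of_le' hk
    refine eq_zero_of_coeff_ne_zero h0 one_pos ?_ f hf
    rw [coeff_gaussPoly_one]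
    refine mul_ne_zero (pow_ne_zero _ (pow_ne_zero _ h0)) fun h => hdvd ?_
    rw [← hτ.pow_eq_one_iff_dvd, ← sub_eq_zero, ← geom_sum_mul]
    erw [h]
    rw [zero_mul]

end TemperleyLieb

namespace TemperleyLieb

/-! ### Classification of the ideals -/

variable {τ : ℂ} {J : EvenSubspace}

theorem IsIdeal.bend_mem (hJ : IsIdeal τ J) {m n : EvenObj} {a : EvenHom m n} (ha : a ∈ J m n) :
    comp τ (tensor (idh m.1) a) (bas (Diagram.cup m.1)) ∈ J ⟨0, Even.zero⟩ (m.tensor n) :=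
  hJ.comp_right (l := ⟨0, Even.zero⟩) (m := m.tensor m) (n := m.tensor n) _ _
    (hJ.tensor_left (m := m) (n := m) (idh m.1) a ha)

/-- A proper non-zero ideal contains a morphism without top points such that all morphisms in the
ideal with fewer points vanish. -/
theorem IsIdeal.exists_minimal (hJ : IsIdeal τ J) (hb : J ≠ ⊥) (ht : J ≠ ⊤) :
    ∃ k : ℕ, 0 < k ∧ (∃ f ∈ J ⟨0, Even.zero⟩ ⟨2 * k, even_two_mul k⟩, f ≠ 0) ∧
      ∀ m n : EvenObj, m.1 + n.1 < 2 * k → J m n = ⊥ := by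
  classical
  have h1 : ∃ k : ℕ, ∃ f ∈ J ⟨0, Even.zero⟩ ⟨2 * k, even_two_mul k⟩, f ≠ 0 := by
    by_contra! hc
    apply hb
    ext m n f
    refine ⟨fun hf => ?_, fun hf => by rw [(Submodule.mem_bot ℂ).1 hf]; exact zero_mem _⟩
    obtain ⟨k, hk⟩ := (m.2.add n.2).two_dvd
    have h2 := hJ.bend_mem hf
    have h3 : ∀ N : EvenObj, N.1 = 2 * k → ∀ g ∈ J ⟨0, Even.zero⟩ N, g = 0 := by
      rintro ⟨_, hN⟩ rfl g hg
      exact hc k g hg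
    have h4 := h3 (m.tensor n) hk _ h2
    exact bend_injective τ (h4.trans (by simp; rfl))
  refine ⟨Nat.find h1, ?_, Nat.find_spec h1, fun m n hmn => ?_⟩
  -- For k = 0 the ideal would contain a non-zero multiple of the identity of 0 and be everything.
  · by_contra h0
    obtain ⟨f, hf, hne⟩ := Nat.find_spec h1
    have h2 : ∀ N : EvenObj, N.1 = 0 → ∀ g ∈ J ⟨0, Even.zero⟩ N, g = 0 := by
      rintro ⟨_, hN⟩ rfl (g : Hom 0 0) hg
      by_contra hg0
      apply ht
      apply hJ.eq_top
      have hu : ∀ a : Diagram 0 0, a = Diagram.one 0 := fun a =>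
        Diagram.ext (funext fun x => by rcases x with x | x <;> exact x.elim0)
      have h3 : g = g (Diagram.one 0) • idh 0 := by
        ext a
        rw [hu a]
        simp [idh, bas]
      rw [h3] at hg
      refine (Submodule.smul_mem_iff _ fun h => hg0 ?_).1 hg
      rw [h3, h, zero_smul]
    exact hne (h2 _ (by simpa using h0) f hf)
  · obtain ⟨k, hk⟩ := (m.2.add n.2).two_dvd
    have h2 := Nat.find_min h1 (m := k) (by omega)
    push Not at h2
    rw [Submodule.eq_bot_iff]
    intro f hf
    have h3 : ∀ N : EvenObj, N.1 = 2 * k → ∀ g ∈ J ⟨0, Even.zero⟩ N, g = 0 := by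
      rintro ⟨_, hN⟩ rfl g hg
      exact h2 g hg
    have h4 := h3 (m.tensor n) hk _ (hJ.bend_mem hf)
    exact bend_injective τ (h4.trans (by simp; rfl))

/-- The generator factors through N - 2 points, and the first half of the factorisation already
lands in a zero space of the ideal. -/
theorem IsIdeal.gen_comp_eq_zero (hJ : IsIdeal τ J) {m : EvenObj} {N : ℕ} (hN : Even N)
    (hmin : ∀ n : EvenObj, n.1 < N → J m n = ⊥) (f : EvenHom m ⟨N, hN⟩)
    (hf : f ∈ J m ⟨N, hN⟩) (i : ℕ) (h : i + 1 < N) :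
    comp τ (bas (Diagram.gen N i h)) f = 0 := by
  obtain ⟨N, rfl⟩ : ∃ M, N = M + 2 := ⟨N - 2, by omega⟩
  have hN' : Even N := by simpa [Nat.even_add] using hN
  obtain ⟨u, c, hg⟩ := exists_gen_eq_comp τ N i h
  have h1 := hJ.comp_left (n := ⟨N, hN'⟩) c f hf
  rw [hmin ⟨N, hN'⟩ (by simp), Submodule.mem_bot] at h1
  have h2 := comp_assoc τ u c f
  rw [h1, map_zero] at h2
  rw [hg, ← h2]

/-- The only proper non-zero ideal is formed by the negligible morphisms. -/
theorem IsIdeal.eq_negligible {ℓ : ℕ} (hodd : Odd ℓ) (hone : 1 < ℓ)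
    (hτ : IsPrimitiveRoot (τ ^ 2) ℓ) (hd : loopValue τ ≠ 0)
    (hq : ∀ k, 1 ≤ k → k ≤ ℓ - 1 → qint τ k ≠ 0)
    (hJ : IsIdeal τ J) (hb : J ≠ ⊥) (ht : J ≠ ⊤) : J = negligible τ := by
  obtain ⟨k, hk, ⟨f, hf, hne⟩, hmin⟩ := hJ.exists_minimal hb ht
  have hfg := hJ.gen_comp_eq_zero (even_two_mul k) (fun n hn => hmin _ n (by simpa using hn)) f hf
  have hkl : k + 1 = ℓ := by
    by_contra h
    exact hne (eq_zero_of_gen_comp_eq_zero hodd hτ hk h f hfg)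
  -- The parity of ℓ enters here: k strands form an object of the even category, so f can be bent
  -- into an endomorphism of it.
  have hke : Even k := by
    rw [← hkl] at hodd
    simpa [Nat.odd_add_one] using hodd
  subst hkl
  rw [Nat.add_sub_cancel] at hq
  refine le_antisymm (hJ.le_negligible ht) (hJ.negligible_le hd hq hke hk ?_)
  obtain ⟨g, hg, hgne⟩ : ∃ g : Hom 0 (k + k), g ∈ J ⟨0, Even.zero⟩ ⟨k + k, hke.add hke⟩ ∧ g ≠ 0 := by
    have h3 : ∀ N : EvenObj, 2 * k = N.1 → ∃ g ∈ J ⟨0, Even.zero⟩ N, g ≠ 0 := by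
      rintro ⟨_, hN⟩ rfl
      exact ⟨f, hf, hne⟩
    exact h3 ⟨k + k, hke.add hke⟩ (two_mul k)
  set x : EvenObj := ⟨k, hke⟩ with hx
  have ha : comp τ (bas (Diagram.capL k k)) (tensor (idh k) g) ∈ J x x :=
    hJ.comp_left (l := x) (m := x.tensor (x.tensor x)) (n := x) (bas (Diagram.capL k k)) _
      (hJ.tensor_left (m := x) (n := x) (m' := ⟨0, Even.zero⟩) (n' := x.tensor x) (idh k) g hg)
  have hane : comp τ (bas (Diagram.capL k k)) (tensor (idh k) g) ≠ 0 := fun h =>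
    hgne (unbend_injective τ (h.trans (by simp)))
  generalize comp τ (bas (Diagram.capL k k)) (tensor (idh k) g) = a at ha hane
  have h1 := hJ.gen_comp_eq_zero hke (fun n hn => hmin x n (by simp only [hx]; omega)) a ha
  -- The projection fixes `a`, yet multiplies it into a scalar multiple of itself; so `a` is such a
  -- multiple, and the scalar is non-zero.
  have h2 := jw_comp_eq_self a h1
  have h3 := jw_comp_eq_smul hd hq a
  rw [h2] at h3
  rw [h3] at ha
  refine (Submodule.smul_mem_iff _ fun h => hane ?_).1 ha
  rw [h3, h, zero_smul]

end TemperleyLieb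

/-! ### The main theorem. -/

theorem mainTheorem3 (τ : ℂ) (ℓ : ℕ) (hodd : Odd ℓ) (hone : 1 < ℓ)
    (hτ : IsPrimitiveRoot (τ ^ 2) ℓ) :
    (TemperleyLieb.IsIdeal τ (TemperleyLieb.negligible τ) ∧
        TemperleyLieb.negligible τ ≠ ⊥ ∧ TemperleyLieb.negligible τ ≠ ⊤) ∧
      ∀ J : TemperleyLieb.EvenSubspace,
        TemperleyLieb.IsIdeal τ J → J ≠ ⊥ → J ≠ ⊤ → J = TemperleyLieb.negligible τ := by
  have hq : ∀ k, 1 ≤ k → k ≤ ℓ - 1 → TemperleyLieb.qint τ k ≠ 0 := fun k h1 h2 h => by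
    have := Nat.le_of_dvd h1 ((TemperleyLieb.qint_eq_zero_iff hone hτ k).1 h)
    omega
  have hd : TemperleyLieb.loopValue τ ≠ 0 := by
    -- The loop value is [2], which is non-zero because ℓ is at least 3.
    have h3 : ℓ ≠ 2 := by rintro rfl; exact absurd hodd (by decide)
    simpa [TemperleyLieb.qint] using hq 2 one_le_two (by omega)
  have hz : TemperleyLieb.qint τ (ℓ - 1 + 1) = 0 := by
    rw [Nat.sub_add_cancel hone.le, TemperleyLieb.qint_eq_zero_iff hone hτ]
  exact ⟨⟨TemperleyLieb.isIdeal_negligible τ,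
    TemperleyLieb.negligible_ne_bot hd hq hz (Nat.Odd.sub_odd hodd odd_one),
    TemperleyLieb.negligible_ne_top τ⟩,
    fun _ hJ hb ht => hJ.eq_negligible hodd hone hτ hd hq hb ht⟩
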